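/- Let $N\ge 1$, let $\Omega\subset\mathbb{R}^N$ be a bounded $C^{1,1}$ domain with outer unit normal $\nu$, let $0<\sigma<1$ and $s=1+\sigma$. Put $c_{N,\sigma}=\Big(\int_{\mathbb{R}^N}\frac{1-\cos\xi_1}{|\xi|^{N+2\sigma}}\,d\xi\Big)^{-1}$, $Q(\Omega)=\mathbb{R}^{2N}\setminus(\mathbb{R}^N\setminus\Omega)^2$ and, for $\mathcal A\subset\mathbb{R}^N$, a scalar or vector valued function $w$ and $x\notin\partial\mathcal A$, $$(-\Delta)^\sigma_{\mathcal A}w(x)=c_{N,\sigma}\lim_{\varepsilon\to0^+}\int_{\mathcal A\setminus B_\varepsilon(x)}\frac{w(x)-w(y)}{|x-y|^{N+2\sigma}}\,dy .$$ For a real-valued Schwartz function $u$ on $\mathbb{R}^N$ let $(-\Delta)^su=(-\Delta)^\sigma_{\mathbb{R}^N}(-\Delta u)$, $$\mathcal N^1_\sigma u=-\operatorname{div}\big((-\Delta)^\sigma_\Omega\nabla u\big)\ \text{ in }\mathbb{R}^N\setminus\overline\Omega,\qquad \mathcal N^2_\sigma u=(-\Delta)^\sigma_{\mathbb{R}^N\setminus\Omega}\nabla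 u\cdot\nu\ \text{ on }\partial\Omega,$$ the latter in the trace sense: $\mathcal N^2_\sigma u(x)=\lim_{t\to0,\,t\ne0}(-\Delta)^\sigma_{\mathbb{R}^N\setminus\Omega}\nabla u(x+t\nu(x))\cdot\nu(x)$ for $x\in\partial\Omega$. Let $u,v$ be real-valued Schwartz functions on $\mathbb{R}^N$ and suppose that $$\int_{\mathbb{R}^N\setminus\Omega}\big|\operatorname{div}\big((-\Delta)^\sigma_\Omega\nabla u\big)\big|\,dx<\infty .$$ Then the limit defining $\mathcal N^2_\sigma u(x)$ exists for every $x\in\partial\Omega$, the four integrals below converge absolutely, and $$\frac{c_{N,\sigma}}2\iint_{Q(\Omega)}\frac{(\nabla u(x)-\nabla u(y))\cdot(\nabla v(x)-\nabla v(y))}{|x-y|^{N+2\sigma}}\,dx\,dy=\int_\Omega v\,(-\Delta)^su\,dx+\int_{\mathbb{R}^N\setminus\Omega}v\,\mathcal N^1_\sigma u\,dx+\int_{\partial\Omega}v\,\mathcal N^2_\sigma u\,dS .$$ -/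

import Mathlib

open Set Filter Topology MeasureTheory
open scoped SchwartzMap NNReal Laplacian

noncomputable section

/-- The space `ℝ^N` with its Euclidean norm. -/
abbrev RN (N : ℕ) : Type := EuclideanSpace ℝ (Fin N)

/-- The normalization constant
`c_{N,σ} = (∫_{ℝ^N} (1 - cos ξ₁) / |ξ|^{N+2σ} dξ)⁻¹`. -/
def fracConst (N : ℕ) [NeZero N] (σ : ℝ) : ℝ :=
  (∫ ξ : RN N, (1 - Real.cos (ξ 0)) / ‖ξ‖ ^ ((N : ℝ) + 2 * σ))⁻¹

/-- The integral truncated at distance `ε` from `x`: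
`∫_{A ∖ B_ε(x)} (w(x) - w(y)) / |x - y|^{N+2σ} dy`, for scalar or vector valued `w`. -/
def truncatedRegional {N : ℕ} {F : Type*} [NormedAddCommGroup F] [NormedSpace ℝ F]
    (σ : ℝ) (A : Set (RN N)) (w : RN N → F) (x : RN N) (ε : ℝ) : F :=
  ∫ y in A \ Metric.ball x ε, (1 / ‖x - y‖ ^ ((N : ℝ) + 2 * σ)) • (w x - w y)

/-- The regional fractional Laplacian `(-Δ)^σ_A w (x)`, i.e. `c_{N,σ}` times the limit of the
truncated integrals as `ε → 0⁺`. -/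
def regionalFracLaplacian {N : ℕ} [NeZero N] {F : Type*} [NormedAddCommGroup F]
    [NormedSpace ℝ F] (σ : ℝ) (A : Set (RN N)) (w : RN N → F) (x : RN N) : F :=
  fracConst N σ • limUnder (𝓝[>] (0 : ℝ)) (truncatedRegional σ A w x)

/-- The fractional Laplacian of order `1 < s < 2`:
`(-Δ)^s u (x) = c_{N,s-1} P.V. ∫_{ℝ^N} ((-Δu)(x) - (-Δu)(y)) / |x - y|^{N+2(s-1)} dy`. -/
def higherFracLaplacian {N : ℕ} [NeZero N] (s : ℝ) (u : RN N → ℝ) (x : RN N) : ℝ :=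
  regionalFracLaplacian (s - 1) univ (fun z => -(Δ u) z) x

/-- The divergence `∑ᵢ ∂ᵢ Vᵢ` of a vector field. -/
def divergence {N : ℕ} (V : RN N → RN N) (x : RN N) : ℝ :=
  ∑ i, (fderiv ℝ V x (EuclideanSpace.single i 1)) i

/-- A bounded `C^{1,1}` domain: a bounded, connected, nonempty open set which near each boundary
point is, in suitable orthogonal coordinates, the strict subgraph of a `C¹` function with Lipschitz
derivative. Here `e` is the vertical direction and `e^⊥` the space of horizontal variables. -/
structure IsBoundedC11Domain {N : ℕ} (Ω : Set (RN N)) : Prop where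
  isOpen : IsOpen Ω
  isConnected : IsConnected Ω
  isBounded : Bornology.IsBounded Ω
  exists_graph : ∀ x ∈ frontier Ω, ∃ (r : ℝ) (e : RN N) (φ : (ℝ ∙ e)ᗮ → ℝ) (K : ℝ≥0),
    0 < r ∧ ‖e‖ = 1 ∧ ContDiff ℝ 1 φ ∧ LipschitzWith K (fderiv ℝ φ) ∧
    ∀ y ∈ Metric.ball x r, y ∈ Ω ↔ inner ℝ e y < φ ((ℝ ∙ e)ᗮ.orthogonalProjectionOnto y)

/-- `n` is the outer unit normal to `Ω` at `x`: near `x`, every cone of opening less than a half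
space around `-n` lies in `Ω`, and every such cone around `n` lies outside `Ω`. There is at most one
such `n`. -/
def IsOuterUnitNormal {N : ℕ} (Ω : Set (RN N)) (x n : RN N) : Prop :=
  ‖n‖ = 1 ∧ ∀ ε > 0, ∀ᶠ y in 𝓝 x,
    (inner ℝ (y - x) n < -ε * ‖y - x‖ → y ∈ Ω) ∧ (ε * ‖y - x‖ < inner ℝ (y - x) n → y ∉ Ω)

/-- The outer unit normal field `ν` of `∂Ω`. -/
def outerNormal {N : ℕ} (Ω : Set (RN N)) (x : RN N) : RN N :=
  Classical.epsilon (IsOuterUnitNormal Ω x)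

/-- `Q(Ω) = ℝ^{2N} ∖ (ℝ^N ∖ Ω)²`. -/
def crossSet {N : ℕ} (Ω : Set (RN N)) : Set (RN N × RN N) := (Ωᶜ ×ˢ Ωᶜ)ᶜ

/-- `𝒩¹_σ u = -div ((-Δ)^σ_Ω ∇u)`. -/
def neumannOne {N : ℕ} [NeZero N] (σ : ℝ) (Ω : Set (RN N)) (u : RN N → ℝ) (x : RN N) : ℝ :=
  -divergence (regionalFracLaplacian σ Ω (gradient u)) x

/-- The function `t ↦ (-Δ)^σ_{ℝ^N∖Ω} ∇u (x + t ν(x)) · ν(x)`, along the normal line at the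
boundary point `x`. -/
def normalProfile {N : ℕ} [NeZero N] (σ : ℝ) (Ω : Set (RN N)) (u : RN N → ℝ) (x : RN N)
    (t : ℝ) : ℝ :=
  inner ℝ (regionalFracLaplacian σ Ωᶜ (gradient u) (x + t • outerNormal Ω x)) (outerNormal Ω x)

/-- `𝒩²_σ u = (-Δ)^σ_{ℝ^N∖Ω} ∇u · ν` on `∂Ω`. The regional operator is only defined off `∂Ω`, so
this is the trace: the (two-sided) limit at `x` along the normal line. -/
def neumannTwo {N : ℕ} [NeZero N] (σ : ℝ) (Ω : Set (RN N)) (u : RN N → ℝ) (x : RN N) : ℝ :=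
  limUnder (𝓝[≠] (0 : ℝ)) (normalProfile σ Ω u x)

/-- The integrand
`(∇u(x) - ∇u(y)) · (∇v(x) - ∇v(y)) / |x - y|^{N+2σ}` of the energy form. -/
def energyIntegrand {N : ℕ} (σ : ℝ) (u v : RN N → ℝ) (p : RN N × RN N) : ℝ :=
  inner ℝ (gradient u p.1 - gradient u p.2) (gradient v p.1 - gradient v p.2) /
    ‖p.1 - p.2‖ ^ ((N : ℝ) + 2 * σ)

end

/-!
Up to the constant `c = c_{N,σ}`, the energy is a sum of two weak divergences: with
`V = (-Δ)^σ ∇u / c` on the whole space and `R = (-Δ)^σ_Ω ∇u / c` off `Ω`, half of the double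
integral equals `∫_Ω V·∇v + ∫_{Ωᶜ} R·∇v`, because `Q(Ω)` and the energy integrand are symmetric
under exchange of the two variables (`setIntegral_energyIntegrand`). Here `V` is written as an
absolutely convergent integral of second differences (`fracLap`), which makes it a `C¹` field with
`div V = -(-Δ)^s u / c`, while `R` is an absolutely convergent integral off the closure of `Ω`
(`regionalIntegral`). It is integrable over `Ωᶜ` since `Ω` and its complement interact finitely
through the kernel `min(|z|,1) |z|^{-(N+2σ)}` (`IsBoundedC11Domain.integrableOn_kernelMajorant`).
What remains is the divergence theorem for the field given by `V` inside and by `R` outside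
(`integral_jump`): the boundary term is the jump `(V - R)·ν` of the normal components, and
`c (V - R)` is the operator over `ℝ^N ∖ Ω`.

The boundary values of `R·ν` are the main difficulty, since for `σ ≥ 1/2` they do not exist in
general. Near a boundary point `p`, the integral that defines `R·ν` is compared with a model in
which `Ω` is replaced by its tangent half space at `p` and `∇u·ν` by its linearization. The
`C^{1,1}` regularity places `∂Ω` between two paraboloids tangent at `p`, and the strip between them
is thin enough for the difference to be dominated by a fixed integrable function
(`integrableOn_paraboloidStrip`, `abs_traceIntegrand_le`). By reflection, the model equals
`D²u(ν,ν)(p)` times a nonnegative quantity that depends only on the distance to the half space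
(`setIntegral_linear_halfSpace`). For `σ < 1/2` the model is itself dominated and need not be
subtracted. For `σ ≥ 1/2` that quantity tends to infinity at the boundary
(`exists_halfSpaceIntegral_ge`); if `D²u(ν,ν)` were nonzero at a boundary point, `R·ν` would blow up
with a fixed sign near it, whereas the divergence theorem with a cut-off bounds its averages by
means of the integrability of `div R` (`GraphChart.not_blowup`). So integrability of `div R` forces
`D²u(ν,ν) = 0` on `∂Ω` (`inner_fderiv_outerNormal_eq_zero`), and `R·ν` has boundary values in either
case (`hasNormalTrace_regionalIntegral`). From inside, the operator over `ℝ^N ∖ Ω` is itself a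
regional integral of the same kind, and its normal component has the same limit as from outside,
because the regularized integrals over `Ω` and over its complement add up to `V·ν`
(`regionalTrace_add_compl`, `tendsto_normalProfile`).

The divergence theorem is proved for `C¹` fields on the exterior whose normal component has bounded
limits along transversal directions (`HasNormalTrace.integral_exterior`). In graph coordinates a
smooth cut-off of the height turns the boundary term into averages of the flux through parallel
surfaces, and dominated convergence applies. A partition of unity globalizes the result, and the
area formula for graphs identifies the limit with an integral against the Hausdorff measure
(`comap_euclideanHausdorffMeasure_eq_withDensity`, `GraphChart.setIntegral_frontier`).
-/

open scoped Convolution Pointwise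

noncomputable section

/-! ### The kernel and its integrable majorants -/

/-- The singular kernel `K(z) = |z|^{-(N+2σ)}`. Its value at the origin is immaterial
for integration. -/
def fracKernel {N : ℕ} (σ : ℝ) (z : RN N) : ℝ := 1 / ‖z‖ ^ ((N : ℝ) + 2 * σ)

/-- The radial majorant `min(|z|^β, 1) |z|^{-(N+2σ)}`, written as a minimum of two powers. For
`0 < 2σ < β` the two exponents lie on either side of `-N`, and the majorant is integrable. -/
def kernelMajorant {N : ℕ} (σ β : ℝ) (z : RN N) : ℝ :=
  min (‖z‖ ^ (β - (N + 2 * σ))) (‖z‖ ^ (-((N : ℝ) + 2 * σ)))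

section Kernel
variable {N : ℕ} {σ β : ℝ}

lemma fracKernel_nonneg (z : RN N) : 0 ≤ fracKernel σ z := by unfold fracKernel; positivity

@[simp] lemma fracKernel_neg (z : RN N) : fracKernel σ (-z) = fracKernel σ z := by
  simp [fracKernel]

lemma fracKernel_sub_comm (x y : RN N) : fracKernel σ (x - y) = fracKernel σ (y - x) := by
  rw [← neg_sub, fracKernel_neg]

@[fun_prop]
lemma measurable_fracKernel : Measurable (fracKernel (N := N) σ) := by
  unfold fracKernel; fun_prop

lemma fracKernel_eq_rpow_neg (z : RN N) : fracKernel σ z = ‖z‖ ^ (-((N : ℝ) + 2 * σ)) := by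
  rw [fracKernel, Real.rpow_neg (norm_nonneg _), one_div]

lemma contDiffAt_fracKernel {z : RN N} (hz : z ≠ 0) {n : ℕ∞} :
    ContDiffAt ℝ n (fracKernel σ) z := by
  unfold fracKernel
  have : ‖z‖ ≠ 0 := norm_ne_zero_iff.2 hz
  refine contDiffAt_const.div (ContDiffAt.rpow_const_of_ne (contDiffAt_norm ℝ hz) this) ?_
  positivity

lemma continuousAt_fracKernel {z : RN N} (hz : z ≠ 0) : ContinuousAt (fracKernel σ) z :=
  (contDiffAt_fracKernel hz (n := 0)).continuousAt

lemma kernelMajorant_nonneg (z : RN N) : 0 ≤ kernelMajorant σ β z := by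
  unfold kernelMajorant; positivity

@[fun_prop]
lemma measurable_kernelMajorant : Measurable (kernelMajorant (N := N) σ β) := by
  unfold kernelMajorant; fun_prop

/-- The majorant controls the kernel against a factor bounded both by `1` and by `|z|^β`. -/
lemma mul_fracKernel_le_kernelMajorant {z : RN N} (hz : z ≠ 0) {a : ℝ}
    (h1 : a ≤ 1) (h2 : a ≤ ‖z‖ ^ β) : a * fracKernel σ z ≤ kernelMajorant σ β z := by
  have hz' : 0 < ‖z‖ := norm_pos_iff.2 hz
  rw [fracKernel_eq_rpow_neg, kernelMajorant, le_min_iff, sub_eq_add_neg, Real.rpow_add hz']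
  have : 0 ≤ ‖z‖ ^ (-((N : ℝ) + 2 * σ)) := by positivity
  exact ⟨by gcongr, by nlinarith⟩

lemma kernelMajorant_anti [NeZero N] (hσ : 0 < σ) (hβ : β ≤ N + 2 * σ) {z w : RN N} (hz : z ≠ 0)
    (h : ‖z‖ ≤ ‖w‖) : kernelMajorant σ β w ≤ kernelMajorant σ β z := by
  have hz' : 0 < ‖z‖ := norm_pos_iff.2 hz
  unfold kernelMajorant
  apply min_le_min
  · exact Real.rpow_le_rpow_of_nonpos hz' h (by linarith)
  · exact Real.rpow_le_rpow_of_nonpos hz' h (by have : (0:ℝ) ≤ N := by positivity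
                                                linarith)

/-- A power `|x|^α` with `α > -dim E` is integrable near the origin. -/
lemma integrableOn_ball_norm_rpow {E : Type*} [NormedAddCommGroup E] [InnerProductSpace ℝ E]
    [FiniteDimensional ℝ E] [MeasurableSpace E] [BorelSpace E] {α : ℝ}
    (hα : -(Module.finrank ℝ E : ℝ) < α) (r : ℝ) :
    IntegrableOn (fun x : E => ‖x‖ ^ α) (Metric.ball 0 r) := by
  rcases subsingleton_or_nontrivial E with hE | hE
  · have : (fun x : E => ‖x‖ ^ α) = fun _ => ‖(0:E)‖ ^ α := by
      ext x; rw [Subsingleton.elim x 0]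
    rw [this]
    exact integrableOn_const (measure_ball_lt_top).ne
  · rw [integrableOn_fun_norm_addHaar volume (f := fun t : ℝ => t ^ α)]
    rcases le_or_gt r 0 with hr | hr
    · simp [Ioo_eq_empty_of_le hr]
    have h1 : IntegrableOn (fun y : ℝ => y ^ ((Module.finrank ℝ E : ℝ) - 1 + α)) (Ioo 0 r) := by
      rw [intervalIntegral.integrableOn_Ioo_rpow_iff hr]; linarith
    refine h1.congr_fun (fun y hy => ?_) measurableSet_Ioo
    have hy0 : 0 < y := hy.1
    simp only [smul_eq_mul]
    rw [Real.rpow_add hy0, ← Real.rpow_natCast, Nat.cast_sub (Module.finrank_pos), Nat.cast_one]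

lemma integrableOn_compl_ball_norm_rpow [NeZero N] {α : ℝ} (hα : α < -(N : ℝ)) {r : ℝ}
    (hr : 0 < r) : IntegrableOn (fun x : RN N => ‖x‖ ^ α) (Metric.ball 0 r)ᶜ := by
  rw [← integrable_indicator_iff measurableSet_ball.compl]
  have h0 : ((Metric.ball (0 : RN N) r)ᶜ.indicator fun x : RN N => ‖x‖ ^ α) =
      fun x : RN N => (Ici r).indicator (fun t : ℝ => t ^ α) ‖x‖ := by
    ext x; simp [indicator]
  rw [h0, integrable_fun_norm_addHaar volume (f := (Ici r).indicator (fun t : ℝ => t ^ α))]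
  have h1 : IntegrableOn (fun y : ℝ => y ^ ((N : ℝ) - 1 + α)) (Ioi (r/2)) :=
    integrableOn_Ioi_rpow_of_lt (by linarith) (by positivity)
  have h2 : IntegrableOn ((Ici r).indicator fun y : ℝ => y ^ ((N : ℝ) - 1 + α)) (Ioi 0) := by
    rw [integrableOn_indicator_iff measurableSet_Ici]
    exact h1.mono_set (fun x hx => mem_Ioi.2 (by linarith [mem_Ici.1 hx.1]))
  refine h2.congr_fun (fun y (hy : 0 < y) => ?_) measurableSet_Ioi
  by_cases hyr : y ∈ Ici r
  · simp only [hyr, indicator_of_mem, smul_eq_mul, finrank_euclideanSpace, Fintype.card_fin]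
    rw [Real.rpow_add hy, ← Real.rpow_natCast, Nat.cast_sub (NeZero.one_le), Nat.cast_one]
  · simp [hyr]

lemma integrable_kernelMajorant [NeZero N] (hσ : 0 < σ) (hβ : 2 * σ < β) :
    Integrable (kernelMajorant (N := N) σ β) := by
  rw [← integrableOn_univ, ← union_compl_self (Metric.ball (0 : RN N) 1)]
  refine IntegrableOn.union ?_ ?_
  · refine (integrableOn_ball_norm_rpow (E := RN N) (α := β - (N + 2 * σ)) ?_ 1).mono'
      measurable_kernelMajorant.aestronglyMeasurable (Eventually.of_forall fun z => ?_)
    · simp; linarith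
    · rw [Real.norm_of_nonneg (kernelMajorant_nonneg _)]; exact min_le_left _ _
  · refine (integrableOn_compl_ball_norm_rpow (N := N) (α := -(N + 2 * σ)) ?_ one_pos).mono'
      measurable_kernelMajorant.aestronglyMeasurable (Eventually.of_forall fun z => ?_)
    · linarith
    · rw [Real.norm_of_nonneg (kernelMajorant_nonneg _)]; exact min_le_right _ _

lemma integrableOn_fracKernel_compl_ball [NeZero N] (hσ : 0 < σ) {r : ℝ} (hr : 0 < r) :
    IntegrableOn (fracKernel (N := N) σ) (Metric.ball 0 r)ᶜ := by
  have := integrableOn_compl_ball_norm_rpow (N := N) (α := -(N + 2 * σ)) (by linarith) hr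
  simpa only [← fracKernel_eq_rpow_neg] using this

lemma SchwartzMap.norm_sub_le_of_fderiv_bound {E F : Type*} [NormedAddCommGroup E]
    [NormedSpace ℝ E] [NormedAddCommGroup F] [NormedSpace ℝ F] (f : 𝓢(E, F)) {C : ℝ}
    (hC : ∀ x, ‖fderiv ℝ f x‖ ≤ C) (x y : E) : ‖f x - f y‖ ≤ C * ‖x - y‖ :=
  convex_univ.norm_image_sub_le_of_norm_fderiv_le (fun _ _ => f.differentiableAt)
    (fun z _ => hC z) (mem_univ _) (mem_univ _)

/-- First and second order Taylor bounds for a Schwartz function, with one constant. -/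
lemma SchwartzMap.exists_taylor_bounds {E F : Type*} [NormedAddCommGroup E] [NormedSpace ℝ E]
    [NormedAddCommGroup F] [NormedSpace ℝ F] (f : 𝓢(E, F)) :
    ∃ C : ℝ, 0 < C ∧ (∀ x, ‖f x‖ ≤ C) ∧ (∀ x, ‖fderiv ℝ f x‖ ≤ C) ∧
      (∀ x y, ‖f x - f y‖ ≤ C * ‖x - y‖) ∧
      ∀ p x y, ‖f x - f y - fderiv ℝ f p (x - y)‖ ≤ C * ‖x - y‖ * (‖x - p‖ + ‖y - p‖) := by
  set f1 := SchwartzMap.fderivCLM ℝ E F f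
  set f2 := SchwartzMap.fderivCLM ℝ E (E →L[ℝ] F) f1
  have h0 : ∀ x, ‖f x‖ ≤ SchwartzMap.seminorm ℝ 0 0 f := f.norm_le_seminorm ℝ
  have h1 : ∀ x, ‖fderiv ℝ f x‖ ≤ SchwartzMap.seminorm ℝ 0 0 f1 := f1.norm_le_seminorm ℝ
  have h2 : ∀ x, ‖fderiv ℝ f1 x‖ ≤ SchwartzMap.seminorm ℝ 0 0 f2 := f2.norm_le_seminorm ℝ
  set C0 := SchwartzMap.seminorm ℝ 0 0 f
  set C1 := SchwartzMap.seminorm ℝ 0 0 f1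
  set C2 := SchwartzMap.seminorm ℝ 0 0 f2
  have p0 : 0 ≤ C0 := (norm_nonneg _).trans (h0 0)
  have p1 : 0 ≤ C1 := (norm_nonneg _).trans (h1 0)
  have p2 : 0 ≤ C2 := (norm_nonneg (fderiv ℝ f1 0)).trans (h2 0)
  have e0 : C0 ≤ C0 + C1 + C2 + 1 := by linarith
  have e1 : C1 ≤ C0 + C1 + C2 + 1 := by linarith
  have e2 : C2 ≤ C0 + C1 + C2 + 1 := by linarith
  refine ⟨C0 + C1 + C2 + 1, by positivity, fun x => (h0 x).trans e0, fun x => (h1 x).trans e1,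
    f.norm_sub_le_of_fderiv_bound fun x => (h1 x).trans e1, fun p x y => ?_⟩
  have hL := f1.norm_sub_le_of_fderiv_bound fun x => (h2 x).trans e2
  set C := C0 + C1 + C2 + 1
  have hC : 0 ≤ C := by positivity
  rw [mul_assoc, mul_comm ‖x - y‖, ← mul_assoc]
  refine (convex_segment (𝕜 := ℝ) y x).norm_image_sub_le_of_norm_fderiv_le'
      (fun z _ => f.differentiableAt) (fun z hz => (hL z p).trans ?_) (left_mem_segment ℝ y x)
      (right_mem_segment ℝ y x)
  gcongr
  obtain ⟨a, b, ha, hb, hab, rfl⟩ := hz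
  have : a • y + b • x - p = a • (y - p) + b • (x - p) := by
    rw [smul_sub, smul_sub, sub_add_sub_comm, ← add_smul, hab, one_smul]
  rw [this]
  calc _ ≤ a * ‖y - p‖ + b * ‖x - p‖ := by
        refine (norm_add_le _ _).trans ?_
        rw [norm_smul, norm_smul, Real.norm_of_nonneg ha, Real.norm_of_nonneg hb]
    _ ≤ 1 * ‖y - p‖ + 1 * ‖x - p‖ := by gcongr <;> linarith
    _ = _ := by ring

end Kernel

/-! ### The fractional Laplacian as an integral of second differences -/

/-- The symmetric second difference `2 f(x) - f(x+z) - f(x-z)`. -/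
def secondDiff {N : ℕ} {F : Type*} [NormedAddCommGroup F] (f : RN N → F) (x z : RN N) : F :=
  (f x - f (x + z)) + (f x - f (x - z))

/-- The fractional Laplacian of order `2σ` without its normalization constant, written as the
absolutely convergent integral of symmetric second differences. -/
def fracLap {N : ℕ} {F : Type*} [NormedAddCommGroup F] [NormedSpace ℝ F] (σ : ℝ) (f : RN N → F)
    (x : RN N) : F :=
  ∫ z, (fracKernel σ z / 2) • secondDiff f x z

section FracLap
variable {N : ℕ} {σ : ℝ} {F : Type*} [NormedAddCommGroup F] [NormedSpace ℝ F]

/-- The second difference of a Schwartz function is bounded and of second order in `z`, uniformly in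
`x`. -/
lemma exists_secondDiff_bound (f : 𝓢(RN N, F)) :
    ∃ C : ℝ, 0 < C ∧ ∀ x z, ‖(fracKernel σ z / 2) • secondDiff f x z‖ ≤
      C * kernelMajorant σ 2 z := by
  obtain ⟨C, hC, h0, -, -, h2⟩ := f.exists_taylor_bounds
  refine ⟨2 * C, by positivity, fun x z => ?_⟩
  rcases eq_or_ne z 0 with rfl | hz
  · simp only [secondDiff, add_zero, sub_self, sub_zero, smul_zero, norm_zero]
    exact mul_nonneg (by positivity) (kernelMajorant_nonneg _)
  have hk := fracKernel_nonneg (σ := σ) z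
  set D := ‖secondDiff f x z‖
  have b0 : D ≤ 4 * C := by
    have := norm_sub_le (f x) (f (x + z))
    have := norm_sub_le (f x) (f (x - z))
    have := norm_add_le (f x - f (x + z)) (f x - f (x - z))
    change D ≤ _ at this
    linarith [h0 x, h0 (x + z), h0 (x - z)]
  have b2 : D ≤ 2 * C * ‖z‖ ^ 2 := by
    have e1 := h2 x x (x + z)
    have e2 := h2 x x (x - z)
    have e4 : f x - f (x + z) - fderiv ℝ f x (x - (x + z)) +
      (f x - f (x - z) - fderiv ℝ f x (x - (x - z))) = secondDiff f x z := by
      simp only [secondDiff, sub_add_cancel_left, sub_sub_cancel, map_neg]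
      abel
    have e3 := norm_add_le_of_le e1 e2
    rw [e4] at e3
    simp only [sub_self, norm_zero, zero_add, add_sub_cancel_left, sub_sub_cancel_left,
      sub_add_cancel_left, sub_sub_cancel, norm_neg] at e3
    change D ≤ _ at e3
    linarith [sq ‖z‖]
  have := mul_fracKernel_le_kernelMajorant (σ := σ) (β := 2) hz (a := D / (4 * C))
    (by rw [div_le_one (by positivity)]; exact b0) (by
      rw [div_le_iff₀ (by positivity), Real.rpow_two]; nlinarith [sq_nonneg ‖z‖])
  rw [norm_smul, Real.norm_of_nonneg (by positivity)]
  calc fracKernel σ z / 2 * D = 2 * C * (D / (4 * C) * fracKernel σ z) := by field_simp; ring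
    _ ≤ _ := by gcongr

lemma aestronglyMeasurable_fracLap_integrand {f : RN N → F} (hf : Continuous f) (x : RN N)
    (μ : Measure (RN N)) :
    AEStronglyMeasurable (fun z => (fracKernel σ z / 2) • secondDiff f x z) μ := by
  refine AEStronglyMeasurable.smul (by fun_prop) ?_
  have : Continuous fun z => secondDiff f x z := by unfold secondDiff; fun_prop
  exact this.aestronglyMeasurable

lemma integrable_fracLap_integrand [NeZero N] (hσ0 : 0 < σ) (hσ1 : σ < 1) (f : 𝓢(RN N, F))
    (x : RN N) : Integrable (fun z => (fracKernel σ z / 2) • secondDiff f x z) := by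
  obtain ⟨C, hC, h⟩ := exists_secondDiff_bound (σ := σ) f
  exact ((integrable_kernelMajorant hσ0 (by linarith)).const_mul C).mono'
    (aestronglyMeasurable_fracLap_integrand f.continuous x _) (Eventually.of_forall (h x))

lemma exists_fracLap_bound [NeZero N] (hσ0 : 0 < σ) (hσ1 : σ < 1) (f : 𝓢(RN N, F)) :
    ∃ C, 0 < C ∧ ∀ x, ‖fracLap σ f x‖ ≤ C := by
  obtain ⟨C, hC, h⟩ := exists_secondDiff_bound (σ := σ) f
  refine ⟨C * (∫ z : RN N, kernelMajorant σ 2 z) + 1, ?_, fun x => ?_⟩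
  · have : 0 ≤ ∫ z : RN N, kernelMajorant σ 2 z := integral_nonneg fun z => kernelMajorant_nonneg z
    positivity
  · have hi := (integrable_kernelMajorant (N := N) (β := 2) hσ0 (by linarith)).const_mul C
    refine (norm_integral_le_of_norm_le hi (Eventually.of_forall (h x))).trans ?_
    rw [integral_const_mul]
    linarith

lemma continuous_fracLap [NeZero N] (hσ0 : 0 < σ) (hσ1 : σ < 1) (f : 𝓢(RN N, F)) :
    Continuous (fracLap σ f) := by
  obtain ⟨C, hC, h⟩ := exists_secondDiff_bound (σ := σ) f
  refine continuous_of_dominated (fun x => aestronglyMeasurable_fracLap_integrand f.continuous x _)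
    (fun x => Eventually.of_forall (h x))
    ((integrable_kernelMajorant hσ0 (by linarith)).const_mul C) (Eventually.of_forall fun z => ?_)
  have := f.continuous
  unfold secondDiff
  fun_prop

/-- Differentiation commutes with the fractional Laplacian, the derivative being again a Schwartz
function. -/
lemma hasFDerivAt_fracLap [NeZero N] (hσ0 : 0 < σ) (hσ1 : σ < 1) (f : 𝓢(RN N, F)) (x : RN N) :
    HasFDerivAt (fracLap σ f) (fracLap σ (fun y => fderiv ℝ f y) x) x := by
  set f1 := SchwartzMap.fderivCLM ℝ (RN N) F f
  obtain ⟨C, hC, h⟩ := exists_secondDiff_bound (σ := σ) f1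
  refine hasFDerivAt_integral_of_dominated_of_fderiv_le (s := univ) (bound := fun z => C * kernelMajorant σ 2 z)
    (F' := fun x z => (fracKernel σ z / 2) • secondDiff f1 x z) univ_mem ?_ ?_ ?_ ?_ ?_ ?_
  · exact Eventually.of_forall fun x => aestronglyMeasurable_fracLap_integrand f.continuous x _
  · exact integrable_fracLap_integrand hσ0 hσ1 f x
  · exact aestronglyMeasurable_fracLap_integrand f1.continuous x _
  · exact Eventually.of_forall fun z x _ => h x z
  · exact (integrable_kernelMajorant hσ0 (by linarith)).const_mul C
  · refine Eventually.of_forall fun z x _ => HasFDerivAt.const_smul ?_ _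
    have d : ∀ y, HasFDerivAt f (f1 y) y := fun y => by
      rw [SchwartzMap.fderivCLM_apply]; exact f.hasFDerivAt y
    have d1 : HasFDerivAt (fun x => f (x + z)) (f1 (x + z)) x := (hasFDerivAt_comp_add_right z).2 (d _)
    have d2 : HasFDerivAt (fun x => f (x - z)) (f1 (x - z)) x := by
      simpa only [sub_eq_add_neg] using (hasFDerivAt_comp_add_right (-z)).2 (d (x + -z))
    exact ((d x).sub d1).add ((d x).sub d2)

lemma fracLap_clm_comp [NeZero N] [CompleteSpace F] {G : Type*} [NormedAddCommGroup G]
    [NormedSpace ℝ G] [CompleteSpace G] (hσ0 : 0 < σ) (hσ1 : σ < 1) (f : 𝓢(RN N, F))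
    (L : F →L[ℝ] G) (x : RN N) :
    fracLap σ (fun y => L (f y)) x = L (fracLap σ f x) := by
  rw [fracLap, fracLap, ← L.integral_comp_comm (integrable_fracLap_integrand hσ0 hσ1 f x)]
  simp [secondDiff]

lemma integrableOn_fracKernel_smul_compl_ball [NeZero N] (hσ0 : 0 < σ) {g : RN N → F} {C : ℝ}
    (hg : Continuous g) (hC : ∀ x, ‖g x‖ ≤ C) {ε : ℝ} (hε : 0 < ε) :
    IntegrableOn (fun z => fracKernel σ z • g z) (Metric.ball 0 ε)ᶜ := by
  refine ((integrableOn_fracKernel_compl_ball hσ0 hε).mul_const C).mono'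
    (AEStronglyMeasurable.smul (by fun_prop) hg.aestronglyMeasurable) (Eventually.of_forall fun z => ?_)
  rw [norm_smul, Real.norm_of_nonneg (fracKernel_nonneg _)]
  exact mul_le_mul_of_nonneg_left (hC z) (fracKernel_nonneg _)

/-- The truncated integrals over the whole space, symmetrized by `z ↦ -z`. -/
lemma truncatedRegional_univ_eq [NeZero N] (hσ0 : 0 < σ) (f : 𝓢(RN N, F)) (x : RN N) {ε : ℝ}
    (hε : 0 < ε) : truncatedRegional σ univ f x ε =
      ∫ z in (Metric.ball 0 ε)ᶜ, (fracKernel σ z / 2) • secondDiff f x z := by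
  obtain ⟨C, hC, h0, -⟩ := f.exists_taylor_bounds
  have hb : ∀ a b, ‖f a - f b‖ ≤ C + C := fun a b =>
    (norm_sub_le _ _).trans (add_le_add (h0 _) (h0 _))
  have e1 : truncatedRegional σ univ f x ε =
      ∫ z in (Metric.ball 0 ε)ᶜ, fracKernel σ z • (f x - f (x + z)) := by
    rw [truncatedRegional, ← (measurePreserving_add_left volume x).setIntegral_preimage_emb
      (measurableEmbedding_addLeft x)]
    congr! 2 with z
    · ext z; simp
    · simp [fracKernel]
  have e2 : truncatedRegional σ univ f x ε =
      ∫ z in (Metric.ball 0 ε)ᶜ, fracKernel σ z • (f x - f (x - z)) := by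
    rw [truncatedRegional, ← (volume.measurePreserving_sub_left x).setIntegral_preimage_emb
      (MeasurableEquiv.subLeft x).measurableEmbedding]
    congr! 2 with z
    · ext z; simp
    · simp [fracKernel]
  have i1 := integrableOn_fracKernel_smul_compl_ball hσ0 (g := fun z => f x - f (x + z))
    (by fun_prop) (fun z => hb _ _) hε
  have i2 := integrableOn_fracKernel_smul_compl_ball hσ0 (g := fun z => f x - f (x - z))
    (by fun_prop) (fun z => hb _ _) hε
  calc truncatedRegional σ univ f x ε = (1 / 2 : ℝ) • (truncatedRegional σ univ f x ε +
        truncatedRegional σ univ f x ε) := by rw [← two_smul ℝ, smul_smul]; norm_num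
    _ = _ := by
      nth_rw 1 [e1]
      rw [e2, ← integral_add i1 i2, ← integral_smul]
      congr with z
      rw [← smul_add, smul_smul, secondDiff]
      congr 1; ring

/-- Removing shrinking balls around a point does not change an absolutely convergent integral in
the limit. -/
lemma tendsto_setIntegral_compl_ball {x : RN N} [NeZero N] {s : Set (RN N)} {g : RN N → F}
    (hg : IntegrableOn g s) :
    Tendsto (fun ε => ∫ y in s \ Metric.ball x ε, g y) (𝓝[>] 0) (𝓝 (∫ y in s, g y)) := by
  have : ∀ ε, ∫ y in s \ Metric.ball x ε, g y = ∫ y in s, (Metric.ball x ε)ᶜ.indicator g y := by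
    intro ε
    rw [integral_indicator measurableSet_ball.compl, Measure.restrict_restrict measurableSet_ball.compl,
      inter_comm, sdiff_eq]
  simp_rw [this]
  refine tendsto_integral_filter_of_dominated_convergence (fun y => ‖g y‖) ?_ ?_ hg.norm ?_
  · exact Eventually.of_forall fun ε => hg.1.indicator measurableSet_ball.compl
  · exact Eventually.of_forall fun ε => Eventually.of_forall fun y => norm_indicator_le_norm_self _ _
  · have : ∀ᵐ y ∂(volume.restrict s), y ≠ x := by
      exact ae_restrict_of_ae (Measure.ae_ne volume x)
    filter_upwards [this] with y hy
    refine tendsto_const_nhds.congr' ?_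
    filter_upwards [Ioo_mem_nhdsGT (dist_pos.2 hy)] with ε hε
    rw [indicator_of_mem]
    simpa using hε.2.le

lemma tendsto_truncatedRegional_univ [NeZero N] (hσ0 : 0 < σ) (hσ1 : σ < 1) (f : 𝓢(RN N, F))
    (x : RN N) : Tendsto (truncatedRegional σ univ f x) (𝓝[>] 0) (𝓝 (fracLap σ f x)) := by
  have := tendsto_setIntegral_compl_ball (x := 0) (s := univ)
    (integrable_fracLap_integrand hσ0 hσ1 f x).integrableOn
  rw [Measure.restrict_univ] at this
  refine this.congr' ?_
  filter_upwards [self_mem_nhdsWithin] with ε hε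
  rw [truncatedRegional_univ_eq hσ0 f x hε, compl_eq_univ_sdiff]

lemma exists_truncatedRegional_univ_bound [NeZero N] (hσ0 : 0 < σ) (hσ1 : σ < 1)
    (f : 𝓢(RN N, F)) : ∃ C, ∀ x, ∀ ε > 0, ‖truncatedRegional σ univ f x ε‖ ≤ C := by
  obtain ⟨C, hC, h⟩ := exists_secondDiff_bound (σ := σ) f
  have hi := (integrable_kernelMajorant (N := N) (β := 2) hσ0 (by linarith)).const_mul C
  refine ⟨∫ z : RN N, C * kernelMajorant σ 2 z, fun x ε hε => ?_⟩
  rw [truncatedRegional_univ_eq hσ0 f x hε]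
  refine (norm_integral_le_of_norm_le hi.integrableOn (Eventually.of_forall (h x))).trans ?_
  exact setIntegral_le_integral hi (Eventually.of_forall fun z =>
    mul_nonneg hC.le (kernelMajorant_nonneg z))

/-- Over the whole space the principal value exists everywhere and is the integral of second
differences. -/
lemma regionalFracLaplacian_univ [NeZero N] (hσ0 : 0 < σ) (hσ1 : σ < 1) (f : 𝓢(RN N, F))
    (x : RN N) : regionalFracLaplacian σ univ f x = fracConst N σ • fracLap σ f x := by
  rw [regionalFracLaplacian, (tendsto_truncatedRegional_univ hσ0 hσ1 f x).limUnder_eq]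

end FracLap

section Gradient
variable {N : ℕ} {σ : ℝ}

/-- The gradient of a Schwartz function, as a Schwartz vector field. -/
def schwartzGradient (u : 𝓢(RN N, ℝ)) : 𝓢(RN N, RN N) :=
  (SchwartzMap.fderivCLM ℝ (RN N) ℝ u).postcompCLM
    (∑ i, (ContinuousLinearMap.apply ℝ ℝ (EuclideanSpace.single i (1 : ℝ))).smulRight
      (EuclideanSpace.single i (1 : ℝ)))

lemma gradient_apply (u : RN N → ℝ) (x : RN N) (i : Fin N) :
    gradient u x i = fderiv ℝ u x (EuclideanSpace.single i 1) := by
  rw [gradient, ← InnerProductSpace.toDual_symm_apply (𝕜 := ℝ), EuclideanSpace.inner_single_right]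
  simp

lemma coe_schwartzGradient (u : 𝓢(RN N, ℝ)) : ⇑(schwartzGradient u) = gradient u := by
  ext x i
  rw [gradient_apply]
  simp [schwartzGradient, Finset.sum_apply, Pi.single_apply]

/-- The trace of an endomorphism, as a continuous linear form. -/
def traceCLM (N : ℕ) : (RN N →L[ℝ] RN N) →L[ℝ] ℝ :=
  ∑ i, (EuclideanSpace.proj i : RN N →L[ℝ] ℝ) ∘L
    (ContinuousLinearMap.apply ℝ (RN N) (EuclideanSpace.single i (1 : ℝ)))

lemma divergence_eq_traceCLM (V : RN N → RN N) (x : RN N) :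
    divergence V x = traceCLM N (fderiv ℝ V x) := by
  simp [divergence, traceCLM]

lemma divergence_gradient (u : 𝓢(RN N, ℝ)) (x : RN N) :
    divergence (gradient u) x = (Δ (u : RN N → ℝ)) x := by
  rw [← SchwartzMap.laplacian_apply, SchwartzMap.laplacian_eq_sum (EuclideanSpace.basisFun (Fin N) ℝ),
    divergence, sum_apply]
  refine Finset.sum_congr rfl fun i _ => ?_
  have h : DifferentiableAt ℝ (gradient u) x := by
    rw [← coe_schwartzGradient]; exact (schwartzGradient u).differentiableAt
  have h2 : (fderiv ℝ (gradient u) x (EuclideanSpace.single i 1)) i =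
      fderiv ℝ (fun y => gradient u y i) x (EuclideanSpace.single i 1) := by
    have := ((EuclideanSpace.proj i : RN N →L[ℝ] ℝ).hasFDerivAt.comp x h.hasFDerivAt).fderiv
    change fderiv ℝ (fun y => gradient u y i) x = _ at this
    rw [this]; rfl
  rw [h2, EuclideanSpace.basisFun_apply, SchwartzMap.lineDerivOp_apply_eq_fderiv]
  congr 2
  ext1 y
  rw [gradient_apply, SchwartzMap.lineDerivOp_apply_eq_fderiv]

lemma divergence_fracLap_gradient [NeZero N] (hσ0 : 0 < σ) (hσ1 : σ < 1) (u : 𝓢(RN N, ℝ))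
    (x : RN N) : divergence (fracLap σ (gradient u)) x =
      - fracLap σ (fun z => -(Δ (u : RN N → ℝ)) z) x := by
  have h := hasFDerivAt_fracLap hσ0 hσ1 (schwartzGradient u) x
  rw [← coe_schwartzGradient, divergence_eq_traceCLM, h.fderiv]
  have := fracLap_clm_comp hσ0 hσ1 (SchwartzMap.fderivCLM ℝ (RN N) (RN N) (schwartzGradient u))
    (- traceCLM N) x
  simp only [neg_apply, SchwartzMap.fderivCLM_apply,
    ← divergence_eq_traceCLM, coe_schwartzGradient, divergence_gradient] at this
  rw [this, neg_neg]
  congr 2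

/-- As the fractional Laplacian commutes with derivatives, `(-Δ)^s u = -div ((-Δ)^σ ∇u)`. -/
lemma higherFracLaplacian_eq [NeZero N] (hσ0 : 0 < σ) (hσ1 : σ < 1) (u : 𝓢(RN N, ℝ))
    (x : RN N) : higherFracLaplacian (1 + σ) u x =
      - divergence (fun z => fracConst N σ • fracLap σ (gradient u) z) x := by
  have h := hasFDerivAt_fracLap hσ0 hσ1 (schwartzGradient u) x
  have hf : (fun z => -(Δ (u : RN N → ℝ)) z) = ⇑(-(Δ u : 𝓢(RN N, ℝ))) := by
    ext1 z; simp [SchwartzMap.laplacian_apply]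
  rw [higherFracLaplacian, add_sub_cancel_left, hf, regionalFracLaplacian_univ hσ0 hσ1, ← hf,
    divergence_eq_traceCLM, ← coe_schwartzGradient, show (fun z => fracConst N σ • fracLap σ (schwartzGradient u) z) =
      fracConst N σ • fracLap σ (schwartzGradient u) from rfl, (h.const_smul _).fderiv, map_smul, ← h.fderiv,
    ← divergence_eq_traceCLM, coe_schwartzGradient, divergence_fracLap_gradient hσ0 hσ1]
  simp

end Gradient

/-! ### Regional integrals off the boundary -/

/-- The regional operator without normalization or limit:
`∫_A (f(x) - f(y)) / |x - y|^{N+2σ} dy`. It is meant for `x` off the closure of `A`, where the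
integral converges absolutely. -/
def regionalIntegral {N : ℕ} {F : Type*} [NormedAddCommGroup F] [NormedSpace ℝ F] (σ : ℝ)
    (A : Set (RN N)) (f : RN N → F) (x : RN N) : F :=
  ∫ y in A, fracKernel σ (x - y) • (f x - f y)

section Regional
variable {N : ℕ} {σ : ℝ} {F : Type*} [NormedAddCommGroup F] [NormedSpace ℝ F]

lemma exists_firstDiff_bound (f : 𝓢(RN N, F)) :
    ∃ C : ℝ, 0 < C ∧ ∀ x y, ‖fracKernel σ (x - y) • (f x - f y)‖ ≤
      C * kernelMajorant σ 1 (x - y) := by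
  obtain ⟨C, hC, h0, -, h1, -⟩ := f.exists_taylor_bounds
  refine ⟨2 * C, by positivity, fun x y => ?_⟩
  rcases eq_or_ne x y with rfl | hz
  · simp only [sub_self, smul_zero, norm_zero]
    exact mul_nonneg (by positivity) (kernelMajorant_nonneg _)
  have hk := fracKernel_nonneg (σ := σ) (x - y)
  have b0 : ‖f x - f y‖ ≤ 2 * C := by linarith [norm_sub_le (f x) (f y), h0 x, h0 y]
  have := mul_fracKernel_le_kernelMajorant (σ := σ) (β := 1) (sub_ne_zero.2 hz)
    (a := ‖f x - f y‖ / (2 * C)) (by rw [div_le_one (by positivity)]; exact b0) (by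
      rw [div_le_iff₀ (by positivity), Real.rpow_one]
      nlinarith [h1 x y, mul_nonneg hC.le (norm_nonneg (x - y))])
  rw [norm_smul, Real.norm_of_nonneg hk]
  calc fracKernel σ (x - y) * ‖f x - f y‖
      = 2 * C * (‖f x - f y‖ / (2 * C) * fracKernel σ (x - y)) := by field_simp
    _ ≤ _ := by gcongr

lemma measurable_firstDiff {f : RN N → F} (hf : Continuous f) :
    StronglyMeasurable fun p : RN N × RN N => fracKernel σ (p.1 - p.2) • (f p.1 - f p.2) := by
  refine StronglyMeasurable.smul (Measurable.stronglyMeasurable (by fun_prop)) ?_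
  exact (by fun_prop : Continuous fun p : RN N × RN N => f p.1 - f p.2).stronglyMeasurable

lemma exists_ball_disjoint {A : Set (RN N)} {x : RN N} (hx : x ∉ closure A) :
    ∃ d > 0, ∀ y ∈ A, d ≤ ‖x - y‖ := by
  obtain ⟨d, hd, h⟩ := Metric.mem_nhds_iff.1 (isClosed_closure.isOpen_compl.mem_nhds hx)
  refine ⟨d, hd, fun y hy => ?_⟩
  by_contra! hlt
  exact h (by rwa [Metric.mem_ball, dist_comm, dist_eq_norm]) (subset_closure hy)

lemma integrableOn_fracKernel_sub [NeZero N] (hσ0 : 0 < σ) {A : Set (RN N)} (hA : MeasurableSet A)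
    {x : RN N} (hx : x ∉ closure A) : IntegrableOn (fun y => fracKernel σ (x - y)) A := by
  obtain ⟨d, hd, h⟩ := exists_ball_disjoint hx
  have h1 := (integrable_indicator_iff measurableSet_ball.compl).2
    (integrableOn_fracKernel_compl_ball (N := N) hσ0 hd)
  have h2 := (h1.comp_sub_left x).integrableOn (s := A)
  refine h2.congr_fun (fun y hy => ?_) hA
  have := h y hy
  simp only
  rw [indicator_of_mem]
  simpa using this

lemma integrableOn_regional_integrand [NeZero N] (hσ0 : 0 < σ) {A : Set (RN N)}
    (hA : MeasurableSet A) {x : RN N} (hx : x ∉ closure A) (f : 𝓢(RN N, F)) :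
    IntegrableOn (fun y => fracKernel σ (x - y) • (f x - f y)) A := by
  obtain ⟨C, hC, h0, -⟩ := f.exists_taylor_bounds
  refine ((integrableOn_fracKernel_sub hσ0 hA hx).mul_const (C + C)).mono'
    ((measurable_firstDiff f.continuous).comp_measurable
      (measurable_prodMk_left (x := x))).aestronglyMeasurable
    (Eventually.of_forall fun y => ?_)
  rw [norm_smul, Real.norm_of_nonneg (fracKernel_nonneg _)]
  exact mul_le_mul_of_nonneg_left ((norm_sub_le _ _).trans (add_le_add (h0 _) (h0 _)))
    (fracKernel_nonneg _)

lemma tendsto_truncatedRegional_of_notMem [NeZero N] (hσ0 : 0 < σ) {A : Set (RN N)}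
    (hA : MeasurableSet A) {x : RN N} (hx : x ∉ closure A) (f : 𝓢(RN N, F)) :
    Tendsto (truncatedRegional σ A f x) (𝓝[>] 0) (𝓝 (regionalIntegral σ A f x)) :=
  tendsto_setIntegral_compl_ball (integrableOn_regional_integrand hσ0 hA hx f)

lemma integrableOn_truncated [NeZero N] (hσ0 : 0 < σ) (f : 𝓢(RN N, F)) (x : RN N) {ε : ℝ}
    (hε : 0 < ε) : IntegrableOn (fun y => fracKernel σ (x - y) • (f x - f y))
      (Metric.ball x ε)ᶜ := by
  refine integrableOn_regional_integrand hσ0 measurableSet_ball.compl ?_ f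
  intro h
  obtain ⟨y, hy, h2⟩ := Metric.mem_closure_iff.1 h ε hε
  exact hy (by rwa [Metric.mem_ball, dist_comm])

/-- Off the closure of `A`, the principal value over the complement of `A` is the difference
between the one over the whole space and the integral over `A`. -/
lemma tendsto_truncatedRegional_compl [NeZero N] (hσ0 : 0 < σ) (hσ1 : σ < 1) {A : Set (RN N)}
    (hA : MeasurableSet A) {x : RN N} (hx : x ∉ closure A) (f : 𝓢(RN N, F)) :
    Tendsto (truncatedRegional σ Aᶜ f x) (𝓝[>] 0)
      (𝓝 (fracLap σ f x - regionalIntegral σ A f x)) := by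
  refine ((tendsto_truncatedRegional_univ hσ0 hσ1 f x).sub
    (tendsto_truncatedRegional_of_notMem hσ0 hA hx f)).congr' ?_
  filter_upwards [self_mem_nhdsWithin] with ε hε
  have h := integrableOn_truncated hσ0 f x hε
  have e := integral_inter_add_sdiff (s := (Metric.ball x ε)ᶜ) hA h
  rw [truncatedRegional, truncatedRegional, truncatedRegional, sub_eq_iff_eq_add, ← compl_eq_univ_sdiff,
    sdiff_eq, sdiff_eq, inter_comm A, inter_comm Aᶜ, ← sdiff_eq _ A]
  rw [add_comm] at e
  exact e.symm

/-- Off the closure of `A` the truncation is void for small radii, so no principal value is needed.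
-/
lemma regionalFracLaplacian_of_notMem [NeZero N] (hσ0 : 0 < σ) {A : Set (RN N)}
    (hA : MeasurableSet A) {x : RN N} (hx : x ∉ closure A) (f : 𝓢(RN N, F)) :
    regionalFracLaplacian σ A f x = fracConst N σ • regionalIntegral σ A f x := by
  rw [regionalFracLaplacian, (tendsto_truncatedRegional_of_notMem hσ0 hA hx f).limUnder_eq]

lemma regionalFracLaplacian_compl [NeZero N] (hσ0 : 0 < σ) (hσ1 : σ < 1) {A : Set (RN N)}
    (hA : MeasurableSet A) {x : RN N} (hx : x ∉ closure A) (f : 𝓢(RN N, F)) :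
    regionalFracLaplacian σ Aᶜ f x =
      fracConst N σ • (fracLap σ f x - regionalIntegral σ A f x) := by
  rw [regionalFracLaplacian, (tendsto_truncatedRegional_compl hσ0 hσ1 hA hx f).limUnder_eq]

/-- Off the closure of a bounded set the regional integral is smooth: locally the kernel may be
replaced by a smooth compactly supported one, which turns it into convolutions. -/
lemma contDiffAt_regionalIntegral [NeZero N] [CompleteSpace F] {A : Set (RN N)}
    (hA : MeasurableSet A) (hb : Bornology.IsBounded A) {x : RN N} (hx : x ∉ closure A)
    (f : 𝓢(RN N, F)) : ContDiffAt ℝ 1 (regionalIntegral σ A f) x := by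
  obtain ⟨d, hd, h⟩ := exists_ball_disjoint hx
  obtain ⟨R, hR⟩ := hb.subset_ball x
  -- `k` equals the kernel at all the differences `z - y`, `z` near `x` and `y ∈ A`.
  let b1 : ContDiffBump (0 : RN N) := ⟨d / 4, d / 2, by positivity, by linarith⟩
  let b2 : ContDiffBump (0 : RN N) := ⟨max R 0 + d, max R 0 + 2 * d, by positivity, by linarith⟩
  let k : RN N → ℝ := fun z => (b2 z - b1 z) * fracKernel σ z
  have hk1 : ContDiff ℝ 1 k := by
    rw [contDiff_iff_contDiffAt]
    intro z
    rcases eq_or_ne z 0 with rfl | hz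
    · refine (contDiffAt_const (c := (0 : ℝ))).congr_of_eventuallyEq ?_
      filter_upwards [Metric.ball_mem_nhds (0 : RN N) (show 0 < d / 4 by positivity)] with z hz
      have e1 : b1 z = 1 := b1.one_of_mem_closedBall (Metric.ball_subset_closedBall hz)
      have e2 : b2 z = 1 := b2.one_of_mem_closedBall (by
        have : d / 4 ≤ max R 0 + d := by have := le_max_right R 0; linarith
        exact Metric.closedBall_subset_closedBall this (Metric.ball_subset_closedBall hz))
      simp [k, e1, e2]
    · exact ((b2.contDiff.contDiffAt).sub (b1.contDiff.contDiffAt)).mul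
        (contDiffAt_fracKernel hz (n := 1))
  have hk2 : HasCompactSupport k := (b2.hasCompactSupport.sub b1.hasCompactSupport).mul_right
  have hk3 : ∀ z, d / 2 ≤ ‖z‖ → ‖z‖ ≤ max R 0 + d → k z = fracKernel σ z := by
    intro z h1 h2
    have e1 : b1 z = 0 := b1.zero_of_le_dist (by simpa using h1)
    have e2 : b2 z = 1 := b2.one_of_mem_closedBall (by simpa using h2)
    simp [k, e1, e2]
  have hfin : volume A ≠ ⊤ := hb.measure_lt_top.ne
  obtain ⟨C, hC, h0, -⟩ := f.exists_taylor_bounds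
  have l1 : LocallyIntegrable (A.indicator fun _ => (1 : ℝ)) :=
    ((integrable_indicator_iff hA).2 (integrableOn_const hfin)).locallyIntegrable
  have fA : IntegrableOn f A := Measure.integrableOn_of_bounded hfin
    f.continuous.aestronglyMeasurable (M := C) (Eventually.of_forall fun y => h0 y)
  have l2 : LocallyIntegrable (A.indicator f) := ((integrable_indicator_iff hA).2 fA).locallyIntegrable
  have c1 := hk2.contDiff_convolution_right (ContinuousLinearMap.lsmul ℝ ℝ) l1 hk1
  have c2 := hk2.contDiff_convolution_right (ContinuousLinearMap.lsmul ℝ ℝ (E := F)).flip l2 hk1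
  have hf : ContDiff ℝ 1 f := f.smooth 1
  refine ((c1.smul hf).sub c2).contDiffAt.congr_of_eventuallyEq ?_
  filter_upwards [Metric.ball_mem_nhds x (show 0 < d / 2 by positivity)] with z hz
  rw [Metric.mem_ball, dist_eq_norm] at hz
  have hkz : ∀ y ∈ A, k (z - y) = fracKernel σ (z - y) := by
    intro y hy
    have a1 := h y hy
    have a2 := hR hy
    rw [Metric.mem_ball, dist_eq_norm] at a2
    have a3 := norm_sub_le_norm_sub_add_norm_sub z x y
    have a4 := norm_sub_le_norm_sub_add_norm_sub x z y
    rw [norm_sub_rev x z] at a4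
    rw [norm_sub_rev] at a2
    apply hk3 <;> linarith [le_max_left R 0]
  have hkc : Continuous fun y => k (z - y) := hk1.continuous.comp (by fun_prop)
  have i0 : IntegrableOn (fun y => k (z - y)) A :=
    ((hk1.continuous.integrable_of_hasCompactSupport hk2).comp_sub_left z).integrableOn
  have e1 : ((A.indicator fun _ => (1 : ℝ)) ⋆[ContinuousLinearMap.lsmul ℝ ℝ] k) z
      = ∫ y in A, k (z - y) := by
    rw [convolution_def, ← integral_indicator hA]
    congr with y
    by_cases hy : y ∈ A <;> simp [hy]
  have e2 : ((A.indicator f) ⋆[(ContinuousLinearMap.lsmul ℝ ℝ (E := F)).flip] k) z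
      = ∫ y in A, k (z - y) • f y := by
    rw [convolution_def, ← integral_indicator hA]
    congr with y
    by_cases hy : y ∈ A <;> simp [hy]
  have i2 : IntegrableOn (fun y => k (z - y) • f y) A := by
    refine (i0.norm.mul_const C).mono' (hkc.smul f.continuous).aestronglyMeasurable
      (Eventually.of_forall fun y => ?_)
    rw [norm_smul]; exact mul_le_mul_of_nonneg_left (h0 y) (norm_nonneg _)
  rw [regionalIntegral, Pi.smul_apply', e1, e2, ← integral_smul_const, ← integral_sub (i0.smul_const _) i2]
  refine setIntegral_congr_fun hA fun y hy => ?_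
  rw [← hkz y hy, smul_sub]

end Regional

/-! ### The energy form -/

section Energy
variable {N : ℕ} {σ : ℝ}

lemma integrableOn_sub_prod_univ {g : RN N → ℝ} (hg : Integrable g) {A : Set (RN N)}
    (hfin : volume A ≠ ⊤) :
    IntegrableOn (fun p : RN N × RN N => g (p.1 - p.2)) (A ×ˢ univ) := by
  have h1 : Integrable (fun p : RN N × RN N => g p.2) ((volume.restrict A).prod volume) := by
    have : IsFiniteMeasure (volume.restrict A) := ⟨by simpa using hfin.lt_top⟩
    exact hg.comp_snd _
  have mp : MeasurePreserving (fun p : RN N × RN N => (p.1, p.1 - p.2))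
      ((volume.restrict A).prod volume) ((volume.restrict A).prod volume) :=
    (MeasurePreserving.id _).skew_product (by fun_prop)
      (Eventually.of_forall fun x => (volume.measurePreserving_sub_left x).map_eq)
  have := mp.integrable_comp_of_integrable h1
  rw [IntegrableOn, Measure.volume_eq_prod, ← Measure.prod_restrict, Measure.restrict_univ]
  exact this

lemma crossSet_eq (Ω : Set (RN N)) : crossSet Ω = Ω ×ˢ univ ∪ Ωᶜ ×ˢ Ω := by
  ext ⟨x, y⟩
  simp only [crossSet, mem_compl_iff, mem_prod, mem_union, mem_univ, and_true]
  tauto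

lemma swap_preimage_crossSet (Ω : Set (RN N)) : Prod.swap ⁻¹' crossSet Ω = crossSet Ω := by
  ext ⟨x, y⟩
  simp only [crossSet, mem_compl_iff, mem_prod, mem_preimage, Prod.swap_prod_mk]
  tauto

lemma integrableOn_sub_crossSet {g : RN N → ℝ} (hg : Integrable g) (hge : ∀ z, g (-z) = g z)
    {Ω : Set (RN N)} (hΩ : MeasurableSet Ω) (hfin : volume Ω ≠ ⊤) :
    IntegrableOn (fun p : RN N × RN N => g (p.1 - p.2)) (crossSet Ω) := by
  have h1 := integrableOn_sub_prod_univ hg hfin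
  have h2 : IntegrableOn (fun p : RN N × RN N => g (p.1 - p.2)) (univ ×ˢ Ω) := by
    have mp : MeasurePreserving (Prod.swap : RN N × RN N → _) volume volume :=
      Measure.measurePreserving_swap
    have := (mp.integrableOn_comp_preimage MeasurableEquiv.prodComm.measurableEmbedding).2 h1
    refine IntegrableOn.congr_fun (this.mono_set ?_) (fun p _ => ?_) (MeasurableSet.univ.prod hΩ)
    · rintro ⟨x, y⟩ ⟨_, hy⟩; exact ⟨hy, mem_univ _⟩
    · simp only [Function.comp, Prod.swap]; rw [← hge, neg_sub]
  rw [crossSet_eq]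
  exact h1.union (h2.mono_set (prod_mono (subset_univ _) Subset.rfl))

lemma kernelMajorant_neg {β : ℝ} (z : RN N) : kernelMajorant σ β (-z) = kernelMajorant σ β z := by
  simp [kernelMajorant]

lemma energyIntegrand_eq (u v : RN N → ℝ) (p : RN N × RN N) : energyIntegrand σ u v p =
    fracKernel σ (p.1 - p.2) *
      inner ℝ (gradient u p.1 - gradient u p.2) (gradient v p.1 - gradient v p.2) := by
  rw [energyIntegrand, fracKernel, div_eq_mul_inv, one_div, mul_comm]

lemma exists_energyIntegrand_bound (u v : 𝓢(RN N, ℝ)) :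
    ∃ C : ℝ, 0 < C ∧ ∀ p, ‖energyIntegrand σ u v p‖ ≤ C * kernelMajorant σ 2 (p.1 - p.2) := by
  obtain ⟨C, hC, h0, -, h1, -⟩ := (schwartzGradient u).exists_taylor_bounds
  obtain ⟨D, hD, k0, -, k1, -⟩ := (schwartzGradient v).exists_taylor_bounds
  refine ⟨4 * C * D, by positivity, fun ⟨x, y⟩ => ?_⟩
  rw [energyIntegrand_eq, ← coe_schwartzGradient, ← coe_schwartzGradient]
  simp only
  rcases eq_or_ne x y with rfl | hz
  · simp only [sub_self, inner_zero_left, mul_zero, norm_zero]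
    exact mul_nonneg (by positivity) (kernelMajorant_nonneg _)
  set w := schwartzGradient u
  set g := schwartzGradient v
  have a0 : ‖w x - w y‖ ≤ 2 * C := by linarith [norm_sub_le (w x) (w y), h0 x, h0 y]
  have b0 : ‖g x - g y‖ ≤ 2 * D := by linarith [norm_sub_le (g x) (g y), k0 x, k0 y]
  have a1 := h1 x y
  have b1 := k1 x y
  have hi := norm_inner_le_norm (𝕜 := ℝ) (w x - w y) (g x - g y)
  have := mul_fracKernel_le_kernelMajorant (σ := σ) (β := 2) (sub_ne_zero.2 hz)
    (a := ‖inner ℝ (w x - w y) (g x - g y)‖ / (4 * C * D)) (by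
      rw [div_le_one (by positivity)]
      calc _ ≤ _ := hi
        _ ≤ (2 * C) * (2 * D) := by gcongr
        _ = _ := by ring) (by
      rw [div_le_iff₀ (by positivity), Real.rpow_two]
      calc _ ≤ _ := hi
        _ ≤ (C * ‖x - y‖) * (D * ‖x - y‖) := by gcongr
        _ = ‖x - y‖ ^ 2 * (C * D) := by ring
        _ ≤ _ := by gcongr; nlinarith [mul_pos hC hD])
  rw [norm_mul, Real.norm_of_nonneg (fracKernel_nonneg _)]
  calc _ = 4 * C * D * (‖inner ℝ (w x - w y) (g x - g y)‖ / (4 * C * D) *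
        fracKernel σ (x - y)) := by field_simp
    _ ≤ _ := by gcongr

lemma measurable_energyIntegrand (u v : 𝓢(RN N, ℝ)) : Measurable (energyIntegrand σ u v) := by
  have h : energyIntegrand σ u v = fun p : RN N × RN N => fracKernel σ (p.1 - p.2) *
      inner ℝ (schwartzGradient u p.1 - schwartzGradient u p.2)
        (schwartzGradient v p.1 - schwartzGradient v p.2) := by
    ext1 p; rw [energyIntegrand_eq, coe_schwartzGradient, coe_schwartzGradient]
  rw [h]
  refine Measurable.mul (by fun_prop) (Continuous.measurable ?_)
  fun_prop

lemma integrableOn_energyIntegrand [NeZero N] (hσ0 : 0 < σ) (hσ1 : σ < 1) (u v : 𝓢(RN N, ℝ))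
    {Ω : Set (RN N)} (hΩ : MeasurableSet Ω) (hfin : volume Ω ≠ ⊤) :
    IntegrableOn (energyIntegrand σ u v) (crossSet Ω) := by
  obtain ⟨C, hC, h⟩ := exists_energyIntegrand_bound (σ := σ) u v
  refine ((integrableOn_sub_crossSet (integrable_kernelMajorant (β := 2) hσ0 (by linarith))
    kernelMajorant_neg hΩ hfin).const_mul C).mono'
    (measurable_energyIntegrand u v).aestronglyMeasurable (Eventually.of_forall h)

/-- The part `K(x - y) (w(x) - w(y)) · g(x)` of the energy integrand, for `w = ∇u` and `g = ∇v`.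
Added to its image under `(x, y) ↦ (y, x)` it gives the whole integrand; on its own it need not be
integrable near the diagonal. -/
def halfEnergyIntegrand (σ : ℝ) (w g : RN N → RN N) (p : RN N × RN N) : ℝ :=
  inner ℝ (fracKernel σ (p.1 - p.2) • (w p.1 - w p.2)) (g p.1)

/-- The pairs at distance at least `ε` from each other. -/
def offDiagonal (N : ℕ) (ε : ℝ) : Set (RN N × RN N) := {p | ε ≤ ‖p.1 - p.2‖}

lemma measurableSet_offDiagonal (ε : ℝ) : MeasurableSet (offDiagonal N ε) :=
  (isClosed_le continuous_const (by fun_prop)).measurableSet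

lemma measurable_halfEnergyIntegrand (w g : 𝓢(RN N, RN N)) :
    Measurable (halfEnergyIntegrand σ w g) := by
  unfold halfEnergyIntegrand
  exact ((measurable_firstDiff w.continuous).inner
    (g.continuous.comp continuous_fst).stronglyMeasurable).measurable

lemma integrableOn_halfEnergy_truncated [NeZero N] (hσ0 : 0 < σ) (w g : 𝓢(RN N, RN N))
    {Ω : Set (RN N)} (hΩ : MeasurableSet Ω) (hfin : volume Ω ≠ ⊤) {ε : ℝ} (hε : 0 < ε) :
    IntegrableOn ((offDiagonal N ε).indicator (halfEnergyIntegrand σ w g)) (crossSet Ω) := by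
  obtain ⟨C, hC, h0, -⟩ := w.exists_taylor_bounds
  obtain ⟨D, hD, k0, -⟩ := g.exists_taylor_bounds
  have hk := (integrable_indicator_iff measurableSet_ball.compl).2
    (integrableOn_fracKernel_compl_ball (N := N) hσ0 hε)
  refine ((integrableOn_sub_crossSet hk (fun z => ?_) hΩ hfin).mul_const ((C + C) * D)).mono'
    ((measurable_halfEnergyIntegrand w g).indicator
      (measurableSet_offDiagonal ε)).aestronglyMeasurable (Eventually.of_forall fun p => ?_)
  · simp [indicator]
  by_cases hp : p ∈ offDiagonal N ε
  · rw [indicator_of_mem hp, indicator_of_mem (by simpa [offDiagonal] using hp)]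
    refine (norm_inner_le_norm _ _).trans ?_
    rw [norm_smul, Real.norm_of_nonneg (fracKernel_nonneg _), mul_assoc]
    have := (norm_sub_le _ _).trans (add_le_add (h0 p.1) (h0 p.2))
    have := k0 p.1
    have := fracKernel_nonneg (σ := σ) (p.1 - p.2)
    gcongr
  · rw [indicator_of_notMem hp, norm_zero]
    exact mul_nonneg (indicator_nonneg (fun _ _ => fracKernel_nonneg _) _) (by positivity)

/-- `Q(Ω)` and the truncation are symmetric under `(x, y) ↦ (y, x)`, so both parts of the energy
integrand contribute equally. -/
lemma setIntegral_energy_truncated [NeZero N] (hσ0 : 0 < σ) (u v : 𝓢(RN N, ℝ))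
    {Ω : Set (RN N)} (hΩ : MeasurableSet Ω) (hfin : volume Ω ≠ ⊤) {ε : ℝ} (hε : 0 < ε) :
    ∫ p in crossSet Ω, (offDiagonal N ε).indicator (energyIntegrand σ u v) p =
      2 * ∫ p in crossSet Ω, (offDiagonal N ε).indicator
        (halfEnergyIntegrand σ (schwartzGradient u) (schwartzGradient v)) p := by
  set h := (offDiagonal N ε).indicator
        (halfEnergyIntegrand σ (schwartzGradient u) (schwartzGradient v)) with hh
  have mp : MeasurePreserving (Prod.swap : RN N × RN N → _) volume volume :=
    Measure.measurePreserving_swap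
  have hme := MeasurableEquiv.prodComm.measurableEmbedding (α := RN N × RN N) (β := RN N × RN N)
  have i1 := integrableOn_halfEnergy_truncated hσ0 (schwartzGradient u) (schwartzGradient v) hΩ hfin hε
  have i2 : IntegrableOn (fun p => h p.swap) (crossSet Ω) := by
    have := (mp.integrableOn_comp_preimage MeasurableEquiv.prodComm.measurableEmbedding).2 i1
    rwa [swap_preimage_crossSet] at this
  have e2 : ∫ p in crossSet Ω, h p.swap = ∫ p in crossSet Ω, h p := by
    rw [← mp.setIntegral_preimage_emb MeasurableEquiv.prodComm.measurableEmbedding h,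
      swap_preimage_crossSet]
  rw [two_mul]
  nth_rw 2 [← e2]
  rw [← integral_add i1 i2]
  congr with p
  have hs : p.swap ∈ offDiagonal N ε ↔ p ∈ offDiagonal N ε := by
    simp [offDiagonal, norm_sub_rev]
  by_cases hp : p ∈ offDiagonal N ε
  · rw [hh, indicator_of_mem hp, indicator_of_mem hp, indicator_of_mem (hs.2 hp), energyIntegrand_eq,
      coe_schwartzGradient, coe_schwartzGradient, halfEnergyIntegrand, halfEnergyIntegrand]
    simp only [Prod.fst_swap, Prod.snd_swap]
    rw [real_inner_smul_left, real_inner_smul_left, fracKernel_sub_comm p.2, ← neg_sub (gradient u p.1),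
      inner_neg_left, inner_sub_right]
    ring
  · rw [hh, indicator_of_notMem hp, indicator_of_notMem hp, indicator_of_notMem (hs.not.2 hp), add_zero]

/-- Integration in `y` over the section of the truncated region turns the half integrand into the
truncated regional operator. -/
lemma setIntegral_section_truncated (w g : 𝓢(RN N, RN N)) (A : Set (RN N)) (x : RN N) (ε : ℝ)
    (hi : IntegrableOn (fun y => fracKernel σ (x - y) • (w x - w y)) (A \ Metric.ball x ε)) :
    ∫ y in A, (offDiagonal N ε).indicator (halfEnergyIntegrand σ w g) (x, y) =
      inner ℝ (truncatedRegional σ A w x ε) (g x) := by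
  have : (fun y => (offDiagonal N ε).indicator (halfEnergyIntegrand σ w g) (x, y)) =
      (Metric.ball x ε)ᶜ.indicator fun y => inner ℝ (g x) (fracKernel σ (x - y) • (w x - w y)) := by
    ext1 y
    have hiff : (x, y) ∈ offDiagonal N ε ↔ y ∉ Metric.ball x ε := by
      rw [Metric.mem_ball, dist_comm, dist_eq_norm, not_lt]; rfl
    by_cases hy : y ∈ Metric.ball x ε
    · rw [indicator_of_notMem fun h => hiff.1 h hy, indicator_of_notMem (notMem_compl_iff.2 hy)]
    · rw [indicator_of_mem (hiff.2 hy), indicator_of_mem hy, halfEnergyIntegrand, real_inner_comm]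
  rw [this, integral_indicator measurableSet_ball.compl,
    Measure.restrict_restrict measurableSet_ball.compl, inter_comm, ← Set.sdiff_eq, integral_inner hi,
    real_inner_comm]
  rfl

/-- If `min(|x-y|,1) / |x-y|^{N+2σ}` is integrable over `Ωᶜ × Ω`, half the energy is, up to the
factor `c_{N,σ}`, `∫_Ω (-Δ)^σ∇u·∇v + ∫_{Ωᶜ} (-Δ)^σ_Ω∇u·∇v`. The integrals truncated away from the
diagonal are symmetrized, and `Q(Ω)` is split into `Ω × ℝ^N` and `Ωᶜ × Ω`. -/
lemma setIntegral_energyIntegrand [NeZero N] (hσ0 : 0 < σ) (hσ1 : σ < 1) (u v : 𝓢(RN N, ℝ))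
    {Ω : Set (RN N)} (hΩ : MeasurableSet Ω) (hfin : volume Ω ≠ ⊤)
    (hper : IntegrableOn (fun p : RN N × RN N => kernelMajorant σ 1 (p.1 - p.2)) (Ωᶜ ×ˢ Ω)) :
    1 / 2 * ∫ p in crossSet Ω, energyIntegrand σ u v p =
      (∫ x in Ω, inner ℝ (fracLap σ (gradient u) x) (gradient v x)) +
      ∫ x in Ωᶜ, inner ℝ (regionalIntegral σ Ω (gradient u) x) (gradient v x) := by
  rw [← coe_schwartzGradient, ← coe_schwartzGradient]
  set w := schwartzGradient u
  set g := schwartzGradient v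
  obtain ⟨D, hD, k0, -⟩ := g.exists_taylor_bounds
  have hdiag : ∀ p : RN N × RN N, p.1 ≠ p.2 → ∀ᶠ ε in 𝓝[>] (0 : ℝ), p ∈ offDiagonal N ε := by
    intro p hp
    filter_upwards [Ioo_mem_nhdsGT (norm_pos_iff.2 (sub_ne_zero.2 hp))] with ε hε using hε.2.le
  -- The truncated energies converge to the energy.
  have L : Tendsto (fun ε => ∫ p in crossSet Ω, (offDiagonal N ε).indicator
      (energyIntegrand σ u v) p) (𝓝[>] 0) (𝓝 (∫ p in crossSet Ω, energyIntegrand σ u v p)) := by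
    refine tendsto_integral_filter_of_dominated_convergence (fun p => ‖energyIntegrand σ u v p‖)
      (Eventually.of_forall fun ε => ((measurable_energyIntegrand u v).indicator
        (measurableSet_offDiagonal ε)).aestronglyMeasurable)
      (Eventually.of_forall fun ε => Eventually.of_forall fun p => norm_indicator_le_norm_self _ _)
      (integrableOn_energyIntegrand hσ0 hσ1 u v hΩ hfin).norm (Eventually.of_forall fun p => ?_)
    by_cases hp : p.1 = p.2
    · have : energyIntegrand σ u v p = 0 := by simp [energyIntegrand, hp]
      have h2 : ∀ ε, (offDiagonal N ε).indicator (energyIntegrand σ u v) p = 0 := by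
        intro ε; simp [indicator, this]
      simp [h2, this]
    · refine tendsto_const_nhds.congr' ?_
      filter_upwards [hdiag p hp] with ε hε
      rw [indicator_of_mem hε]
  -- The part over `Ω × ℝ^N`.
  obtain ⟨C, hC⟩ := exists_truncatedRegional_univ_bound hσ0 hσ1 w
  have hCb : ∀ x, ∀ ε > 0, ‖(inner ℝ (truncatedRegional σ univ w x ε) (g x) : ℝ)‖ ≤ C * D := by
    intro x ε hε
    refine (norm_inner_le_norm _ _).trans ?_
    have := hC x ε hε
    exact mul_le_mul this (k0 x) (norm_nonneg _) ((norm_nonneg _).trans this)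
  have meas1 : ∀ ε, 0 < ε → IntegrableOn ((offDiagonal N ε).indicator
      (halfEnergyIntegrand σ w g)) (Ω ×ˢ univ) := fun ε hε =>
    (integrableOn_halfEnergy_truncated hσ0 w g hΩ hfin hε).mono_set
      (by rw [crossSet_eq]; exact subset_union_left)
  have fub1 : ∀ ε, 0 < ε → ∫ p in Ω ×ˢ univ, (offDiagonal N ε).indicator
      (halfEnergyIntegrand σ w g) p = ∫ x in Ω, inner ℝ (truncatedRegional σ univ w x ε) (g x) := by
    intro ε hε
    rw [Measure.volume_eq_prod, setIntegral_prod _ (meas1 ε hε)]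
    congr with x
    refine setIntegral_section_truncated w g univ x ε ?_
    rw [← compl_eq_univ_sdiff]
    exact integrableOn_truncated hσ0 w x hε
  have L1 : Tendsto (fun ε => ∫ x in Ω, inner ℝ (truncatedRegional σ univ w x ε) (g x)) (𝓝[>] 0)
      (𝓝 (∫ x in Ω, inner ℝ (fracLap σ w x) (g x))) := by
    refine tendsto_integral_filter_of_dominated_convergence (fun _ => C * D) ?_ ?_
      (integrableOn_const hfin) (Eventually.of_forall fun x =>
        (tendsto_truncatedRegional_univ hσ0 hσ1 w x).inner tendsto_const_nhds)
    · filter_upwards [self_mem_nhdsWithin] with ε hε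
      have h1 := meas1 ε hε
      rw [IntegrableOn, Measure.volume_eq_prod, ← Measure.prod_restrict] at h1
      refine (h1.integral_prod_left).1.congr (Eventually.of_forall fun x => ?_)
      refine setIntegral_section_truncated w g univ x ε ?_
      rw [← compl_eq_univ_sdiff]
      exact integrableOn_truncated hσ0 w x hε
    · filter_upwards [self_mem_nhdsWithin] with ε hε
      exact Eventually.of_forall fun x => hCb x ε hε
  -- The part over `Ωᶜ × Ω`.
  obtain ⟨B, hB, hB2⟩ := exists_firstDiff_bound (σ := σ) w
  have hbd : ∀ p : RN N × RN N, ‖halfEnergyIntegrand σ w g p‖ ≤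
      B * D * kernelMajorant σ 1 (p.1 - p.2) := by
    intro p
    refine (norm_inner_le_norm _ _).trans ?_
    refine (mul_le_mul (hB2 p.1 p.2) (k0 p.1) (norm_nonneg _)
      (mul_nonneg hB.le (kernelMajorant_nonneg _))).trans (le_of_eq (by ring))
  have int2 : IntegrableOn (halfEnergyIntegrand σ w g) (Ωᶜ ×ˢ Ω) :=
    (hper.const_mul (B * D)).mono' (measurable_halfEnergyIntegrand w g).aestronglyMeasurable
      (Eventually.of_forall hbd)
  have L2 : Tendsto (fun ε => ∫ p in Ωᶜ ×ˢ Ω, (offDiagonal N ε).indicator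
      (halfEnergyIntegrand σ w g) p) (𝓝[>] 0)
      (𝓝 (∫ p in Ωᶜ ×ˢ Ω, halfEnergyIntegrand σ w g p)) := by
    refine tendsto_integral_filter_of_dominated_convergence
      (fun p => ‖halfEnergyIntegrand σ w g p‖)
      (Eventually.of_forall fun ε => ((measurable_halfEnergyIntegrand w g).indicator
        (measurableSet_offDiagonal ε)).aestronglyMeasurable)
      (Eventually.of_forall fun ε => Eventually.of_forall fun p => norm_indicator_le_norm_self _ _)
      int2.norm ?_
    filter_upwards [ae_restrict_mem (hΩ.compl.prod hΩ)] with p hp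
    refine tendsto_const_nhds.congr' ?_
    filter_upwards [hdiag p (fun h => hp.1 (h ▸ hp.2))] with ε hε
    rw [indicator_of_mem hε]
  have fub2 : ∫ p in Ωᶜ ×ˢ Ω, halfEnergyIntegrand σ w g p =
      ∫ x in Ωᶜ, inner ℝ (regionalIntegral σ Ω w x) (g x) := by
    rw [Measure.volume_eq_prod, setIntegral_prod _ int2]
    have hw := hper
    rw [IntegrableOn, Measure.volume_eq_prod, ← Measure.prod_restrict] at hw
    refine integral_congr_ae ?_
    filter_upwards [hw.prod_right_ae] with x hx
    simp only [halfEnergyIntegrand]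
    rw [regionalIntegral, real_inner_comm, ← integral_inner]
    · simp only [real_inner_comm (g x)]
    · exact (hx.const_mul B).mono' ((measurable_firstDiff w.continuous).comp_measurable
        (measurable_prodMk_left (x := x))).aestronglyMeasurable
        (Eventually.of_forall fun y => hB2 x y)
  have split : ∀ ε, 0 < ε → 1 / 2 * ∫ p in crossSet Ω, (offDiagonal N ε).indicator
      (energyIntegrand σ u v) p =
      (∫ x in Ω, inner ℝ (truncatedRegional σ univ w x ε) (g x)) +
      ∫ p in Ωᶜ ×ˢ Ω, (offDiagonal N ε).indicator (halfEnergyIntegrand σ w g) p := by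
    intro ε hε
    have hi := integrableOn_halfEnergy_truncated hσ0 w g hΩ hfin hε
    rw [setIntegral_energy_truncated hσ0 u v hΩ hfin hε, ← fub1 ε hε]
    rw [crossSet_eq] at hi ⊢
    rw [setIntegral_union _ (hΩ.compl.prod hΩ) (hi.mono_set subset_union_left)
      (hi.mono_set subset_union_right)]
    · ring
    · rw [Set.disjoint_left]; rintro p hp hq; exact hq.1 hp.1
  rw [← fub2]
  refine tendsto_nhds_unique (L.const_mul (1 / 2)) ((L1.add L2).congr' ?_)
  filter_upwards [self_mem_nhdsWithin] with ε hε
  exact (split ε hε).symm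

/-- Under the same condition the regional integral is integrable on the complement. -/
lemma integrableOn_regionalIntegral [NeZero N] (f : 𝓢(RN N, RN N))
    {Ω : Set (RN N)}
    (hper : IntegrableOn (fun p : RN N × RN N => kernelMajorant σ 1 (p.1 - p.2)) (Ωᶜ ×ˢ Ω)) :
    IntegrableOn (regionalIntegral σ Ω f) Ωᶜ := by
  obtain ⟨B, hB, hB2⟩ := exists_firstDiff_bound (σ := σ) f
  rw [IntegrableOn, Measure.volume_eq_prod, ← Measure.prod_restrict] at hper
  exact ((hper.const_mul B).mono' (measurable_firstDiff f.continuous).aestronglyMeasurable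
    (Eventually.of_forall fun p => hB2 p.1 p.2)).integral_prod_left

end Energy

/-! ### Boundary charts, tangent paraboloids and the outer normal -/

/-- `Ω` is, in the ball of radius `r` around `x₀`, the strict subgraph of a `C^{1,1}` function `φ`
over the hyperplane orthogonal to the unit vector `e`. -/
structure GraphChart {N : ℕ} (Ω : Set (RN N)) (x₀ : RN N) (r : ℝ) (e : RN N)
    (φ : (ℝ ∙ e)ᗮ → ℝ) (K : ℝ≥0) : Prop where
  pos : 0 < r
  norm_e : ‖e‖ = 1
  contDiff : ContDiff ℝ 1 φ
  lipschitz : LipschitzWith K (fderiv ℝ φ)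
  mem_iff : ∀ y ∈ Metric.ball x₀ r,
    y ∈ Ω ↔ inner ℝ e y < φ ((ℝ ∙ e)ᗮ.orthogonalProjectionOnto y)

/-- The (non-normalized) upward normal `e - ∇φ` of the graph of `φ`. -/
def graphNormal {N : ℕ} (e : RN N) (φ : (ℝ ∙ e)ᗮ → ℝ) (x' : (ℝ ∙ e)ᗮ) : RN N :=
  e - (gradient φ x' : (ℝ ∙ e)ᗮ)

/-- Near `p` the set `Ω` is squeezed between the two paraboloids of opening `K` that are tangent at
`p` to the hyperplane orthogonal to `n`. -/
def TangentAt {N : ℕ} (Ω : Set (RN N)) (K r : ℝ) (p n : RN N) : Prop :=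
  ∀ y ∈ Metric.ball p r, (y ∈ Ω → inner ℝ (y - p) n ≤ K * ‖y - p‖ ^ 2) ∧
    (y ∉ Ω → -(K * ‖y - p‖ ^ 2) ≤ inner ℝ (y - p) n)

section Hyperplane
variable {N : ℕ} {e : RN N}

lemma inner_hyperplane (x' : (ℝ ∙ e)ᗮ) : inner ℝ e (x' : RN N) = 0 :=
  Submodule.mem_orthogonal_singleton_iff_inner_right.1 x'.2

lemma proj_add_smul (x' : (ℝ ∙ e)ᗮ) (t : ℝ) :
    (ℝ ∙ e)ᗮ.orthogonalProjectionOnto ((x' : RN N) + t • e) = x' := by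
  rw [map_add, map_smul, Submodule.orthogonalProjectionOnto_mem_subspace_eq_self,
    Submodule.orthogonalProjectionOnto_orthogonalComplement_singleton_eq_zero, smul_zero, add_zero]

lemma inner_add_smul (he : ‖e‖ = 1) (x' : (ℝ ∙ e)ᗮ) (t : ℝ) :
    inner ℝ e ((x' : RN N) + t • e) = t := by
  rw [inner_add_right, inner_hyperplane, inner_smul_right, real_inner_self_eq_norm_sq, he]
  simp

lemma proj_add_inner_smul (he : ‖e‖ = 1) (y : RN N) :
    ((ℝ ∙ e)ᗮ.orthogonalProjectionOnto y : RN N) + (inner ℝ e y : ℝ) • e = y := by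
  have h1 := Submodule.starProjection_add_starProjection_orthogonal (K := ℝ ∙ e) y
  have h2 := Submodule.starProjection_unit_singleton ℝ he y
  rw [h2, add_comm] at h1
  exact h1

lemma norm_proj_le (y : RN N) : ‖(ℝ ∙ e)ᗮ.orthogonalProjectionOnto y‖ ≤ ‖y‖ :=
  Submodule.norm_orthogonalProjectionOnto_apply_le _ _

lemma inner_graphNormal (φ : (ℝ ∙ e)ᗮ → ℝ) (x' : (ℝ ∙ e)ᗮ) (y : RN N) :
    inner ℝ y (graphNormal e φ x') =
      inner ℝ e y - fderiv ℝ φ x' ((ℝ ∙ e)ᗮ.orthogonalProjectionOnto y) := by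
  rw [graphNormal, inner_sub_right, real_inner_comm]
  congr 1
  rw [← Submodule.inner_orthogonalProjectionOnto_eq_of_mem_right, real_inner_comm, gradient,
    InnerProductSpace.toDual_symm_apply]

lemma inner_e_graphNormal (he : ‖e‖ = 1) (φ : (ℝ ∙ e)ᗮ → ℝ) (x' : (ℝ ∙ e)ᗮ) :
    inner ℝ e (graphNormal e φ x') = 1 := by
  rw [inner_graphNormal, Submodule.orthogonalProjectionOnto_orthogonalComplement_singleton_eq_zero,
    map_zero, real_inner_self_eq_norm_sq, he]
  norm_num

lemma one_le_norm_graphNormal (he : ‖e‖ = 1) (φ : (ℝ ∙ e)ᗮ → ℝ) (x' : (ℝ ∙ e)ᗮ) :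
    1 ≤ ‖graphNormal e φ x'‖ := by
  have := real_inner_le_norm e (graphNormal e φ x')
  rwa [inner_e_graphNormal he, he, one_mul] at this

lemma continuous_graphNormal {φ : (ℝ ∙ e)ᗮ → ℝ} (hφ : ContDiff ℝ 1 φ) :
    Continuous (graphNormal e φ) := by
  have h1 : Continuous (fderiv ℝ φ) := hφ.continuous_fderiv one_ne_zero
  have h2 : Continuous (gradient φ) := by
    unfold gradient
    exact (InnerProductSpace.toDual ℝ (ℝ ∙ e)ᗮ).symm.continuous.comp h1
  unfold graphNormal
  fun_prop

end Hyperplane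

namespace GraphChart
variable {N : ℕ} {Ω : Set (RN N)} {x₀ e : RN N} {r : ℝ} {φ : (ℝ ∙ e)ᗮ → ℝ} {K : ℝ≥0}

lemma taylor (h : GraphChart Ω x₀ r e φ K) (a b : (ℝ ∙ e)ᗮ) :
    |φ b - φ a - fderiv ℝ φ a (b - a)| ≤ K * ‖b - a‖ ^ 2 := by
  rw [← Real.norm_eq_abs, sq, ← mul_assoc]
  have hd : ∀ z, DifferentiableAt ℝ φ z := fun z => h.contDiff.differentiable one_ne_zero z
  refine (convex_segment (𝕜 := ℝ) a b).norm_image_sub_le_of_norm_fderiv_le'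
      (fun z _ => hd z) (fun z hz => ?_) (left_mem_segment ℝ a b) (right_mem_segment ℝ a b)
  refine (h.lipschitz.norm_sub_le z a).trans ?_
  gcongr
  obtain ⟨s, t, hs, ht, hst, rfl⟩ := hz
  have : s • a + t • b - a = t • (b - a) := by
    rw [← eq_sub_iff_add_eq] at hst
    rw [hst]; module
  rw [this, norm_smul, Real.norm_of_nonneg ht]
  exact mul_le_of_le_one_left (norm_nonneg _) (by linarith)

lemma inner_eq_of_mem_frontier (h : GraphChart Ω x₀ r e φ K) (hΩ : IsOpen Ω) {p : RN N}
    (hp : p ∈ frontier Ω) (hpb : p ∈ Metric.ball x₀ r) :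
    inner ℝ e p = φ ((ℝ ∙ e)ᗮ.orthogonalProjectionOnto p) := by
  rw [hΩ.frontier_eq] at hp
  refine le_antisymm ?_ (not_lt.1 fun hlt => hp.2 ((h.mem_iff p hpb).2 hlt))
  by_contra! hlt
  have c1 : Continuous fun y : RN N => (inner ℝ e y : ℝ) := by fun_prop
  have c2 : Continuous fun y : RN N => φ ((ℝ ∙ e)ᗮ.orthogonalProjectionOnto y) :=
    h.contDiff.continuous.comp (by fun_prop)
  have ho : IsOpen ({y : RN N | φ ((ℝ ∙ e)ᗮ.orthogonalProjectionOnto y) < inner ℝ e y} ∩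
      Metric.ball x₀ r) := (isOpen_lt c2 c1).inter Metric.isOpen_ball
  obtain ⟨y, ⟨hy1, hy2⟩, hy3⟩ := mem_closure_iff.1 hp.1 _ ho ⟨hlt, hpb⟩
  exact lt_asymm hy1 ((h.mem_iff y hy2).1 hy3)

lemma mem_frontier_of_inner_eq (h : GraphChart Ω x₀ r e φ K) (hΩ : IsOpen Ω) {p : RN N}
    (hpb : p ∈ Metric.ball x₀ r) (hp : inner ℝ e p = φ ((ℝ ∙ e)ᗮ.orthogonalProjectionOnto p)) :
    p ∈ frontier Ω := by
  rw [hΩ.frontier_eq]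
  refine ⟨?_, fun hm => ((h.mem_iff p hpb).1 hm).ne hp⟩
  have hc : Tendsto (fun t : ℝ => p + t • e) (𝓝[<] 0) (𝓝 p) := by
    have : Continuous fun t : ℝ => p + t • e := by fun_prop
    simpa using (this.tendsto 0).mono_left nhdsWithin_le_nhds
  refine mem_closure_of_tendsto hc ?_
  filter_upwards [hc.eventually (Metric.isOpen_ball.mem_nhds hpb), self_mem_nhdsWithin] with t ht ht0
  rw [h.mem_iff _ ht, map_add, map_smul,
    Submodule.orthogonalProjectionOnto_orthogonalComplement_singleton_eq_zero, smul_zero, add_zero,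
    inner_add_right, inner_smul_right, real_inner_self_eq_norm_sq, h.norm_e, hp]
  simpa using ht0

/-- The Taylor remainder of a `C^{1,1}` graph is quadratic, which puts the graph between two tangent
paraboloids. -/
lemma tangentAt_graphNormal (h : GraphChart Ω x₀ r e φ K) (hΩ : IsOpen Ω) {p : RN N}
    (hp : p ∈ frontier Ω) (hpb : p ∈ Metric.ball x₀ (r / 2)) :
    TangentAt Ω K (r / 2) p (graphNormal e φ ((ℝ ∙ e)ᗮ.orthogonalProjectionOnto p)) := by
  intro y hy
  have hr := h.pos
  have hpb' : p ∈ Metric.ball x₀ r := Metric.ball_subset_ball (by linarith) hpb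
  have hyb : y ∈ Metric.ball x₀ r := by
    rw [Metric.mem_ball] at *
    linarith [dist_triangle y p x₀]
  have e1 := h.inner_eq_of_mem_frontier hΩ hp hpb'
  have t1 := abs_le.1 (h.taylor ((ℝ ∙ e)ᗮ.orthogonalProjectionOnto p)
    ((ℝ ∙ e)ᗮ.orthogonalProjectionOnto y))
  have n1 : ‖(ℝ ∙ e)ᗮ.orthogonalProjectionOnto y - (ℝ ∙ e)ᗮ.orthogonalProjectionOnto p‖ ^ 2
      ≤ ‖y - p‖ ^ 2 := by
    rw [← map_sub]; gcongr; exact norm_proj_le _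
  have n2 : (K : ℝ) * ‖(ℝ ∙ e)ᗮ.orthogonalProjectionOnto y -
      (ℝ ∙ e)ᗮ.orthogonalProjectionOnto p‖ ^ 2 ≤ K * ‖y - p‖ ^ 2 := by gcongr
  rw [inner_graphNormal, inner_sub_right, map_sub, h.mem_iff y hyb]
  constructor
  · intro hlt; linarith
  · intro hlt; linarith [not_lt.1 hlt]

end GraphChart

section Normal
variable {N : ℕ} {Ω : Set (RN N)}

lemma TangentAt.mono {K K' r r' : ℝ} {p n : RN N} (h : TangentAt Ω K r p n) (hK : K ≤ K')
    (hr : r' ≤ r) : TangentAt Ω K' r' p n := by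
  intro y hy
  obtain ⟨h1, h2⟩ := h y (Metric.ball_subset_ball hr hy)
  have : K * ‖y - p‖ ^ 2 ≤ K' * ‖y - p‖ ^ 2 := by gcongr
  exact ⟨fun hh => (h1 hh).trans this, fun hh => by linarith [h2 hh]⟩

lemma TangentAt.compl {K r : ℝ} {p n : RN N} (h : TangentAt Ω K r p n) :
    TangentAt Ωᶜ K r p (-n) := by
  intro y hy
  obtain ⟨h1, h2⟩ := h y hy
  rw [inner_neg_right]
  exact ⟨fun h => by linarith [h2 h], fun h => by linarith [h1 (not_not.1 h)]⟩

lemma TangentAt.normalize {K r : ℝ} {p n : RN N} (h : TangentAt Ω K r p n) (hK : 0 ≤ K)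
    (hn : 1 ≤ ‖n‖) : TangentAt Ω K r p (‖n‖⁻¹ • n) := by
  intro y hy
  obtain ⟨h1, h2⟩ := h y hy
  have h0 : 0 < ‖n‖ := by linarith
  have hi : ‖n‖⁻¹ ≤ 1 := inv_le_one_of_one_le₀ hn
  have hi0 : 0 < ‖n‖⁻¹ := by positivity
  have hq : 0 ≤ K * ‖y - p‖ ^ 2 := by positivity
  rw [inner_smul_right]
  constructor
  · intro hh; nlinarith [h1 hh]
  · intro hh; nlinarith [h2 hh]

lemma TangentAt.isOuterUnitNormal {K r : ℝ} {p n : RN N} (h : TangentAt Ω K r p n)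
    (hr : 0 < r) (hK : 0 ≤ K) (hn : ‖n‖ = 1) : IsOuterUnitNormal Ω p n := by
  refine ⟨hn, fun ε hε => ?_⟩
  have hpos : 0 < min r (ε / (K + 1)) := by positivity
  filter_upwards [Metric.ball_mem_nhds p hpos] with y hy
  have hy1 : y ∈ Metric.ball p r := Metric.ball_subset_ball (min_le_left _ _) hy
  have hy2 : ‖y - p‖ * (K + 1) ≤ ε := by
    rw [← le_div_iff₀ (by positivity), ← dist_eq_norm]
    exact (hy.le.trans (min_le_right _ _))
  obtain ⟨h1, h2⟩ := h y hy1
  have h3 : K * ‖y - p‖ ^ 2 ≤ ε * ‖y - p‖ := by nlinarith [norm_nonneg (y - p)]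
  constructor
  · intro hh; by_contra hc; linarith [h2 hc]
  · intro hh hc; linarith [h1 hc]

lemma IsOuterUnitNormal.unique {p n m : RN N} (hn : IsOuterUnitNormal Ω p n)
    (hm : IsOuterUnitNormal Ω p m) : n = m := by
  by_contra hne
  have hd : 0 < ‖n - m‖ := norm_pos_iff.2 (sub_ne_zero.2 hne)
  have hsq : ‖n - m‖ ^ 2 = 2 - 2 * inner ℝ n m := by
    rw [norm_sub_sq_real, hn.1, hm.1]; ring
  have hlt : 0 < 1 - inner ℝ n m := by nlinarith
  set a := 1 - inner ℝ n m
  have hε : 0 < a / (2 * ‖n - m‖) := by positivity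
  have ev := (hn.2 _ hε).and (hm.2 _ hε)
  have hc : Tendsto (fun t : ℝ => p + t • (n - m)) (𝓝[>] 0) (𝓝 p) := by
    have : Continuous fun t : ℝ => p + t • (n - m) := by fun_prop
    simpa using (this.tendsto 0).mono_left nhdsWithin_le_nhds
  obtain ⟨t, ⟨h1, h2⟩, ht⟩ := ((hc.eventually ev).and self_mem_nhdsWithin).exists
  have ht0 : (0 : ℝ) < t := ht
  simp only [add_sub_cancel_left, norm_smul, Real.norm_of_nonneg ht0.le, inner_smul_left,
    inner_sub_left, real_inner_self_eq_norm_sq, hn.1, hm.1, RCLike.conj_to_real] at h1 h2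
  have q : a / (2 * ‖n - m‖) * (t * ‖n - m‖) = t * a / 2 := by field_simp
  rw [q] at h1
  rw [neg_mul, q] at h2
  rw [real_inner_comm] at h1
  have hta : 0 < t * a := by positivity
  refine h1.2 (by simp only [a] at *; nlinarith) (h2.1 (by simp only [a] at *; nlinarith))

lemma IsOuterUnitNormal.outerNormal_eq {p n : RN N} (hn : IsOuterUnitNormal Ω p n) :
    outerNormal Ω p = n :=
  IsOuterUnitNormal.unique (Classical.epsilon_spec ⟨n, hn⟩) hn

end Normal

section NormalField
variable {N : ℕ} {Ω : Set (RN N)}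

lemma GraphChart.outerNormal_eq {x₀ e : RN N} {r : ℝ} {φ : (ℝ ∙ e)ᗮ → ℝ} {K : ℝ≥0}
    (h : GraphChart Ω x₀ r e φ K) (hΩ : IsOpen Ω) {p : RN N}
    (hp : p ∈ frontier Ω) (hpb : p ∈ Metric.ball x₀ (r / 2)) :
    outerNormal Ω p = ‖graphNormal e φ ((ℝ ∙ e)ᗮ.orthogonalProjectionOnto p)‖⁻¹ •
      graphNormal e φ ((ℝ ∙ e)ᗮ.orthogonalProjectionOnto p) := by
  have h1 := one_le_norm_graphNormal h.norm_e φ ((ℝ ∙ e)ᗮ.orthogonalProjectionOnto p)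
  refine (((h.tangentAt_graphNormal hΩ hp hpb).normalize K.2 h1).isOuterUnitNormal
    (half_pos h.pos) K.2 ?_).outerNormal_eq
  rw [norm_smul, norm_inv, norm_norm, inv_mul_cancel₀ (by positivity)]

lemma IsBoundedC11Domain.exists_chart (hΩ : IsBoundedC11Domain Ω) {x : RN N}
    (hx : x ∈ frontier Ω) : ∃ (r : ℝ) (e : RN N) (φ : (ℝ ∙ e)ᗮ → ℝ) (K : ℝ≥0),
      GraphChart Ω x r e φ K := by
  obtain ⟨r, e, φ, K, h1, h2, h3, h4, h5⟩ := hΩ.exists_graph x hx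
  exact ⟨r, e, φ, K, h1, h2, h3, h4, h5⟩

lemma IsBoundedC11Domain.isCompact_frontier (hΩ : IsBoundedC11Domain Ω) :
    IsCompact (frontier Ω) :=
  Metric.isCompact_of_isClosed_isBounded isClosed_frontier
    (hΩ.isBounded.closure.subset frontier_subset_closure)

/-- A `C^{1,1}` domain satisfies a two-sided tangent paraboloid condition with uniform constants. -/
lemma IsBoundedC11Domain.exists_tangentAt (hΩ : IsBoundedC11Domain Ω) :
    ∃ K r : ℝ, 0 < K ∧ 0 < r ∧ ∀ p ∈ frontier Ω, ‖outerNormal Ω p‖ = 1 ∧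
      TangentAt Ω K r p (outerNormal Ω p) := by
  have := hΩ.isCompact_frontier.induction_on (p := fun s => ∃ K r : ℝ, 0 < K ∧ 0 < r ∧
    ∀ p ∈ s ∩ frontier Ω, ‖outerNormal Ω p‖ = 1 ∧ TangentAt Ω K r p (outerNormal Ω p))
    ⟨1, 1, one_pos, one_pos, by simp⟩ ?_ ?_ ?_
  · simpa using this
  · rintro s t hst ⟨K, r, hK, hr, h⟩
    exact ⟨K, r, hK, hr, fun p hp => h p ⟨hst hp.1, hp.2⟩⟩
  · rintro s t ⟨K, r, hK, hr, h⟩ ⟨K', r', hK', hr', h'⟩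
    refine ⟨max K K', min r r', by positivity, by positivity, fun p hp => ?_⟩
    rcases hp.1 with hs | ht
    · exact ⟨(h p ⟨hs, hp.2⟩).1, (h p ⟨hs, hp.2⟩).2.mono (le_max_left _ _) (min_le_left _ _)⟩
    · exact ⟨(h' p ⟨ht, hp.2⟩).1, (h' p ⟨ht, hp.2⟩).2.mono (le_max_right _ _) (min_le_right _ _)⟩
  · intro x hx
    obtain ⟨r, e, φ, K, h⟩ := hΩ.exists_chart hx
    refine ⟨Metric.ball x (r / 2), mem_nhdsWithin_of_mem_nhds (Metric.ball_mem_nhds _ (half_pos h.pos)),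
      K + 1, r / 2, by positivity, half_pos h.pos, fun p hp => ?_⟩
    have h1 := one_le_norm_graphNormal h.norm_e φ ((ℝ ∙ e)ᗮ.orthogonalProjectionOnto p)
    rw [h.outerNormal_eq hΩ.isOpen hp.2 hp.1]
    refine ⟨?_, (((h.tangentAt_graphNormal hΩ.isOpen hp.2 hp.1).normalize K.2 h1)).mono
      (by linarith) le_rfl⟩
    rw [norm_smul, norm_inv, norm_norm, inv_mul_cancel₀ (by positivity)]

lemma IsBoundedC11Domain.continuousOn_outerNormal (hΩ : IsBoundedC11Domain Ω) :
    ContinuousOn (outerNormal Ω) (frontier Ω) := by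
  intro x hx
  obtain ⟨r, e, φ, K, h⟩ := hΩ.exists_chart hx
  have hc : Continuous fun p : RN N => graphNormal e φ ((ℝ ∙ e)ᗮ.orthogonalProjectionOnto p) :=
    (continuous_graphNormal h.contDiff).comp (by fun_prop)
  have hne : ∀ p : RN N, ‖graphNormal e φ ((ℝ ∙ e)ᗮ.orthogonalProjectionOnto p)‖ ≠ 0 := fun p =>
    (zero_lt_one.trans_le (one_le_norm_graphNormal h.norm_e φ _)).ne'
  refine ((hc.norm.inv₀ hne).smul hc).continuousWithinAt.congr_of_eventuallyEq_of_mem ?_ hx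
  filter_upwards [self_mem_nhdsWithin,
    mem_nhdsWithin_of_mem_nhds (Metric.ball_mem_nhds x (half_pos h.pos))] with p hp hpb
  exact h.outerNormal_eq hΩ.isOpen hp hpb

end NormalField

/-! ### Graph coordinates and the perimeter estimate -/

section GraphCoordinates
variable {N : ℕ} {e : RN N}

lemma measurePreserving_add_smul (he : ‖e‖ = 1) :
    MeasurePreserving (fun p : (ℝ ∙ e)ᗮ × ℝ => (p.1 : RN N) + p.2 • e) := by
  have h1 := ((ℝ ∙ e).measurePreserving_measurableEquivProd (0 : RN N)).symm
  rw [InnerProductSpace.euclideanHausdorffMeasure_eq_volume] at h1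
  have h2 := (LinearIsometryEquiv.toSpanUnitSingleton (𝕜 := ℝ) e he).measurePreserving
  have h3 := h1.comp ((h2.prod (MeasurePreserving.id (volume : Measure (ℝ ∙ e)ᗮ))).comp
    (Measure.measurePreserving_swap (μ := (volume : Measure (ℝ ∙ e)ᗮ)) (ν := (volume : Measure ℝ))))
  convert h3 using 1
  · ext1 p
    simp [add_comm]
  · rfl

/-- Coordinates adapted to a graph: `(x', t) ↦ x' + (φ(x') + t) e`. -/
def graphHomeomorph (he : ‖e‖ = 1) (φ : (ℝ ∙ e)ᗮ → ℝ) (hφ : Continuous φ) :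
    (ℝ ∙ e)ᗮ × ℝ ≃ₜ RN N where
  toFun p := (p.1 : RN N) + (φ p.1 + p.2) • e
  invFun y := ((ℝ ∙ e)ᗮ.orthogonalProjectionOnto y,
    inner ℝ e y - φ ((ℝ ∙ e)ᗮ.orthogonalProjectionOnto y))
  left_inv p := by
    simp only [proj_add_smul, inner_add_smul he, add_sub_cancel_left]
  right_inv y := by
    simp only [add_sub_cancel, proj_add_inner_smul he]
  continuous_toFun := by fun_prop
  continuous_invFun := by fun_prop

lemma measurePreserving_graphHomeomorph (he : ‖e‖ = 1) (φ : (ℝ ∙ e)ᗮ → ℝ) (hφ : Continuous φ) :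
    MeasurePreserving (graphHomeomorph he φ hφ) := by
  have mp : MeasurePreserving (fun p : (ℝ ∙ e)ᗮ × ℝ => (p.1, φ p.1 + p.2)) :=
    (MeasurePreserving.id _).skew_product (by fun_prop)
      (Eventually.of_forall fun x => (measurePreserving_add_left volume (φ x)).map_eq)
  exact (measurePreserving_add_smul he).comp mp

end GraphCoordinates

section Boundary
variable {N : ℕ} {Ω : Set (RN N)}

lemma GraphChart.frontier_inter_ball {x₀ e : RN N} {r : ℝ} {φ : (ℝ ∙ e)ᗮ → ℝ} {K : ℝ≥0}
    (h : GraphChart Ω x₀ r e φ K) (hΩ : IsOpen Ω) :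
    frontier Ω ∩ Metric.ball x₀ r = (fun x' : (ℝ ∙ e)ᗮ => (x' : RN N) + φ x' • e) '' univ ∩
      Metric.ball x₀ r := by
  ext p
  simp only [mem_inter_iff, and_congr_left_iff, image_univ, mem_range]
  intro hp
  constructor
  · intro hf
    refine ⟨(ℝ ∙ e)ᗮ.orthogonalProjectionOnto p, ?_⟩
    rw [← h.inner_eq_of_mem_frontier hΩ hf hp, proj_add_inner_smul h.norm_e]
  · rintro ⟨x', rfl⟩
    refine h.mem_frontier_of_inner_eq hΩ hp ?_
    rw [inner_add_smul h.norm_e, proj_add_smul]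

lemma IsBoundedC11Domain.volume_frontier (hΩ : IsBoundedC11Domain Ω) :
    volume (frontier Ω) = 0 := by
  refine measure_null_of_locally_null _ fun x hx => ?_
  obtain ⟨r, e, φ, K, h⟩ := hΩ.exists_chart hx
  refine ⟨frontier Ω ∩ Metric.ball x r, inter_mem_nhdsWithin _ (Metric.ball_mem_nhds _ h.pos), ?_⟩
  rw [h.frontier_inter_ball hΩ.isOpen]
  refine measure_mono_null inter_subset_left ?_
  have hφ := h.contDiff.continuous
  have e1 : (fun x' : (ℝ ∙ e)ᗮ => (x' : RN N) + φ x' • e) '' univ =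
      (graphHomeomorph h.norm_e φ hφ) '' (univ ×ˢ {0}) := by
    ext y
    simp [graphHomeomorph]
  rw [e1, (graphHomeomorph h.norm_e φ hφ).image_eq_preimage_symm,
    ← (measurePreserving_graphHomeomorph h.norm_e φ hφ).measure_preimage]
  · rw [← preimage_comp]
    simp [Measure.volume_eq_prod]
  · have : IsClosed ((graphHomeomorph h.norm_e φ hφ).symm ⁻¹' (univ ×ˢ {0})) :=
      (isClosed_univ.prod isClosed_singleton).preimage (graphHomeomorph h.norm_e φ hφ).symm.continuous
    exact this.measurableSet.nullMeasurableSet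

/-- A segment from a point of a set to a point outside it meets the frontier. -/
lemma exists_mem_segment_frontier {x y : RN N} (hx : x ∈ Ω) (hy : y ∉ Ω) :
    ∃ q ∈ segment ℝ x y, q ∈ frontier Ω := by
  by_contra! hq
  have hpre : IsPreconnected (segment ℝ x y) := (convex_segment x y).isPreconnected
  have hx1 : x ∈ interior Ω := by
    by_contra hn
    exact hq x (left_mem_segment ℝ x y) ⟨subset_closure hx, hn⟩
  have hsub : segment ℝ x y ⊆ interior Ω ∪ (closure Ω)ᶜ := by
    intro z hz
    by_contra hn
    rw [mem_union, not_or, mem_compl_iff, not_not] at hn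
    exact hq z hz ⟨hn.2, hn.1⟩
  have hd : Disjoint (interior Ω) (closure Ω)ᶜ :=
    disjoint_compl_right.mono_left (interior_subset.trans subset_closure)
  have := hpre.subset_left_of_subset_union isOpen_interior isClosed_closure.isOpen_compl hd hsub
    ⟨x, left_mem_segment ℝ x y, hx1⟩
  exact hy (interior_subset (this (right_mem_segment ℝ x y)))

lemma GraphChart.exists_lipschitz {x₀ e : RN N} {r : ℝ} {φ : (ℝ ∙ e)ᗮ → ℝ} {K : ℝ≥0}
    (h : GraphChart Ω x₀ r e φ K) : ∃ L : ℝ, 0 ≤ L ∧ ∀ x ∈ Metric.ball x₀ r,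
      ∀ y ∈ Metric.ball x₀ r, |φ ((ℝ ∙ e)ᗮ.orthogonalProjectionOnto x) -
        φ ((ℝ ∙ e)ᗮ.orthogonalProjectionOnto y)| ≤ L * ‖x - y‖ := by
  set a := (ℝ ∙ e)ᗮ.orthogonalProjectionOnto x₀
  have hr := h.pos
  refine ⟨‖fderiv ℝ φ a‖ + K * r, by positivity, fun x hx y hy => ?_⟩
  have hproj : ∀ z ∈ Metric.ball x₀ r, (ℝ ∙ e)ᗮ.orthogonalProjectionOnto z ∈ Metric.ball a r := by
    intro z hz
    rw [Metric.mem_ball, dist_eq_norm, ← map_sub]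
    exact (norm_proj_le _).trans_lt (by rwa [← dist_eq_norm])
  rw [← Real.norm_eq_abs]
  refine ((convex_ball a r).norm_image_sub_le_of_norm_fderiv_le (𝕜 := ℝ)
    (C := ‖fderiv ℝ φ a‖ + K * r) (fun z _ => h.contDiff.differentiable one_ne_zero z) (fun z hz => ?_) (hproj y hy)
    (hproj x hx)).trans ?_
  · have h1 := h.lipschitz.norm_sub_le z a
    have h2 : (K : ℝ) * ‖z - a‖ ≤ K * r := by
      have : ‖z - a‖ < r := by rw [← dist_eq_norm]; exact hz
      gcongr
    have h3 := norm_le_norm_add_norm_sub' (fderiv ℝ φ z) (fderiv ℝ φ a)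
    linarith
  · rw [← map_sub]
    gcongr
    exact norm_proj_le _

/-- The points of `Ω` which the translation by `ζ` moves out of `Ω` have measure `O(|ζ|)`. -/
lemma IsBoundedC11Domain.exists_volume_translate_le (hΩ : IsBoundedC11Domain Ω) :
    ∃ C ρ : ℝ, 0 ≤ C ∧ 0 < ρ ∧ ∀ ζ : RN N, ‖ζ‖ < ρ →
      volume {x | x ∈ Ω ∧ x + ζ ∉ Ω} ≤ ENNReal.ofReal (C * ‖ζ‖) := by
  have := hΩ.isCompact_frontier.induction_on (p := fun s => ∃ C ρ : ℝ, 0 ≤ C ∧ 0 < ρ ∧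
    ∀ ζ : RN N, ‖ζ‖ < ρ → volume {x | x ∈ Ω ∧ x + ζ ∉ Ω ∧
      ∃ q ∈ segment ℝ x (x + ζ), q ∈ s} ≤ ENNReal.ofReal (C * ‖ζ‖))
    ⟨0, 1, le_rfl, one_pos, by simp⟩ ?_ ?_ ?_
  · obtain ⟨C, ρ, hC, hρ, h⟩ := this
    refine ⟨C, ρ, hC, hρ, fun ζ hζ => (measure_mono fun x hx => ?_).trans (h ζ hζ)⟩
    exact ⟨hx.1, hx.2, exists_mem_segment_frontier hx.1 hx.2⟩
  · rintro s t hst ⟨C, ρ, hC, hρ, h⟩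
    refine ⟨C, ρ, hC, hρ, fun ζ hζ => (measure_mono fun x hx => ?_).trans (h ζ hζ)⟩
    obtain ⟨q, hq, hqs⟩ := hx.2.2
    exact ⟨hx.1, hx.2.1, q, hq, hst hqs⟩
  · rintro s t ⟨C, ρ, hC, hρ, h⟩ ⟨C', ρ', hC', hρ', h'⟩
    refine ⟨C + C', min ρ ρ', by positivity, by positivity, fun ζ hζ => ?_⟩
    rw [add_mul, ENNReal.ofReal_add (by positivity) (by positivity)]
    refine le_trans (measure_mono fun x hx => ?_) ((measure_union_le _ _).trans (add_le_add
      (h ζ (hζ.trans_le (min_le_left _ _))) (h' ζ (hζ.trans_le (min_le_right _ _)))))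
    obtain ⟨q, hq, hqs | hqs⟩ := hx.2.2
    · exact Or.inl ⟨hx.1, hx.2.1, q, hq, hqs⟩
    · exact Or.inr ⟨hx.1, hx.2.1, q, hq, hqs⟩
  · intro x₀ hx₀
    obtain ⟨r, e, φ, K, h⟩ := hΩ.exists_chart hx₀
    have hr := h.pos
    have he := h.norm_e
    obtain ⟨L, hL0, hL⟩ := h.exists_lipschitz
    set a := (ℝ ∙ e)ᗮ.orthogonalProjectionOnto x₀
    have hfin : volume (Metric.ball a r) ≠ ⊤ := measure_ball_lt_top.ne
    refine ⟨Metric.ball x₀ (r / 3), mem_nhdsWithin_of_mem_nhds (Metric.ball_mem_nhds _ (by positivity)),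
      (volume (Metric.ball a r)).toReal * (1 + L), r / 3, by positivity, by positivity, fun ζ hζ => ?_⟩
    have hφ := h.contDiff.continuous
    set Φ := graphHomeomorph he φ hφ
    -- A point that leaves `Ω` under a translation by `ζ` lies below the graph by at most
    -- `(1 + L) ‖ζ‖`.
    set S : Set ((ℝ ∙ e)ᗮ × ℝ) := Metric.ball a r ×ˢ Icc (-((1 + L) * ‖ζ‖)) 0
    have hS : volume S = ENNReal.ofReal ((volume (Metric.ball a r)).toReal * (1 + L) * ‖ζ‖) := by
      rw [Measure.volume_eq_prod, Measure.prod_prod, Real.volume_Icc, mul_assoc,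
        ENNReal.ofReal_mul ENNReal.toReal_nonneg, ENNReal.ofReal_toReal hfin]
      congr 2; ring
    have hSm : MeasurableSet S := measurableSet_ball.prod measurableSet_Icc
    have hv : volume (Φ '' S) = volume S := by
      rw [Φ.image_eq_preimage_symm, ← (measurePreserving_graphHomeomorph he φ hφ).measure_preimage,
        ← preimage_comp]
      · congr 1; ext p; simp [Φ]
      · exact (Φ.symm.continuous.measurable hSm).nullMeasurableSet
    rw [← hS, ← hv]
    refine measure_mono fun x hx => ?_
    obtain ⟨hx1, hx2, q, hq, hqb⟩ := hx
    have hd1 : ‖x - q‖ ≤ ‖ζ‖ := by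
      rw [norm_sub_rev]; simpa using norm_sub_le_of_mem_segment hq
    have hxb : x ∈ Metric.ball x₀ (r - ‖ζ‖) := by
      rw [Metric.mem_ball] at *
      have := dist_triangle x q x₀
      rw [dist_eq_norm x q] at this
      linarith
    have hxb1 : x ∈ Metric.ball x₀ r := Metric.ball_subset_ball (by linarith [norm_nonneg ζ]) hxb
    have hxb2 : x + ζ ∈ Metric.ball x₀ r := by
      rw [Metric.mem_ball] at *
      have := dist_triangle (x + ζ) x x₀
      rw [dist_eq_norm (x + ζ) x, add_sub_cancel_left] at this
      linarith
    have m1 := (h.mem_iff x hxb1).1 hx1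
    have m2 := not_lt.1 (mt (h.mem_iff _ hxb2).2 hx2)
    have m3 := (abs_le.1 (hL _ hxb2 _ hxb1)).1
    rw [add_sub_cancel_left] at m3
    rw [inner_add_right] at m2
    have m4 := real_inner_le_norm e ζ
    rw [he, one_mul] at m4
    refine ⟨Φ.symm x, ⟨?_, ?_, ?_⟩, Φ.apply_symm_apply x⟩
    · change (ℝ ∙ e)ᗮ.orthogonalProjectionOnto x ∈ Metric.ball a r
      rw [Metric.mem_ball, dist_eq_norm, ← map_sub]
      exact (norm_proj_le _).trans_lt (by rwa [← dist_eq_norm])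
    · change _ ≤ inner ℝ e x - φ ((ℝ ∙ e)ᗮ.orthogonalProjectionOnto x)
      linarith
    · change inner ℝ e x - φ ((ℝ ∙ e)ᗮ.orthogonalProjectionOnto x) ≤ 0
      linarith

/-- The interaction of `Ω` with its complement through the kernel `min(|z|,1) |z|^{-(N+2σ)}` is
finite: this is the finiteness of a fractional perimeter of order less than one. -/
lemma IsBoundedC11Domain.integrableOn_kernelMajorant [NeZero N] (hΩ : IsBoundedC11Domain Ω) {σ : ℝ}
    (hσ0 : 0 < σ) (hσ1 : σ < 1) :
    IntegrableOn (fun p : RN N × RN N => kernelMajorant σ 1 (p.1 - p.2)) (Ωᶜ ×ˢ Ω) := by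
  have hm : MeasurableSet Ω := hΩ.isOpen.measurableSet
  have hfin : volume Ω < ⊤ := hΩ.isBounded.measure_lt_top
  obtain ⟨C, ρ, hC, hρ, h⟩ := hΩ.exists_volume_translate_le
  -- A bound for the translation defect which is also valid for large translations.
  obtain ⟨D, hD, hD2⟩ : ∃ D : ℝ, 0 ≤ D ∧ ∀ ζ : RN N,
      volume {x | x ∈ Ω ∧ x + ζ ∉ Ω} ≤ ENNReal.ofReal (D * min ‖ζ‖ 1) := by
    set V := (volume Ω).toReal
    have hV : 0 ≤ V := ENNReal.toReal_nonneg
    refine ⟨C + V / min ρ 1 + V, by positivity, fun ζ => ?_⟩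
    have hV1 : volume {x | x ∈ Ω ∧ x + ζ ∉ Ω} ≤ ENNReal.ofReal V := by
      rw [ENNReal.ofReal_toReal hfin.ne]; exact measure_mono fun x hx => hx.1
    have hq : 0 ≤ V / min ρ 1 := by positivity
    have hmin : 0 < min ρ 1 := by positivity
    rcases lt_or_ge ‖ζ‖ (min ρ 1) with hlt | hge
    · refine (h ζ (hlt.trans_le (min_le_left _ _))).trans (ENNReal.ofReal_le_ofReal ?_)
      rw [min_eq_left (hlt.le.trans (min_le_right _ _))]
      gcongr; linarith
    · refine hV1.trans (ENNReal.ofReal_le_ofReal ?_)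
      have h1 : min ρ 1 ≤ min ‖ζ‖ 1 := le_min hge (min_le_right _ _)
      calc V = V / min ρ 1 * min ρ 1 := by field_simp
        _ ≤ (C + V / min ρ 1 + V) * min ‖ζ‖ 1 := by gcongr; linarith
  have hmeas : Measurable fun p : RN N × RN N => kernelMajorant σ 1 (p.1 - p.2) := by fun_prop
  refine ⟨hmeas.aestronglyMeasurable, ?_⟩
  rw [hasFiniteIntegral_iff_ofReal (Eventually.of_forall fun p => kernelMajorant_nonneg _)]
  set k : RN N → ENNReal := fun z => ENNReal.ofReal (kernelMajorant σ 1 z)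
  have hk : Measurable k := by fun_prop
  have hΩc : MeasurableSet (Ωᶜ ×ˢ Ω) := hm.compl.prod hm
  -- Shear `(ζ, y) ↦ (y + ζ, y)`.
  have mp : MeasurePreserving (fun p : RN N × RN N => (p.2 + p.1, p.2)) := by
    have h1 : MeasurePreserving (fun p : RN N × RN N => (p.1, p.1 + p.2)) :=
      (MeasurePreserving.id _).skew_product (by fun_prop)
        (Eventually.of_forall fun x => (measurePreserving_add_left volume x).map_eq)
    exact (Measure.measurePreserving_swap.comp h1).comp Measure.measurePreserving_swap
  have e1 : ∫⁻ p in Ωᶜ ×ˢ Ω, k (p.1 - p.2) =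
      ∫⁻ ζ, k ζ * volume {y | y ∈ Ω ∧ y + ζ ∉ Ω} := by
    have hcomp : Measurable fun a : RN N × RN N =>
        (Ωᶜ ×ˢ Ω).indicator (fun p : RN N × RN N => k (p.1 - p.2)) (a.2 + a.1, a.2) :=
      ((by fun_prop : Measurable fun p : RN N × RN N => k (p.1 - p.2)).indicator hΩc).comp
        (by fun_prop)
    rw [← lintegral_indicator hΩc, ← mp.lintegral_comp ((by fun_prop : Measurable
      fun p : RN N × RN N => k (p.1 - p.2)).indicator hΩc), Measure.volume_eq_prod,
      lintegral_prod _ hcomp.aemeasurable]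
    refine lintegral_congr fun ζ => ?_
    have hs : MeasurableSet {y | y ∈ Ω ∧ y + ζ ∉ Ω} :=
      hm.inter ((measurable_add_const ζ) hm.compl)
    rw [← lintegral_indicator_const hs]
    refine lintegral_congr fun y => ?_
    by_cases hy : y ∈ Ω ∧ y + ζ ∉ Ω
    · rw [indicator_of_mem (s := {y | y ∈ Ω ∧ y + ζ ∉ Ω}) hy, indicator_of_mem (by exact ⟨hy.2, hy.1⟩)]
      simp
    · rw [indicator_of_notMem (s := {y | y ∈ Ω ∧ y + ζ ∉ Ω}) hy, indicator_of_notMem]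
      exact fun hh => hy ⟨hh.2, hh.1⟩
  rw [e1]
  -- The translation defect contributes the second factor `min(|ζ|, 1)`, so that `2σ < 2` suffices.
  have hi : Integrable (fun z : RN N => D * kernelMajorant σ 2 z) :=
    (integrable_kernelMajorant hσ0 (by linarith)).const_mul D
  refine lt_of_le_of_lt (lintegral_mono_ae (g := fun z => ENNReal.ofReal (D * kernelMajorant σ 2 z)) ?_)
    hi.lintegral_lt_top
  filter_upwards [Measure.ae_ne volume (0 : RN N)] with z hz
  refine (mul_le_mul_right (hD2 z) _).trans ?_
  rw [← ENNReal.ofReal_mul (kernelMajorant_nonneg _)]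
  refine ENNReal.ofReal_le_ofReal ?_
  have hz' : 0 < ‖z‖ := norm_pos_iff.2 hz
  rw [mul_left_comm]
  gcongr
  rw [kernelMajorant, kernelMajorant, le_min_iff]
  have hmn : 0 ≤ min ‖z‖ 1 := by positivity
  constructor
  · have : ‖z‖ ^ ((2 : ℝ) - (N + 2 * σ)) = ‖z‖ ^ ((1 : ℝ) - (N + 2 * σ)) * ‖z‖ := by
      rw [← Real.rpow_add_one hz'.ne']; ring_nf
    rw [this]
    exact mul_le_mul (min_le_left _ _) (min_le_left _ _) hmn (by positivity)
  · calc _ ≤ ‖z‖ ^ (-((N : ℝ) + 2 * σ)) * 1 :=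
        mul_le_mul (min_le_right _ _) (min_le_right _ _) hmn (by positivity)
      _ = _ := mul_one _

end Boundary

/-! ### Integrals over paraboloid strips and half spaces -/

section Strip
variable {N : ℕ} {σ : ℝ}

lemma exists_isometry_apply_eq {n m : RN N} (hn : ‖n‖ = 1) (hm : ‖m‖ = 1) :
    ∃ U : RN N ≃ₗᵢ[ℝ] RN N, U n = m :=
  ⟨_, Submodule.reflection_sub (hn.trans hm.symm)⟩

lemma integrable_kernelMajorant_smul [NeZero N] (hσ : 0 < σ) {β : ℝ} (hβ : 2 * σ < β) {κ : ℝ}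
    (hκ : 0 < κ) : Integrable (fun z : RN N => kernelMajorant σ β (κ • z)) :=
  (integrable_kernelMajorant hσ hβ).comp_smul hκ.ne'

lemma integrableOn_kernelMajorant_compl_ball [NeZero N] (hσ : 0 < σ) {β : ℝ} {r κ : ℝ} (hr : 0 < r)
    (hκ : 0 < κ) :
    IntegrableOn (fun z : RN N => kernelMajorant σ β (κ • z)) (Metric.ball 0 r)ᶜ := by
  have h := integrableOn_compl_ball_norm_rpow (N := N) (α := -(N + 2 * σ)) (by linarith) hr
  refine (h.const_mul (κ ^ (-((N : ℝ) + 2 * σ)))).mono'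
    (measurable_kernelMajorant.comp (measurable_const_smul κ)).aestronglyMeasurable
    (Eventually.of_forall fun z => ?_)
  rw [Real.norm_of_nonneg (kernelMajorant_nonneg _)]
  refine (min_le_right _ _).trans_eq ?_
  rw [norm_smul, Real.norm_of_nonneg hκ.le, Real.mul_rpow hκ.le (norm_nonneg _)]

/-- The thin region between two tangent paraboloids at the origin. -/
def paraboloidStrip (K : ℝ) (n : RN N) : Set (RN N) := {z | |inner ℝ z n| ≤ K * ‖z‖ ^ 2}

lemma measurableSet_paraboloidStrip (K : ℝ) (n : RN N) : MeasurableSet (paraboloidStrip K n) :=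
  (isClosed_le (by fun_prop) (by fun_prop)).measurableSet

/-- The quadratic thinness of the strip makes the kernel `|z|^{1-N-2σ}` integrable on it for every
`σ < 1`. -/
lemma integrableOn_paraboloidStrip [NeZero N] (hσ : 0 < σ) (hσ1 : σ < 1) {K κ : ℝ} (hK : 0 < K)
    (hκ : 0 < κ) {e : RN N} (he : ‖e‖ = 1) :
    IntegrableOn (fun z : RN N => kernelMajorant σ 1 (κ • z)) (paraboloidStrip K e) := by
  set ρ := 1 / (2 * K) with hρ
  have hρ0 : 0 < ρ := by positivity
  have hmeas : Measurable (fun z : RN N => kernelMajorant σ 1 (κ • z)) :=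
    measurable_kernelMajorant.comp (measurable_const_smul κ)
  rw [← inter_union_compl (paraboloidStrip K e) (Metric.ball 0 ρ)]
  refine IntegrableOn.union ?_
    ((integrableOn_kernelMajorant_compl_ball hσ hρ0 hκ).mono_set inter_subset_right)
  set α : ℝ := 1 - (N + 2 * σ) with hα
  have hNp : (1 : ℝ) ≤ N := by exact_mod_cast NeZero.one_le
  have hα0 : α < 0 := by rw [hα]; linarith
  set H := (ℝ ∙ e)ᗮ
  -- The majorant in the coordinates `z = x' + t e`.
  set m : H × ℝ → ℝ := {p : H × ℝ | ‖p.1‖ < ρ ∧ |p.2| ≤ 2 * K * ‖p.1‖ ^ 2}.indicator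
    fun p => κ ^ α * ‖p.1‖ ^ α with hm
  have hset : MeasurableSet {p : H × ℝ | ‖p.1‖ < ρ ∧ |p.2| ≤ 2 * K * ‖p.1‖ ^ 2} :=
    show MeasurableSet ({p : H × ℝ | ‖p.1‖ < ρ} ∩ {p | |p.2| ≤ 2 * K * ‖p.1‖ ^ 2}) from
    (isOpen_lt (by fun_prop) (by fun_prop)).measurableSet.inter
      (isClosed_le (by fun_prop) (by fun_prop)).measurableSet
  have hmm : Measurable m := Measurable.indicator (by fun_prop) hset
  have hdim : Module.finrank ℝ H = N - 1 := by
    have h1 := (ℝ ∙ e).finrank_add_finrank_orthogonal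
    rw [finrank_span_singleton (by rintro rfl; simp at he), finrank_euclideanSpace,
      Fintype.card_fin] at h1
    change 1 + Module.finrank ℝ H = N at h1
    omega
  have him : Integrable m := by
    have hsec : ∀ x' : H, (fun t => m (x', t)) =
        (Icc (-(2 * K * ‖x'‖ ^ 2)) (2 * K * ‖x'‖ ^ 2)).indicator
          (fun _ => (Metric.ball (0 : H) ρ).indicator (fun x' => κ ^ α * ‖x'‖ ^ α) x') := by
      intro x'
      ext1 t
      simp only [hm, indicator, mem_ofPred_eq, mem_Icc, Metric.mem_ball, dist_zero_right, ← abs_le]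
      split_ifs <;> first | rfl | tauto
    rw [Measure.volume_eq_prod, integrable_prod_iff hmm.aestronglyMeasurable]
    refine ⟨Eventually.of_forall fun x' => ?_, ?_⟩
    · rw [hsec]
      exact (integrable_indicator_iff measurableSet_Icc).2 (integrableOn_const (by simp))
    · have h3 : IntegrableOn (fun x' : H => ‖x'‖ ^ (α + 2)) (Metric.ball 0 ρ) := by
        refine integrableOn_ball_norm_rpow ?_ ρ
        rw [hdim, Nat.cast_sub NeZero.one_le, hα]
        push_cast; linarith
      have h4 := (integrable_indicator_iff measurableSet_ball).2 (h3.const_mul (4 * K * κ ^ α))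
      refine h4.mono' hmm.stronglyMeasurable.norm.integral_prod_right'.aestronglyMeasurable
        (Eventually.of_forall fun x' => ?_)
      rw [Real.norm_of_nonneg (integral_nonneg fun t => norm_nonneg _)]
      have hns : ∀ t, ‖m (x', t)‖ = m (x', t) := fun t =>
        Real.norm_of_nonneg (indicator_nonneg (fun _ _ => by positivity) _)
      -- The section over `x'` has length `4 K |x'|²`, which raises the exponent by two.
      simp_rw [hns, hsec]
      rw [integral_indicator measurableSet_Icc, setIntegral_const, smul_eq_mul,
        Measure.real, Real.volume_Icc, sub_neg_eq_add, ENNReal.toReal_ofReal (by positivity)]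
      by_cases hx : x' ∈ Metric.ball (0 : H) ρ
      · rw [indicator_of_mem hx, indicator_of_mem hx]
        rcases eq_or_ne x' 0 with rfl | hx0
        · rw [norm_zero]; simp; positivity
        · refine le_of_eq ?_
          rw [Real.rpow_add (norm_pos_iff.2 hx0), Real.rpow_two]; ring
      · rw [indicator_of_notMem hx, indicator_of_notMem hx, mul_zero]
  have mp := measurePreserving_add_smul he
  have hemb : MeasurableEmbedding (fun p : H × ℝ => (p.1 : RN N) + p.2 • e) := by
    have := (graphHomeomorph he (fun _ => 0) continuous_const).measurableEmbedding
    simpa [graphHomeomorph] using this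
  rw [← mp.integrableOn_comp_preimage hemb]
  refine (him.integrableOn).mono' (hmeas.comp mp.measurable).aestronglyMeasurable ?_
  have hpm : MeasurableSet ((fun p : H × ℝ => (p.1 : RN N) + p.2 • e) ⁻¹'
      (paraboloidStrip K e ∩ Metric.ball 0 ρ)) :=
    mp.measurable ((measurableSet_paraboloidStrip K e).inter measurableSet_ball)
  have hae : ∀ᵐ p : H × ℝ, p.2 ≠ 0 := by
    rw [Measure.volume_eq_prod]
    exact Measure.quasiMeasurePreserving_snd.ae (Measure.ae_ne volume (0 : ℝ))
  filter_upwards [ae_restrict_mem hpm, ae_restrict_of_ae hae] with p hp hp0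
  obtain ⟨hp1, hp2⟩ := hp
  have hno : ‖(p.1 : RN N) + p.2 • e‖ ^ 2 = ‖p.1‖ ^ 2 + p.2 ^ 2 := by
    rw [norm_add_sq_real, inner_smul_right, real_inner_comm, inner_hyperplane, norm_smul, he]
    simp
  have hin : (inner ℝ ((p.1 : RN N) + p.2 • e) e : ℝ) = p.2 := by
    rw [real_inner_comm, inner_add_smul he]
  simp only [paraboloidStrip, mem_ofPred_eq, hin, hno] at hp1
  rw [mem_ball_zero_iff] at hp2
  have hp2' : ‖(p.1 : RN N) + p.2 • e‖ ^ 2 < ρ ^ 2 := by gcongr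
  rw [hno] at hp2'
  have ht : |p.2| < ρ := abs_lt_of_sq_lt_sq (by nlinarith [sq_nonneg ‖p.1‖]) hρ0.le
  have hx' : ‖p.1‖ < ρ := lt_of_pow_lt_pow_left₀ 2 hρ0.le (by nlinarith [sq_nonneg p.2])
  -- For `|t| < 1 / (2K)` the term `K t²` can be absorbed, so that `|t| ≤ 2 K |x'|²` in the strip.
  have h5 : K * p.2 ^ 2 ≤ |p.2| / 2 := by
    rw [← sq_abs, sq, ← mul_assoc]
    have : K * |p.2| ≤ 1 / 2 := by
      calc K * |p.2| ≤ K * ρ := by gcongr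
        _ = 1 / 2 := by rw [hρ]; field_simp
    nlinarith [abs_nonneg p.2]
  have h6 : |p.2| ≤ 2 * K * ‖p.1‖ ^ 2 := by linarith
  have h7 : 0 < ‖p.1‖ := by
    rcases (norm_nonneg p.1).eq_or_lt with h | h
    · rw [← h] at h6
      exact absurd (abs_pos.2 hp0) (by simp at h6; simp [h6])
    · exact h
  rw [hm, indicator_of_mem (show p ∈ {p : H × ℝ | ‖p.1‖ < ρ ∧ |p.2| ≤ 2 * K * ‖p.1‖ ^ 2} from
    ⟨hx', h6⟩), Function.comp, Real.norm_of_nonneg (kernelMajorant_nonneg _)]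
  refine (min_le_left _ _).trans ?_
  rw [norm_smul, Real.norm_of_nonneg hκ.le, Real.mul_rpow hκ.le (norm_nonneg _)]
  refine mul_le_mul_of_nonneg_left ?_ (by positivity)
  refine Real.rpow_le_rpow_of_nonpos h7 ?_ hα0.le
  exact le_of_sq_le_sq (by rw [hno]; exact le_add_of_nonneg_right (sq_nonneg _)) (norm_nonneg _)

end Strip

section HalfSpaceIntegral
variable {N : ℕ} {σ : ℝ}

/-- The cut-off `(1 - |z|)₊`. -/
def tent (z : RN N) : ℝ := max 0 (1 - ‖z‖)

lemma tent_nonneg (z : RN N) : 0 ≤ tent z := le_max_left _ _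

lemma tent_le_one (z : RN N) : tent z ≤ 1 := max_le zero_le_one (by linarith [norm_nonneg z])

lemma one_sub_tent_le (z : RN N) : 1 - tent z ≤ ‖z‖ := by
  have : 1 - ‖z‖ ≤ tent z := le_max_right _ _
  linarith

lemma norm_mul_tent_le (z : RN N) : ‖z‖ * tent z ≤ 1 := by
  unfold tent
  rcases le_total 0 (1 - ‖z‖) with h | h
  · rw [max_eq_right h]; nlinarith [norm_nonneg z]
  · rw [max_eq_left h]; simp

@[fun_prop]
lemma continuous_tent : Continuous (tent : RN N → ℝ) := by unfold tent; fun_prop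

/-- The model singular integral `∫ z·n (1 - |z|)₊ K(z) dz` over the half space `{z·n > d}`, that is,
at distance `d` from the singularity. -/
def halfSpaceIntegral (σ : ℝ) (n : RN N) (d : ℝ) : ℝ :=
  ∫ z in {z : RN N | d < inner ℝ z n}, inner ℝ z n * (tent z * fracKernel σ z)

lemma measurableSet_halfSpace (n : RN N) (d : ℝ) : MeasurableSet {z : RN N | d < inner ℝ z n} :=
  (isOpen_lt (by fun_prop) (by fun_prop)).measurableSet

lemma integrableOn_linear_halfSpace [NeZero N] (hσ : 0 < σ) {n : RN N} (hn : ‖n‖ = 1)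
    (ℓ : RN N →L[ℝ] ℝ) {d : ℝ} (hd : 0 < d) :
    IntegrableOn (fun z => ℓ z * (tent z * fracKernel σ z)) {z : RN N | d < inner ℝ z n} := by
  have hsub : {z : RN N | d < inner ℝ z n} ⊆ (Metric.ball 0 d)ᶜ := by
    intro z hz
    have h1 := real_inner_le_norm z n
    rw [hn, mul_one] at h1
    simpa using (le_of_lt hz).trans h1
  refine (((integrableOn_fracKernel_compl_ball hσ hd).mono_set hsub).const_mul ‖ℓ‖).mono'
    (Measurable.aestronglyMeasurable (by fun_prop)) (Eventually.of_forall fun z => ?_)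
  have hk := fracKernel_nonneg (σ := σ) z
  rw [norm_mul, norm_mul, Real.norm_of_nonneg (tent_nonneg z), Real.norm_of_nonneg hk, ← mul_assoc]
  gcongr
  calc ‖ℓ z‖ * tent z ≤ ‖ℓ‖ * ‖z‖ * tent z := by gcongr; exact tent_nonneg z; exact ℓ.le_opNorm z
    _ = ‖ℓ‖ * (‖z‖ * tent z) := by ring
    _ ≤ ‖ℓ‖ * 1 := by gcongr; exact norm_mul_tent_le z
    _ = _ := mul_one _

lemma inner_clm_apply (n z : RN N) : innerSL ℝ n z = inner ℝ z n := by
  rw [innerSL_apply_apply, real_inner_comm]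

/-- By reflection across the line spanned by `n`, only the normal component of a linear form
survives the integration over a half space. -/
lemma setIntegral_linear_halfSpace [NeZero N] (hσ : 0 < σ) {n : RN N} (hn : ‖n‖ = 1)
    (ℓ : RN N →L[ℝ] ℝ) {d : ℝ} (hd : 0 < d) :
    ∫ z in {z : RN N | d < inner ℝ z n}, ℓ z * (tent z * fracKernel σ z) =
      ℓ n * halfSpaceIntegral σ n d := by
  set U := (ℝ ∙ n).reflection
  have hU : ∀ z, U z = (2 * inner ℝ z n : ℝ) • n - z := by
    intro z
    rw [Submodule.reflection_apply, Submodule.starProjection_unit_singleton ℝ hn, real_inner_comm]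
    module
  have hUn : ∀ z, (inner ℝ (U z) n : ℝ) = inner ℝ z n := by
    intro z
    rw [hU, inner_sub_left, inner_smul_left, real_inner_self_eq_norm_sq, hn]
    simp; ring
  have h1 := U.measurePreserving.setIntegral_preimage_emb U.toHomeomorph.measurableEmbedding
    (fun z => ℓ z * (tent z * fracKernel σ z)) {z : RN N | d < inner ℝ z n}
  have hpre : U ⁻¹' {z : RN N | d < inner ℝ z n} = {z : RN N | d < inner ℝ z n} := by
    ext z; simp [hUn]
  have hK : ∀ z, tent (U z) * fracKernel σ (U z) = tent z * fracKernel σ z := by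
    intro z; simp [tent, fracKernel]
  rw [hpre] at h1
  simp_rw [hK] at h1
  have i1 := integrableOn_linear_halfSpace hσ hn ℓ hd
  have i2 : IntegrableOn (fun z => ℓ (U z) * (tent z * fracKernel σ z))
      {z : RN N | d < inner ℝ z n} :=
    integrableOn_linear_halfSpace hσ hn (ℓ ∘L (U.toContinuousLinearEquiv : RN N →L[ℝ] RN N)) hd
  have h2 : 2 * ∫ z in {z : RN N | d < inner ℝ z n}, ℓ z * (tent z * fracKernel σ z) =
      2 * (ℓ n * halfSpaceIntegral σ n d) := by
    rw [two_mul]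
    nth_rw 1 [← h1]
    rw [← integral_add i2 i1, halfSpaceIntegral, ← integral_const_mul, ← integral_const_mul]
    congr with z
    rw [hU, map_sub, map_smul, smul_eq_mul]
    ring
  linarith

lemma halfSpaceIntegral_congr {n m : RN N} (hn : ‖n‖ = 1) (hm : ‖m‖ = 1) (d : ℝ) :
    halfSpaceIntegral σ n d = halfSpaceIntegral σ m d := by
  obtain ⟨U, hU⟩ := exists_isometry_apply_eq hn hm
  have hUn : ∀ z, (inner ℝ (U z) m : ℝ) = inner ℝ z n := by
    intro z
    rw [← hU, U.inner_map_map]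
  have h1 := U.measurePreserving.setIntegral_preimage_emb U.toHomeomorph.measurableEmbedding
    (fun z => inner ℝ z m * (tent z * fracKernel σ z)) {z : RN N | d < inner ℝ z m}
  rw [halfSpaceIntegral, halfSpaceIntegral, ← h1]
  have hK : ∀ z, tent (U z) * fracKernel σ (U z) = tent z * fracKernel σ z := by
    intro z; simp [tent, fracKernel]
  simp_rw [hK, hUn]
  congr! 2
  ext z; simp [hUn]

lemma halfSpaceIntegral_anti [NeZero N] (hσ : 0 < σ) {n : RN N} (hn : ‖n‖ = 1) {d d' : ℝ}
    (hd : 0 < d) (h : d ≤ d') : halfSpaceIntegral σ n d' ≤ halfSpaceIntegral σ n d := by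
  refine setIntegral_mono_set ?_ ?_ (Eventually.of_forall fun z hz => lt_of_le_of_lt h hz)
  · have := integrableOn_linear_halfSpace (σ := σ) hσ hn (innerSL ℝ n) hd
    simpa only [inner_clm_apply] using this
  · filter_upwards [ae_restrict_mem (measurableSet_halfSpace n d)] with z hz
    exact mul_nonneg (hd.trans hz).le (mul_nonneg (tent_nonneg z) (fracKernel_nonneg z))

/-- For `σ ≥ 1/2` the function `z·n |z|^{-(N+2σ)}` is not integrable near the origin in the half
space `z·n > 0`: dilation by `1/2` does not decrease its integral. -/
lemma not_integrableOn_linear_kernel [NeZero N] (hσ : 1 / 2 ≤ σ) {n : RN N} (hn : ‖n‖ = 1) :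
    ¬ IntegrableOn (fun z : RN N => inner ℝ z n * fracKernel σ z)
      ({z | 0 < inner ℝ z n} ∩ Metric.ball 0 (1 / 2)) := by
  intro hi
  set f : RN N → ℝ := fun z => inner ℝ z n * fracKernel σ z
  set S : Set (RN N) := {z | 0 < inner ℝ z n} ∩ Metric.ball 0 (1 / 2)
  set S' : Set (RN N) := {z | 0 < inner ℝ z n} ∩ Metric.ball 0 (1 / 4)
  have hS'm : MeasurableSet S' := (measurableSet_halfSpace n 0).inter measurableSet_ball
  have hSm : MeasurableSet S := (measurableSet_halfSpace n 0).inter measurableSet_ball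
  have hsub : S' ⊆ S := inter_subset_inter_right _ (Metric.ball_subset_ball (by norm_num))
  have hf0 : ∀ z ∈ S, 0 ≤ f z := fun z hz => mul_nonneg (le_of_lt hz.1) (fracKernel_nonneg z)
  have hscale : ∫ z in S', f z = 2 ^ (2 * σ - 1) * ∫ z in S, f z := by
    have h1 := Measure.setIntegral_comp_smul (volume : Measure (RN N)) f S (R := 1 / 2) (by norm_num)
    have hSS : (1 / 2 : ℝ) • S = S' := by
      ext z
      rw [mem_smul_set_iff_inv_smul_mem₀ (by norm_num)]
      simp only [S, S', mem_inter_iff, mem_ofPred_eq, inner_smul_left, mem_ball_zero_iff, norm_smul]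
      norm_num
      intro _
      constructor <;> intro h <;> linarith
    have hfs : ∀ z, f ((1 / 2 : ℝ) • z) = 2 ^ ((N : ℝ) + 2 * σ - 1) * f z := by
      intro z
      simp only [f, fracKernel, inner_smul_left, norm_smul]
      rw [Real.mul_rpow (by norm_num) (norm_nonneg _), Real.rpow_sub_one (by norm_num)]
      norm_num
      rw [Real.div_rpow (by norm_num) (by norm_num), Real.one_rpow]
      field_simp
    simp_rw [hfs] at h1
    rw [hSS, integral_const_mul, finrank_euclideanSpace, Fintype.card_fin, smul_eq_mul] at h1
    have h2 : |((1 / 2 : ℝ) ^ N)⁻¹| = 2 ^ (N : ℝ) := by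
      rw [abs_of_nonneg (by positivity), Real.rpow_natCast]; simp
    rw [h2, add_sub_assoc, Real.rpow_add (by norm_num), mul_assoc] at h1
    exact (mul_left_cancel₀ (by positivity) h1).symm
  have hpos : 0 < ∫ z in S \ S', f z := by
    rw [setIntegral_pos_iff_support_of_nonneg_ae]
    · have ho : IsOpen ({z : RN N | 0 < inner ℝ z n} ∩ (Metric.ball 0 (1 / 2) \
          Metric.closedBall 0 (1 / 4))) :=
        (isOpen_lt (by fun_prop) (by fun_prop)).inter
          (Metric.isOpen_ball.sdiff Metric.isClosed_closedBall)
      refine lt_of_lt_of_le (ho.measure_pos volume ⟨(3 / 8 : ℝ) • n, ?_, ?_, ?_⟩)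
        (measure_mono ?_)
      · simp [inner_smul_left, hn]
      · simp [norm_smul, hn]; norm_num
      · simp [norm_smul, hn]; norm_num
      · rintro z ⟨hz1, hz2, hz3⟩
        refine ⟨mul_ne_zero (ne_of_gt hz1) ?_, ⟨hz1, hz2⟩, fun h => hz3 (Metric.ball_subset_closedBall h.2)⟩
        have : z ≠ 0 := by rintro rfl; simp at hz1
        have : 0 < ‖z‖ := norm_pos_iff.2 this
        unfold fracKernel; positivity
    · filter_upwards [ae_restrict_mem (hSm.diff hS'm)] with z hz using hf0 z hz.1
    · exact hi.mono_set sdiff_subset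
  have hadd := setIntegral_sdiff hS'm hi hsub
  have hS0 : 0 ≤ ∫ z in S, f z := setIntegral_nonneg hSm hf0
  have h2 : (1 : ℝ) ≤ 2 ^ (2 * σ - 1) := Real.one_le_rpow (by norm_num) (by linarith)
  nlinarith

/-- For `σ ≥ 1/2` the half space integral blows up as the half space approaches the singularity. -/
lemma exists_halfSpaceIntegral_ge [NeZero N] (hσ : 1 / 2 ≤ σ) (A : ℝ) :
    ∃ d₀ > 0, ∀ n : RN N, ‖n‖ = 1 → ∀ d, 0 < d → d < d₀ → A ≤ halfSpaceIntegral σ n d := by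
  have hσ0 : 0 < σ := by linarith
  obtain ⟨m, hm⟩ : ∃ m : RN N, ‖m‖ = 1 := ⟨EuclideanSpace.single 0 1, by simp⟩
  suffices ∃ d₀ > 0, A ≤ halfSpaceIntegral σ m d₀ by
    obtain ⟨d₀, h0, h⟩ := this
    refine ⟨d₀, h0, fun n hn d hd hlt => ?_⟩
    rw [halfSpaceIntegral_congr hn hm]
    exact h.trans (halfSpaceIntegral_anti hσ0 hm hd hlt.le)
  by_contra! hA
  set f : RN N → ℝ := fun z => inner ℝ z m * (tent z * fracKernel σ z)
  have hcov : AECover (volume.restrict {z : RN N | 0 < inner ℝ z m}) atTop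
      (fun k : ℕ => {z : RN N | 1 / ((k : ℝ) + 1) < inner ℝ z m}) := by
    refine ⟨?_, fun k => measurableSet_halfSpace m _⟩
    filter_upwards [ae_restrict_mem (measurableSet_halfSpace m 0)] with z hz
    have h0 : (0 : ℝ) < inner ℝ z m := hz
    have h1 : Tendsto (fun k : ℕ => 1 / ((k : ℝ) + 1)) atTop (𝓝 0) :=
      tendsto_one_div_add_atTop_nhds_zero_nat
    exact h1.eventually_lt_const h0
  have hsub : ∀ k : ℕ, {z : RN N | 1 / ((k : ℝ) + 1) < inner ℝ z m} ⊆ {z | 0 < inner ℝ z m} :=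
    fun k z hz => lt_trans (show (0:ℝ) < 1/((k:ℝ)+1) by positivity) hz
  have hint : IntegrableOn f {z : RN N | 0 < inner ℝ z m} := by
    refine hcov.integrable_of_integral_bounded_of_nonneg_ae A (fun k => ?_) ?_
      (Eventually.of_forall fun k => ?_)
    · rw [IntegrableOn, Measure.restrict_restrict (measurableSet_halfSpace m _),
        inter_eq_left.2 (hsub k)]
      have := integrableOn_linear_halfSpace (σ := σ) hσ0 hm (innerSL ℝ m)
        (show 0 < 1 / ((k : ℝ) + 1) by positivity)
      simp only [inner_clm_apply] at this
      exact this
    · filter_upwards [ae_restrict_mem (measurableSet_halfSpace m 0)] with z hz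
      exact mul_nonneg (le_of_lt hz) (mul_nonneg (tent_nonneg z) (fracKernel_nonneg z))
    · rw [Measure.restrict_restrict (measurableSet_halfSpace m _), inter_eq_left.2 (hsub k)]
      exact (hA _ (by positivity)).le
  refine not_integrableOn_linear_kernel hσ hm
    (((hint.mono_set inter_subset_left).const_mul 2).mono'
      (Measurable.aestronglyMeasurable (by fun_prop)) ?_)
  filter_upwards [ae_restrict_mem ((measurableSet_halfSpace m 0).inter measurableSet_ball)] with z hz
  have hz1 : 0 < inner ℝ z m := hz.1
  have hz2 : ‖z‖ < 1 / 2 := by simpa using hz.2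
  have ht : 1 / 2 ≤ tent z := by have := one_sub_tent_le z; linarith
  have hk := fracKernel_nonneg (σ := σ) z
  rw [Real.norm_of_nonneg (mul_nonneg hz1.le hk)]
  have : 0 ≤ inner ℝ z m * fracKernel σ z := mul_nonneg hz1.le hk
  calc _ = 2 * (inner ℝ z m * fracKernel σ z) * (1 / 2) := by ring
    _ ≤ 2 * (inner ℝ z m * fracKernel σ z) * tent z := by gcongr
    _ = 2 * f z := by simp only [f]; ring

end HalfSpaceIntegral

/-! ### The regularized regional integral -/

/-- `g` is continuous, bounded, Lipschitz, and has the second order expansion with differential `ℓ`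
around `p`, all with the constant `M`. -/
structure HasExpansionAt {N : ℕ} (g : RN N → ℝ) (ℓ : RN N →L[ℝ] ℝ) (p : RN N) (M : ℝ) : Prop where
  continuous : Continuous g
  pos : 0 < M
  bound : ∀ x, |g x| ≤ M
  lip : ∀ x y, |g x - g y| ≤ M * ‖x - y‖
  taylor : ∀ x y, |g x - g y - ℓ (x - y)| ≤ M * ‖x - y‖ * (‖x - p‖ + ‖y - p‖)
  clm : ∀ z, |ℓ z| ≤ M * ‖z‖

/-- The integrand of `∫_E (g(x) - g(y)) K(x - y) dy`, from which `μ` times the linear model over the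
half space `{(y - p)·n < 0}` is subtracted. The linear model is cut off by `tent` at unit distance
from `x`, so that it is integrable at infinity. -/
def traceIntegrand {N : ℕ} (σ μ : ℝ) (E : Set (RN N)) (n p : RN N) (g : RN N → ℝ)
    (ℓ : RN N →L[ℝ] ℝ) (x y : RN N) : ℝ :=
  E.indicator (fun y => fracKernel σ (x - y) * (g x - g y)) y - μ *
    {y : RN N | inner ℝ (y - p) n < 0}.indicator
      (fun y => ℓ (x - y) * (tent (x - y) * fracKernel σ (x - y))) y

/-- A majorant of `traceIntegrand` in the variable `z = y - p`, which does not depend on `x`. Its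
four terms account for the overlap of `E` with the half space, for the strip in which they differ,
for the points far from `p`, and for a model that is not subtracted. -/
def traceMajorant {N : ℕ} (σ μ K κ r : ℝ) (n z : RN N) : ℝ :=
  kernelMajorant σ (1 + σ) (κ • z) +
    (paraboloidStrip K n).indicator (fun z => kernelMajorant σ 1 (κ • z)) z +
    (Metric.ball 0 r)ᶜ.indicator (fun z => kernelMajorant σ 1 (κ • z)) z +
    (1 - μ) * kernelMajorant σ 1 (κ • z)

/-- The admissible weights of the linear model: it may be subtracted (`μ = 1`), and for `σ < 1/2`,
when the integrals converge without regularization, it need not be (`μ = 0`). -/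
def ModelWeight (σ μ : ℝ) : Prop := μ = 1 ∨ (μ = 0 ∧ σ < 1 / 2)

section Trace
variable {N : ℕ} {σ μ K κ r M : ℝ} {n p : RN N} {E : Set (RN N)} {g : RN N → ℝ}
  {ℓ : RN N →L[ℝ] ℝ}

lemma ModelWeight.nonneg (hμ : ModelWeight σ μ) : 0 ≤ μ := by
  rcases hμ with rfl | ⟨rfl, -⟩ <;> norm_num

lemma ModelWeight.le_one (hμ : ModelWeight σ μ) : μ ≤ 1 := by
  rcases hμ with rfl | ⟨rfl, -⟩ <;> norm_num

lemma integrable_traceMajorant [NeZero N] (hσ0 : 0 < σ) (hσ1 : σ < 1) (hμ : ModelWeight σ μ)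
    (hK : 0 < K) (hκ : 0 < κ) (hr : 0 < r) (hn : ‖n‖ = 1) :
    Integrable (traceMajorant σ μ K κ r n) := by
  refine ((Integrable.add (integrable_kernelMajorant_smul hσ0 (by linarith) hκ) ?_).add ?_).add ?_
  · exact (integrable_indicator_iff (measurableSet_paraboloidStrip K n)).2
      (integrableOn_paraboloidStrip hσ0 hσ1 hK hκ hn)
  · exact (integrable_indicator_iff measurableSet_ball.compl).2
      (integrableOn_kernelMajorant_compl_ball hσ0 hr hκ)
  · rcases hμ with rfl | ⟨rfl, h⟩
    · simp
    · exact (integrable_kernelMajorant_smul hσ0 (by linarith) hκ).const_mul _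

lemma integral_traceMajorant_congr {m : RN N} (hn : ‖n‖ = 1) (hm : ‖m‖ = 1) :
    ∫ z, traceMajorant σ μ K κ r n z = ∫ z, traceMajorant σ μ K κ r m z := by
  obtain ⟨U, hU⟩ := exists_isometry_apply_eq hn hm
  symm
  rw [← U.measurePreserving.integral_comp U.toHomeomorph.measurableEmbedding]
  congr with z
  have hR : ∀ β, kernelMajorant σ β (κ • U z) = kernelMajorant σ β (κ • z) := by
    intro β; simp [kernelMajorant, norm_smul]
  have hs : U z ∈ paraboloidStrip K m ↔ z ∈ paraboloidStrip K n := by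
    simp only [paraboloidStrip, mem_ofPred_eq, U.norm_map, ← hU, U.inner_map_map]
  by_cases hz : z ∈ paraboloidStrip K n
  · simp [traceMajorant, hR, indicator, hz, hs.2 hz]
  · simp [traceMajorant, hR, indicator, hz, mt hs.1 hz]

/-- The regularized integrand is dominated as long as `x` stays at a distance to `E` and to the half
space that is proportional to the distance to `p`. Where `E` and the half space overlap, Taylor
expansion gains a power of `|z|`; where they differ, `y` lies in the thin strip between the tangent
paraboloids or is far from `p`. -/
lemma abs_traceIntegrand_le [NeZero N] (hσ0 : 0 < σ) (hσ1 : σ < 1) (hμ : ModelWeight σ μ)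
    (hκ : 0 < κ) (hE : TangentAt E K r p n) (hg : HasExpansionAt g ℓ p M) {x y : RN N}
    (hx : ∀ y, y ∈ E ∨ inner ℝ (y - p) n < 0 → κ * ‖y - p‖ ≤ ‖x - y‖) (hy : y ≠ p) :
    |traceIntegrand σ μ E n p g ℓ x y| ≤ M * (2 + 2 / κ) * traceMajorant σ μ K κ r n (y - p) := by
  have hM := hg.pos
  have hN : (1 : ℝ) ≤ N := by exact_mod_cast NeZero.one_le
  have hC2 : 2 * M ≤ M * (2 + 2 / κ) := by
    have : 0 ≤ 2 / κ := by positivity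
    nlinarith
  have hyp : 0 < ‖y - p‖ := norm_pos_iff.2 (sub_ne_zero.2 hy)
  have hyk : κ • (y - p) ≠ 0 := smul_ne_zero hκ.ne' (sub_ne_zero.2 hy)
  set z := x - y with hz
  have hk := fracKernel_nonneg (σ := σ) z
  set R1 := kernelMajorant σ 1 (κ • (y - p)) with hR1
  set R2 := kernelMajorant σ (1 + σ) (κ • (y - p)) with hR2
  have hR1n : 0 ≤ R1 := kernelMajorant_nonneg _
  have hR2n : 0 ≤ R2 := kernelMajorant_nonneg _
  have hμ0 := hμ.nonneg
  have hμ1 := hμ.le_one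
  have e1 : 0 ≤ (paraboloidStrip K n).indicator (fun z => kernelMajorant σ 1 (κ • z)) (y - p) :=
    indicator_nonneg (fun _ _ => kernelMajorant_nonneg _) _
  have e2 : 0 ≤ (Metric.ball 0 r)ᶜ.indicator (fun z => kernelMajorant σ 1 (κ • z)) (y - p) :=
    indicator_nonneg (fun _ _ => kernelMajorant_nonneg _) _
  have e3 : 0 ≤ (1 - μ) * kernelMajorant σ 1 (κ • (y - p)) :=
    mul_nonneg (by linarith) (kernelMajorant_nonneg _)
  -- First order bounds.
  have key1 : y ∈ E ∨ inner ℝ (y - p) n < 0 → z ≠ 0 ∧ ‖κ • (y - p)‖ ≤ ‖z‖ := by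
    intro h
    have := hx y h
    rw [norm_smul, Real.norm_of_nonneg hκ.le]
    refine ⟨norm_pos_iff.1 (lt_of_lt_of_le (by positivity) this), this⟩
  have keyE : y ∈ E ∨ inner ℝ (y - p) n < 0 → fracKernel σ z * |g x - g y| ≤ 2 * M * R1 := by
    intro h
    obtain ⟨h0, h1⟩ := key1 h
    have a1 : |g x - g y| ≤ 2 * M := by
      have := abs_sub (g x) (g y); linarith [hg.bound x, hg.bound y]
    have a2 : |g x - g y| ≤ 2 * M * ‖z‖ := by nlinarith [hg.lip x y, norm_nonneg z]
    have := mul_fracKernel_le_kernelMajorant (σ := σ) (β := 1) h0 (a := |g x - g y| / (2 * M))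
      (by rw [div_le_one (by positivity)]; exact a1)
      (by rw [div_le_iff₀ (by positivity), Real.rpow_one]; linarith)
    calc _ = 2 * M * (|g x - g y| / (2 * M) * fracKernel σ z) := by field_simp
      _ ≤ 2 * M * R1 := by
        gcongr
        exact this.trans (kernelMajorant_anti hσ0 (by linarith) hyk h1)
  have keyH : y ∈ E ∨ inner ℝ (y - p) n < 0 →
      |ℓ z * (tent z * fracKernel σ z)| ≤ 2 * M * R1 := by
    intro h
    obtain ⟨h0, h1⟩ := key1 h
    have a1 : |ℓ z| * tent z ≤ M := by
      calc _ ≤ M * ‖z‖ * tent z := by gcongr; exact tent_nonneg z; exact hg.clm z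
        _ = M * (‖z‖ * tent z) := by ring
        _ ≤ M * 1 := by gcongr; exact norm_mul_tent_le z
        _ = M := mul_one M
    have a2 : |ℓ z| * tent z ≤ M * ‖z‖ := by
      calc _ ≤ |ℓ z| * 1 := by gcongr; exact tent_le_one z
        _ ≤ _ := by rw [mul_one]; exact hg.clm z
    have := mul_fracKernel_le_kernelMajorant (σ := σ) (β := 1) h0 (a := |ℓ z| * tent z / M)
      (by rw [div_le_one (by positivity)]; exact a1)
      (by rw [div_le_iff₀ (by positivity), Real.rpow_one]; linarith)
    rw [abs_mul, abs_mul, abs_of_nonneg (tent_nonneg z), abs_of_nonneg hk]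
    calc _ = M * (|ℓ z| * tent z / M * fracKernel σ z) := by field_simp
      _ ≤ M * R1 := by
        gcongr
        exact this.trans (kernelMajorant_anti hσ0 (by linarith) hyk h1)
      _ ≤ 2 * M * R1 := by nlinarith
  -- In the difference of `E` and the half space, `y` lies in the strip or is far from `p`.
  have hstrip : |inner ℝ (y - p) n| ≤ K * ‖y - p‖ ^ 2 ∨ y ∉ Metric.ball p r →
      2 * M * R1 ≤ M * (2 + 2 / κ) * traceMajorant σ μ K κ r n (y - p) := by
    intro h
    have : R1 ≤ traceMajorant σ μ K κ r n (y - p) := by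
      unfold traceMajorant
      rcases h with h | h
      · rw [indicator_of_mem (show y - p ∈ paraboloidStrip K n from h)]
        linarith
      · rw [indicator_of_mem (s := (Metric.ball 0 r)ᶜ) (by simpa [dist_eq_norm] using h)]
        linarith
    gcongr
  have hT : 0 ≤ traceMajorant σ μ K κ r n (y - p) := by
    unfold traceMajorant; linarith
  by_cases hyE : y ∈ E <;> by_cases hyH : inner ℝ (y - p) n < 0
  · rw [traceIntegrand, indicator_of_mem hyE,
      indicator_of_mem (show y ∈ {y : RN N | inner ℝ (y - p) n < 0} from hyH)]
    rcases hμ with rfl | ⟨rfl, hs⟩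
    · have hle : R2 ≤ traceMajorant σ 1 K κ r n (y - p) := by unfold traceMajorant; linarith
      refine le_trans ?_ (mul_le_mul_of_nonneg_left hle (by positivity))
      obtain ⟨h0, h1⟩ := key1 (Or.inl hyE)
      have hz0 : 0 < ‖z‖ := norm_pos_iff.2 h0
      have hyz : ‖y - p‖ ≤ ‖z‖ / κ := by
        rw [le_div_iff₀ hκ, mul_comm]
        simpa [norm_smul, abs_of_pos hκ] using h1
      have hxz : ‖x - p‖ ≤ ‖z‖ + ‖y - p‖ := by
        have := norm_add_le (x - y) (y - p); simpa [hz] using this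
      -- The remainder is of second order; the majorant of order `1 + σ` suffices and is integrable
      -- since `2σ < 1 + σ`.
      set D := g x - g y - ℓ z * tent z with hD
      have hC : 0 < M * (2 + 2 / κ) := by positivity
      have hDb : |D| ≤ M * (2 + 2 / κ) ∧ |D| ≤ M * (2 + 2 / κ) * ‖z‖ ^ (1 + σ) := by
        rcases le_total ‖z‖ 1 with hz1 | hz1
        · have hD2 : |D| ≤ M * (2 + 2 / κ) * ‖z‖ ^ 2 := by
            have t1 := hg.taylor x y
            have t2 : |ℓ z * (1 - tent z)| ≤ M * ‖z‖ * ‖z‖ := by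
              have ht1 : 0 ≤ 1 - tent z := by linarith [tent_le_one z]
              rw [abs_mul, abs_of_nonneg ht1]
              exact mul_le_mul (hg.clm z) (one_sub_tent_le z) ht1 (by positivity)
            have t3 : D = (g x - g y - ℓ z) + ℓ z * (1 - tent z) := by rw [hD]; ring
            have t4 : ‖x - p‖ + ‖y - p‖ ≤ ‖z‖ + 2 * (‖z‖ / κ) := by linarith
            calc |D| ≤ M * ‖z‖ * (‖z‖ + 2 * (‖z‖ / κ)) + M * ‖z‖ * ‖z‖ := by
                  rw [t3]
                  refine (abs_add_le _ _).trans (add_le_add (t1.trans ?_) t2)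
                  gcongr
              _ = _ := by field_simp; ring
          have hp1 : ‖z‖ ^ 2 ≤ 1 := pow_le_one₀ hz0.le hz1
          have hp2 : ‖z‖ ^ 2 ≤ ‖z‖ ^ (1 + σ) := by
            rw [← Real.rpow_two]
            exact Real.rpow_le_rpow_of_exponent_ge hz0 hz1 (by linarith)
          refine ⟨hD2.trans (by nlinarith), hD2.trans (by gcongr)⟩
        · have ht : tent z = 0 := max_eq_left (by linarith)
          have hD3 : |D| ≤ 2 * M := by
            rw [hD, ht, mul_zero, sub_zero]
            have := abs_sub (g x) (g y); linarith [hg.bound x, hg.bound y]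
          have hp : 1 ≤ ‖z‖ ^ (1 + σ) := Real.one_le_rpow hz1 (by linarith)
          refine ⟨hD3.trans hC2, (hD3.trans hC2).trans (by nlinarith)⟩
      have := mul_fracKernel_le_kernelMajorant (σ := σ) (β := 1 + σ) h0
        (a := |D| / (M * (2 + 2 / κ)))
        (by rw [div_le_one hC]; exact hDb.1) (by rw [div_le_iff₀ hC, mul_comm]; exact hDb.2)
      have heq : fracKernel σ (x - y) * (g x - g y) - 1 * (ℓ (x - y) * (tent (x - y) *
          fracKernel σ (x - y))) = D * fracKernel σ z := by rw [hD, hz]; ring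
      rw [heq, abs_mul, abs_of_nonneg hk]
      calc _ = M * (2 + 2 / κ) * (|D| / (M * (2 + 2 / κ)) * fracKernel σ z) := by field_simp
        _ ≤ _ := by
          gcongr
          exact this.trans (kernelMajorant_anti hσ0 (by linarith) hyk h1)
    · rw [zero_mul, sub_zero, abs_mul, abs_of_nonneg hk]
      refine (keyE (Or.inl hyE)).trans ?_
      have : R1 ≤ traceMajorant σ 0 K κ r n (y - p) := by unfold traceMajorant; linarith
      gcongr
  · rw [traceIntegrand, indicator_of_mem hyE,
      indicator_of_notMem (show y ∉ {y : RN N | inner ℝ (y - p) n < 0} from hyH), mul_zero, sub_zero,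
      abs_mul, abs_of_nonneg hk]
    refine (keyE (Or.inl hyE)).trans (hstrip ?_)
    by_cases hb : y ∈ Metric.ball p r
    · left
      rw [abs_of_nonneg (not_lt.1 hyH)]; exact (hE y hb).1 hyE
    · exact Or.inr hb
  · rw [traceIntegrand, indicator_of_notMem hyE,
      indicator_of_mem (show y ∈ {y : RN N | inner ℝ (y - p) n < 0} from hyH), zero_sub, abs_neg,
      abs_mul, abs_of_nonneg hμ0]
    refine le_trans ?_ ((keyH (Or.inr hyH)).trans (hstrip ?_))
    · exact mul_le_of_le_one_left (abs_nonneg _) hμ1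
    · by_cases hb : y ∈ Metric.ball p r
      · left
        rw [abs_of_neg hyH]; linarith [(hE y hb).2 hyE]
      · exact Or.inr hb
  · rw [traceIntegrand, indicator_of_notMem hyE,
      indicator_of_notMem (show y ∉ {y : RN N | inner ℝ (y - p) n < 0} from hyH), mul_zero, sub_zero,
      abs_zero]
    positivity

lemma measurableSet_negHalfSpace (p n : RN N) : MeasurableSet {y : RN N | inner ℝ (y - p) n < 0} :=
  (isOpen_lt (by fun_prop) (by fun_prop)).measurableSet

lemma measurable_traceIntegrand (hEm : MeasurableSet E) (hg : Continuous g) (x : RN N) :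
    Measurable (traceIntegrand σ μ E n p g ℓ x) := by
  unfold traceIntegrand
  have := hg.measurable
  exact (Measurable.indicator (by fun_prop) hEm).sub
    ((Measurable.indicator (by fun_prop) (measurableSet_negHalfSpace p n)).const_mul μ)

lemma ae_abs_traceIntegrand_le [NeZero N] (hσ0 : 0 < σ) (hσ1 : σ < 1) (hμ : ModelWeight σ μ)
    (hκ : 0 < κ) (hE : TangentAt E K r p n) (hg : HasExpansionAt g ℓ p M) {x : RN N}
    (hx : ∀ y, y ∈ E ∨ inner ℝ (y - p) n < 0 → κ * ‖y - p‖ ≤ ‖x - y‖) :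
    ∀ᵐ y, ‖traceIntegrand σ μ E n p g ℓ x y‖ ≤
      M * (2 + 2 / κ) * traceMajorant σ μ K κ r n (y - p) := by
  filter_upwards [Measure.ae_ne volume p] with y hy
  exact abs_traceIntegrand_le hσ0 hσ1 hμ hκ hE hg hx hy

lemma integrable_traceIntegrand [NeZero N] (hσ0 : 0 < σ) (hσ1 : σ < 1) (hμ : ModelWeight σ μ)
    (hK : 0 < K) (hκ : 0 < κ) (hr : 0 < r) (hn : ‖n‖ = 1) (hEm : MeasurableSet E)
    (hE : TangentAt E K r p n) (hg : HasExpansionAt g ℓ p M) {x : RN N}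
    (hx : ∀ y, y ∈ E ∨ inner ℝ (y - p) n < 0 → κ * ‖y - p‖ ≤ ‖x - y‖) :
    Integrable (traceIntegrand σ μ E n p g ℓ x) :=
  ((((integrable_traceMajorant hσ0 hσ1 hμ hK hκ hr hn).comp_sub_right p).const_mul _)).mono'
    (measurable_traceIntegrand hEm hg.continuous x).aestronglyMeasurable
    (ae_abs_traceIntegrand_le hσ0 hσ1 hμ hκ hE hg hx)

lemma abs_integral_traceIntegrand_le [NeZero N] (hσ0 : 0 < σ) (hσ1 : σ < 1) (hμ : ModelWeight σ μ)
    (hK : 0 < K) (hκ : 0 < κ) (hr : 0 < r) (hn : ‖n‖ = 1)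
    (hE : TangentAt E K r p n) (hg : HasExpansionAt g ℓ p M) {x : RN N}
    (hx : ∀ y, y ∈ E ∨ inner ℝ (y - p) n < 0 → κ * ‖y - p‖ ≤ ‖x - y‖) :
    |∫ y, traceIntegrand σ μ E n p g ℓ x y| ≤
      M * (2 + 2 / κ) * ∫ z, traceMajorant σ μ K κ r n z := by
  have h := norm_integral_le_of_norm_le
    (((integrable_traceMajorant hσ0 hσ1 hμ hK hκ hr hn).comp_sub_right p).const_mul _)
    (ae_abs_traceIntegrand_le hσ0 hσ1 hμ hκ hE hg hx)
  rwa [integral_const_mul, integral_sub_right_eq_self (traceMajorant σ μ K κ r n)] at h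

lemma tendsto_integral_traceIntegrand [NeZero N] (hσ0 : 0 < σ) (hσ1 : σ < 1)
    (hμ : ModelWeight σ μ) (hK : 0 < K) (hκ : 0 < κ) (hr : 0 < r) (hn : ‖n‖ = 1)
    (hEm : MeasurableSet E) (hE : TangentAt E K r p n) (hg : HasExpansionAt g ℓ p M)
    {ι : Type*} {l : Filter ι} [l.IsCountablyGenerated] {X : ι → RN N} (hX : Tendsto X l (𝓝 p))
    (hx : ∀ᶠ i in l, ∀ y, y ∈ E ∨ inner ℝ (y - p) n < 0 → κ * ‖y - p‖ ≤ ‖X i - y‖) :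
    Tendsto (fun i => ∫ y, traceIntegrand σ μ E n p g ℓ (X i) y) l
      (𝓝 (∫ y, traceIntegrand σ μ E n p g ℓ p y)) := by
  refine tendsto_integral_filter_of_dominated_convergence _
    (Eventually.of_forall fun i =>
      (measurable_traceIntegrand hEm hg.continuous (X i)).aestronglyMeasurable)
    (hx.mono fun i hi => ae_abs_traceIntegrand_le hσ0 hσ1 hμ hκ hE hg hi)
    (((integrable_traceMajorant hσ0 hσ1 hμ hK hκ hr hn).comp_sub_right p).const_mul _) ?_
  filter_upwards [Measure.ae_ne volume p] with y hy
  have hpy : p - y ≠ 0 := sub_ne_zero.2 hy.symm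
  have c1 : ContinuousAt (fun x => fracKernel σ (x - y)) p :=
    (continuousAt_fracKernel (σ := σ) hpy).comp (f := fun x => x - y) (by fun_prop)
  have c0 : ContinuousAt g p := hg.continuous.continuousAt
  have hc : ContinuousAt (fun x => traceIntegrand σ μ E n p g ℓ x y) p := by
    unfold traceIntegrand
    refine ContinuousAt.sub ?_ (continuousAt_const.mul ?_)
    · by_cases hyE : y ∈ E
      · simp only [indicator_of_mem hyE]; fun_prop
      · simp only [indicator_of_notMem hyE]; fun_prop
    · by_cases hyH : y ∈ {y : RN N | inner ℝ (y - p) n < 0}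
      · simp only [indicator_of_mem hyH]; fun_prop
      · simp only [indicator_of_notMem hyH]; fun_prop
  exact hc.tendsto.comp hX

/-- The integral over `E` is the regularized one plus the explicit singular model. -/
lemma setIntegral_eq_traceIntegral [NeZero N] (hσ0 : 0 < σ) (hn : ‖n‖ = 1)
    (hEm : MeasurableSet E) (hg : HasExpansionAt g ℓ p M) {x : RN N} (hx : x ∉ closure E)
    (hxn : 0 < inner ℝ (x - p) n) :
    ∫ y in E, fracKernel σ (x - y) * (g x - g y) =
      (∫ y, traceIntegrand σ μ E n p g ℓ x y) +
        μ * (ℓ n * halfSpaceIntegral σ n (inner ℝ (x - p) n)) := by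
  have hgc := hg.continuous.measurable
  have i1 : IntegrableOn (fun y => fracKernel σ (x - y) * (g x - g y)) E := by
    refine ((integrableOn_fracKernel_sub hσ0 hEm hx).mul_const (2 * M)).mono'
      (Measurable.aestronglyMeasurable (by fun_prop)) (Eventually.of_forall fun y => ?_)
    rw [norm_mul, Real.norm_of_nonneg (fracKernel_nonneg _)]
    refine mul_le_mul_of_nonneg_left ?_ (fracKernel_nonneg _)
    have := abs_sub (g x) (g y)
    rw [Real.norm_eq_abs]
    linarith [hg.bound x, hg.bound y]
  have hpre : {y : RN N | inner ℝ (y - p) n < 0} =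
      (fun y => x - y) ⁻¹' {z : RN N | inner ℝ (x - p) n < inner ℝ z n} := by
    ext y
    simp only [mem_ofPred_eq, mem_preimage, inner_sub_left]
    constructor <;> intro h <;> linarith
  have mp := (volume : Measure (RN N)).measurePreserving_sub_left x
  have hemb := (MeasurableEquiv.subLeft x).measurableEmbedding
  have i2 : IntegrableOn (fun y => ℓ (x - y) * (tent (x - y) * fracKernel σ (x - y)))
      {y : RN N | inner ℝ (y - p) n < 0} := by
    rw [hpre]
    exact (mp.integrableOn_comp_preimage hemb).2 (integrableOn_linear_halfSpace hσ0 hn ℓ hxn)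
  have e2 : ∫ y in {y : RN N | inner ℝ (y - p) n < 0},
      ℓ (x - y) * (tent (x - y) * fracKernel σ (x - y)) =
      ℓ n * halfSpaceIntegral σ n (inner ℝ (x - p) n) := by
    rw [hpre, ← setIntegral_linear_halfSpace hσ0 hn ℓ hxn]
    exact mp.setIntegral_preimage_emb hemb (fun z => ℓ z * (tent z * fracKernel σ z)) _
  rw [← e2]
  unfold traceIntegrand
  rw [integral_sub, integral_const_mul, integral_indicator hEm,
    integral_indicator (measurableSet_negHalfSpace p n)]
  · ring
  · exact (integrable_indicator_iff hEm).2 i1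
  · exact ((integrable_indicator_iff (measurableSet_negHalfSpace p n)).2 i2).const_mul μ

lemma ae_inner_sub_ne_zero (hn : n ≠ 0) : ∀ᵐ y : RN N, inner ℝ (y - p) n ≠ 0 := by
  have h1 : ∀ᵐ z : RN N, z ∉ (ℝ ∙ n)ᗮ := by
    have htop : (ℝ ∙ n)ᗮ ≠ ⊤ := by
      intro h
      have : n ∈ (ℝ ∙ n)ᗮ := h ▸ Submodule.mem_top
      rw [Submodule.mem_orthogonal_singleton_iff_inner_left, inner_self_eq_zero] at this
      exact hn this
    exact measure_eq_zero_iff_ae_notMem.1 (Measure.addHaar_submodule volume _ htop)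
  have h2 := ((measurePreserving_sub_right volume p).quasiMeasurePreserving).ae h1
  filter_upwards [h2] with y hy h
  exact hy (Submodule.mem_orthogonal_singleton_iff_inner_left.2 h)

/-- The regularized integrals over `E` and over its complement, with opposite normals, add up to
the principal value over the whole space. -/
lemma integral_traceIntegrand_add_compl [NeZero N] (hσ0 : 0 < σ) (hσ1 : σ < 1)
    (hμ : ModelWeight σ μ) (hK : 0 < K) (hr : 0 < r) (hn : ‖n‖ = 1) (hEm : MeasurableSet E)
    (hE : TangentAt E K r p n) (hg : HasExpansionAt g ℓ p M) :
    (∫ y, traceIntegrand σ μ E n p g ℓ p y) + ∫ y, traceIntegrand σ μ Eᶜ (-n) p g ℓ p y =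
      fracLap σ g p := by
  have hx : ∀ y, (1 : ℝ) * ‖y - p‖ ≤ ‖p - y‖ := fun y => by rw [one_mul, norm_sub_rev]
  have i1 := integrable_traceIntegrand hσ0 hσ1 hμ hK one_pos hr hn hEm hE hg (fun y _ => hx y)
  have i2 := integrable_traceIntegrand hσ0 hσ1 hμ hK one_pos hr (n := -n) (by rwa [norm_neg])
    hEm.compl hE.compl hg (fun y _ => hx y)
  set h : RN N → ℝ := fun y => fracKernel σ (p - y) * (g p - g y) -
    μ * (ℓ (p - y) * (tent (p - y) * fracKernel σ (p - y)))
  have hae : (fun y => traceIntegrand σ μ E n p g ℓ p y + traceIntegrand σ μ Eᶜ (-n) p g ℓ p y)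
      =ᵐ[volume] h := by
    filter_upwards [ae_inner_sub_ne_zero (p := p) (norm_ne_zero_iff.1 (by rw [hn]; norm_num))] with y hy
    simp only [traceIntegrand, h]
    have a1 := congrFun (indicator_self_add_compl E
      (fun y => fracKernel σ (p - y) * (g p - g y))) y
    simp only [Pi.add_apply] at a1
    have a2 : {y : RN N | inner ℝ (y - p) n < 0}.indicator
        (fun y => ℓ (p - y) * (tent (p - y) * fracKernel σ (p - y))) y +
        {y : RN N | inner ℝ (y - p) (-n) < 0}.indicator
        (fun y => ℓ (p - y) * (tent (p - y) * fracKernel σ (p - y))) y =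
        ℓ (p - y) * (tent (p - y) * fracKernel σ (p - y)) := by
      simp only [indicator, mem_ofPred_eq, inner_neg_right, neg_lt_zero]
      rcases lt_or_gt_of_ne hy with h | h
      · simp [h, h.not_gt]
      · simp [h, h.not_gt]
    rw [← a1, ← a2]; ring
  rw [← integral_add i1 i2, integral_congr_ae hae]
  have hi : Integrable h := (i1.add i2).congr hae
  -- Symmetrization under `z ↦ -z` removes the odd model and produces the second difference.
  have h1 : ∫ y, h y = ∫ z, h (p + z) := (integral_add_left_eq_self h p).symm
  have h2 : ∫ y, h y = ∫ z, h (p - z) := (integral_sub_left_eq_self h volume p).symm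
  have h3 : 2 * ∫ y, h y = 2 * fracLap σ g p := by
    rw [two_mul]
    nth_rw 1 [h1]
    rw [h2, ← integral_add (hi.comp_add_left p) (hi.comp_sub_left p), fracLap, ← integral_const_mul]
    congr with z
    simp only [h, secondDiff, smul_eq_mul, sub_sub_cancel, sub_add_cancel_left, fracKernel_neg, map_neg]
    have : tent (-z) = tent z := by simp [tent]
    rw [this]; ring
  linarith

end Trace

/-! ### Boundary values of the regional operators -/

section Approach
variable {N : ℕ} {σ μ K κ r M : ℝ} {n m p q : RN N} {E : Set (RN N)}

/-- Points that move away from `p` in a direction `q` transversal to the tangent hyperplane stay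
away from `E` and from the tangent half space, proportionally to the distance to `p`. -/
lemma TangentAt.le_norm_sub (hE : TangentAt E K r p n) (hK : 0 < K) (hn : ‖n‖ = 1) (hq : ‖q‖ ≤ 1)
    (hκ : 0 < κ) (hqn : κ ≤ inner ℝ q n) {t : ℝ} (ht : 0 < t) (htr : 2 * t ≤ r)
    (htK : 8 * K * t ≤ κ) {y : RN N} (hy : y ∈ E ∨ inner ℝ (y - p) n < 0) :
    κ / 4 * ‖y - p‖ ≤ ‖p + t • q - y‖ ∧ κ / 2 * t ≤ ‖p + t • q - y‖ := by
  have hκ1 : κ ≤ 1 := by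
    have := real_inner_le_norm q n
    rw [hn, mul_one] at this; linarith
  have hyp : 0 ≤ ‖y - p‖ := norm_nonneg _
  rcases le_or_gt (2 * t) ‖y - p‖ with h | h
  · have h1 : ‖y - p‖ - t ≤ ‖p + t • q - y‖ := by
      have h2 : ‖t • q‖ ≤ t := by
        rw [norm_smul, Real.norm_of_nonneg ht.le]; nlinarith
      have h3 := norm_sub_norm_le (y - p) (t • q)
      rw [norm_sub_rev (y - p), show t • q - (y - p) = p + t • q - y by abel] at h3
      linarith
    constructor <;> nlinarith
  · have h1 : κ / 2 * t ≤ inner ℝ (p + t • q - y) n := by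
      have h2 : inner ℝ (p + t • q - y) n = t * inner ℝ q n - inner ℝ (y - p) n := by
        rw [show p + t • q - y = t • q - (y - p) by abel, inner_sub_left, real_inner_smul_left]
      have h3 : t * κ ≤ t * inner ℝ q n := by gcongr
      rw [h2]
      rcases hy with hy | hy
      · have h4 := (hE y (by rw [Metric.mem_ball, dist_eq_norm]; linarith)).1 hy
        have h5 : K * ‖y - p‖ ^ 2 ≤ K * (2 * t) ^ 2 := by gcongr
        nlinarith
      · nlinarith
    have h2 := real_inner_le_norm (p + t • q - y) n
    rw [hn, mul_one] at h2
    constructor <;> nlinarith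

/-- Transversal directions lead out of the closure of `E` for a while. -/
lemma TangentAt.notMem_closure (hE : TangentAt E K r p n) (hK : 0 < K) (hn : ‖n‖ = 1)
    (hq : ‖q‖ ≤ 1) (hκ : 0 < κ) (hqn : κ ≤ inner ℝ q n) {t : ℝ} (ht : 0 < t) (htr : 2 * t ≤ r)
    (htK : 8 * K * t ≤ κ) : p + t • q ∉ closure E := by
  intro h
  have hsub : closure E ⊆ {y | κ / 2 * t ≤ ‖p + t • q - y‖} :=
    closure_minimal (fun y hy =>
      (hE.le_norm_sub hK hn hq hκ hqn ht htr htK (Or.inl hy)).2)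
      (isClosed_le (by fun_prop) (by fun_prop))
  have := hsub h
  simp only [mem_ofPred_eq, sub_self, norm_zero] at this
  nlinarith [mul_pos hκ ht]

end Approach

section TraceSchwartz
variable {N : ℕ} {σ μ K κ r M : ℝ} {n m p q : RN N} {E : Set (RN N)}

/-- The differential at `p` of the component `w · m` of a vector field. -/
def innerDeriv (w : RN N → RN N) (p m : RN N) : RN N →L[ℝ] ℝ :=
  (innerSL ℝ m).comp (fderiv ℝ w p)

lemma innerDeriv_apply (w : RN N → RN N) (p m z : RN N) :
    innerDeriv w p m z = inner ℝ (fderiv ℝ w p z) m := by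
  rw [innerDeriv, ContinuousLinearMap.comp_apply, innerSL_apply_apply, real_inner_comm]

/-- `M` is admissible in the expansions of all components `w · m`, `‖m‖ ≤ 1`, at all points. -/
def ExpansionBound (w : RN N → RN N) (M : ℝ) : Prop :=
  ∀ p m : RN N, ‖m‖ ≤ 1 → HasExpansionAt (fun x => inner ℝ (w x) m) (innerDeriv w p m) p M

lemma exists_expansionBound (w : 𝓢(RN N, RN N)) : ∃ M, 0 < M ∧ ExpansionBound w M := by
  obtain ⟨C, hC, h0, h1, h2, h3⟩ := w.exists_taylor_bounds
  have key : ∀ z m : RN N, ‖m‖ ≤ 1 → |inner ℝ z m| ≤ ‖z‖ := fun z m hm =>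
    (abs_real_inner_le_norm z m).trans (mul_le_of_le_one_right (norm_nonneg _) hm)
  refine ⟨C, hC, fun p m hm => ⟨w.continuous.inner continuous_const, hC, fun x =>
    (key _ _ hm).trans (h0 x), fun x y => ?_, fun x y => ?_, fun z => ?_⟩⟩
  · rw [← inner_sub_left]; exact (key _ _ hm).trans (h2 x y)
  · rw [innerDeriv_apply, ← inner_sub_left, ← inner_sub_left]
    exact (key _ _ hm).trans (h3 p x y)
  · rw [innerDeriv_apply]
    exact (key _ _ hm).trans ((ContinuousLinearMap.le_opNorm _ _).trans (by gcongr; exact h1 p))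

/-- The boundary value at `p` of the component along `m` of the (regularized) regional integral over
`E`, where `n` is the outer normal to `E` at `p`. It is the boundary value of the integral itself
once the coefficient of the singular model vanishes. -/
def regionalTrace (σ μ : ℝ) (E : Set (RN N)) (w : RN N → RN N) (p n m : RN N) : ℝ :=
  ∫ y, traceIntegrand σ μ E n p (fun x => inner ℝ (w x) m) (innerDeriv w p m) p y

lemma inner_regionalIntegral [NeZero N] (hσ0 : 0 < σ) (w : 𝓢(RN N, RN N)) (hEm : MeasurableSet E)
    {x : RN N} (hx : x ∉ closure E) (m : RN N) :
    inner ℝ (regionalIntegral σ E w x) m =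
      ∫ y in E, fracKernel σ (x - y) * (inner ℝ (w x) m - inner ℝ (w y) m) := by
  rw [regionalIntegral, real_inner_comm,
    ← integral_inner (integrableOn_regional_integrand hσ0 hEm hx w)]
  congr with y
  rw [inner_smul_right, real_inner_comm, inner_sub_left]

/-- Away from its explicit singular part, the regional integral is bounded near the boundary along
transversal directions, uniformly in the boundary point. -/
lemma exists_abs_inner_regionalIntegral_sub_le [NeZero N] (hσ0 : 0 < σ) (hσ1 : σ < 1)
    (hμ : ModelWeight σ μ) (hK : 0 < K) (hκ : 0 < κ) (hr : 0 < r) (w : 𝓢(RN N, RN N)) :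
    ∃ C, 0 < C ∧ ∀ (E : Set (RN N)) (p n m q : RN N) (t : ℝ), MeasurableSet E →
      TangentAt E K r p n → ‖n‖ = 1 → ‖m‖ ≤ 1 → ‖q‖ ≤ 1 → κ ≤ inner ℝ q n → 0 < t → 2 * t ≤ r →
      8 * K * t ≤ κ →
      |inner ℝ (regionalIntegral σ E w (p + t • q)) m -
        μ * (inner ℝ (fderiv ℝ w p n) m * halfSpaceIntegral σ n (t * inner ℝ q n))| ≤ C := by
  obtain ⟨M, hM, hexp⟩ := exists_expansionBound w
  obtain ⟨e, he⟩ : ∃ e : RN N, ‖e‖ = 1 := ⟨EuclideanSpace.single 0 1, by simp⟩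
  set C := M * (2 + 2 / (κ / 4)) * ∫ z, traceMajorant σ μ K (κ / 4) r e z
  refine ⟨|C| + 1, by positivity, fun E p n m q t hEm hE hn hm hq hqn ht htr htK => ?_⟩
  have hx := hE.notMem_closure hK hn hq hκ hqn ht htr htK
  have hin : inner ℝ (p + t • q - p) n = t * inner ℝ q n := by
    rw [add_sub_cancel_left, real_inner_smul_left]
  have hpos : 0 < inner ℝ (p + t • q - p) n := by rw [hin]; nlinarith
  rw [inner_regionalIntegral hσ0 w hEm hx,
    setIntegral_eq_traceIntegral hσ0 hn hEm (hexp p m hm) hx hpos (μ := μ), innerDeriv_apply, hin,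
    add_sub_cancel_right]
  have := abs_integral_traceIntegrand_le hσ0 hσ1 hμ hK (show 0 < κ / 4 by linarith) hr hn hE
    (hexp p m hm) (x := p + t • q)
    (fun y hy => (hE.le_norm_sub hK hn hq hκ hqn ht htr htK hy).1)
  rw [integral_traceMajorant_congr hn he] at this
  exact this.trans ((le_abs_self C).trans (by linarith))

/-- Where the singular part is absent, the regional integral has a boundary value along
transversal directions. -/
lemma tendsto_inner_regionalIntegral [NeZero N] (hσ0 : 0 < σ) (hσ1 : σ < 1)
    (hμ : ModelWeight σ μ) (hK : 0 < K) (hr : 0 < r) (w : 𝓢(RN N, RN N)) (hEm : MeasurableSet E)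
    (hE : TangentAt E K r p n) (hn : ‖n‖ = 1) (hm : ‖m‖ ≤ 1) (hq : ‖q‖ ≤ 1)
    (hqn : 0 < inner ℝ q n) (h0 : μ * inner ℝ (fderiv ℝ w p n) m = 0) :
    Tendsto (fun t : ℝ => inner ℝ (regionalIntegral σ E w (p + t • q)) m) (𝓝[>] 0)
      (𝓝 (regionalTrace σ μ E w p n m)) := by
  obtain ⟨M, hM, hexp⟩ := exists_expansionBound w
  set κ : ℝ := inner ℝ q n
  have hsmall : ∀ᶠ t : ℝ in 𝓝[>] 0, 0 < t ∧ 2 * t ≤ r ∧ 8 * K * t ≤ κ := by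
    have h1 : ∀ᶠ t : ℝ in 𝓝 0, 2 * t < r :=
      (show Continuous fun t : ℝ => 2 * t by fun_prop).tendsto 0 |>.eventually_lt_const (by simpa)
    have h2 : ∀ᶠ t : ℝ in 𝓝 0, 8 * K * t < κ :=
      (show Continuous fun t : ℝ => 8 * K * t by fun_prop).tendsto 0
        |>.eventually_lt_const (by simpa)
    filter_upwards [self_mem_nhdsWithin, h1.filter_mono nhdsWithin_le_nhds,
      h2.filter_mono nhdsWithin_le_nhds] with t ht h1 h2 using ⟨ht, h1.le, h2.le⟩
  have hX : Tendsto (fun t : ℝ => p + t • q) (𝓝[>] 0) (𝓝 p) := by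
    have := (show Continuous fun t : ℝ => p + t • q by fun_prop).tendsto 0
    simp only [zero_smul, add_zero] at this
    exact this.mono_left nhdsWithin_le_nhds
  refine (tendsto_integral_traceIntegrand hσ0 hσ1 hμ hK (show 0 < κ / 4 by positivity) hr hn hEm hE
    (hexp p m hm) hX (hsmall.mono fun t ht y hy =>
      (hE.le_norm_sub hK hn hq hqn le_rfl ht.1 ht.2.1 ht.2.2 hy).1)).congr' ?_
  filter_upwards [hsmall] with t ht
  have hx := hE.notMem_closure hK hn hq hqn le_rfl ht.1 ht.2.1 ht.2.2
  have hpos : 0 < inner ℝ (p + t • q - p) n := by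
    rw [add_sub_cancel_left, real_inner_smul_left]; exact mul_pos ht.1 hqn
  rw [inner_regionalIntegral hσ0 w hEm hx,
    setIntegral_eq_traceIntegral hσ0 hn hEm (hexp p m hm) hx hpos (μ := μ), innerDeriv_apply,
    ← mul_assoc, h0, zero_mul, add_zero]

/-- The traces of the regional operators over `E` and over its complement add up to the operator
over the whole space, which has no jump. -/
lemma regionalTrace_add_compl [NeZero N] (hσ0 : 0 < σ) (hσ1 : σ < 1)
    (hμ : ModelWeight σ μ) (hK : 0 < K) (hr : 0 < r) (w : 𝓢(RN N, RN N)) (hEm : MeasurableSet E)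
    (hE : TangentAt E K r p n) (hn : ‖n‖ = 1) (hm : ‖m‖ ≤ 1) :
    regionalTrace σ μ E w p n m + regionalTrace σ μ Eᶜ w p (-n) m =
      inner ℝ (fracLap σ w p) m := by
  obtain ⟨M, hM, hexp⟩ := exists_expansionBound w
  rw [regionalTrace, regionalTrace, integral_traceIntegrand_add_compl hσ0 hσ1 hμ hK hr hn hEm hE
    (hexp p m hm), real_inner_comm]
  have := fracLap_clm_comp hσ0 hσ1 w (innerSL ℝ m) p
  simp only [innerSL_apply_apply] at this
  rw [← this]
  congr with y
  rw [real_inner_comm]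

end TraceSchwartz

section NormalProfile
variable {N : ℕ} {σ μ K r : ℝ} {p : RN N} {Ω : Set (RN N)}

/-- The boundary value of `((-Δ)^σ_{ℝ^N∖Ω} ∇u) · ν`, as the difference of the boundary values of the
full and of the regional operator. -/
lemma tendsto_normalProfile [NeZero N] (hσ0 : 0 < σ) (hσ1 : σ < 1) (hμ : ModelWeight σ μ)
    (hK : 0 < K) (hr : 0 < r) (u : 𝓢(RN N, ℝ)) (hΩ : IsOpen Ω)
    (hT : TangentAt Ω K r p (outerNormal Ω p)) (hn : ‖outerNormal Ω p‖ = 1)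
    (h0 : μ * inner ℝ (fderiv ℝ (gradient u) p (outerNormal Ω p)) (outerNormal Ω p) = 0) :
    Tendsto (normalProfile σ Ω u p) (𝓝[≠] 0)
      (𝓝 (fracConst N σ * (inner ℝ (fracLap σ (gradient u) p) (outerNormal Ω p) -
        regionalTrace σ μ Ω (gradient u) p (outerNormal Ω p) (outerNormal Ω p)))) := by
  set n := outerNormal Ω p with hndef
  rw [← coe_schwartzGradient] at h0 ⊢
  set w := schwartzGradient u
  have hnn : inner ℝ n n = (1 : ℝ) := by rw [real_inner_self_eq_norm_sq, hn]; norm_num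
  have hm := hΩ.measurableSet
  rw [← Iio_union_Ioi, nhdsWithin_union, tendsto_sup]
  have hsmall : ∀ᶠ t : ℝ in 𝓝[>] 0, 0 < t ∧ 2 * t ≤ r ∧ 8 * K * t ≤ 1 := by
    have h1 : ∀ᶠ t : ℝ in 𝓝 0, 2 * t < r :=
      (show Continuous fun t : ℝ => 2 * t by fun_prop).tendsto 0 |>.eventually_lt_const (by simpa)
    have h2 : ∀ᶠ t : ℝ in 𝓝 0, 8 * K * t < 1 :=
      (show Continuous fun t : ℝ => 8 * K * t by fun_prop).tendsto 0
        |>.eventually_lt_const (by simp)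
    filter_upwards [self_mem_nhdsWithin, h1.filter_mono nhdsWithin_le_nhds,
      h2.filter_mono nhdsWithin_le_nhds] with t ht h1 h2 using ⟨ht, h1.le, h2.le⟩
  constructor
  · -- From inside, the regional operator over the complement is an absolutely convergent integral.
    have hc := hT.compl
    have hnn' : (0 : ℝ) < inner ℝ (-n) (-n) := by rw [inner_neg_neg, hnn]; norm_num
    have hn' : ‖-n‖ = 1 := by rwa [norm_neg]
    have h1 := tendsto_inner_regionalIntegral hσ0 hσ1 hμ hK hr w hm.compl hc hn' hn.le hn'.le hnn'
      (by rw [map_neg, inner_neg_left, mul_neg, h0, neg_zero])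
    have h2 : Tendsto (fun t : ℝ => -t) (𝓝[<] 0) (𝓝[>] 0) := by
      simpa using tendsto_neg_nhdsLT (a := (0 : ℝ))
    rw [← regionalTrace_add_compl hσ0 hσ1 hμ hK hr w hm hT hn hn.le, add_sub_cancel_left]
    refine ((h1.comp h2).const_mul (fracConst N σ)).congr' ?_
    filter_upwards [h2.eventually hsmall] with t ht
    have hx := hc.notMem_closure hK hn' hn'.le (κ := 1) one_pos
      (by rw [inner_neg_neg, hnn]) ht.1 ht.2.1 ht.2.2
    rw [neg_smul_neg] at hx
    simp only [Function.comp_apply, neg_smul_neg]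
    rw [normalProfile, ← hndef, ← coe_schwartzGradient,
      regionalFracLaplacian_of_notMem hσ0 hm.compl hx w, real_inner_smul_left]
  · -- From outside, it is the difference of two operators with boundary values.
    have h1 := tendsto_inner_regionalIntegral hσ0 hσ1 hμ hK hr w hm hT hn hn.le hn.le
      (by rw [hnn]; norm_num) h0
    have h2 : Tendsto (fun t : ℝ => inner ℝ (fracLap σ w (p + t • n)) n) (𝓝[>] 0)
        (𝓝 (inner ℝ (fracLap σ w p) n)) := by
      have hcont := continuous_fracLap hσ0 hσ1 w
      have := (show Continuous fun t : ℝ => inner ℝ (fracLap σ w (p + t • n)) n by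
        fun_prop).tendsto 0
      simp only [zero_smul, add_zero] at this
      exact this.mono_left nhdsWithin_le_nhds
    refine ((h2.sub h1).const_mul (fracConst N σ)).congr' ?_
    filter_upwards [hsmall] with t ht
    have hx := hT.notMem_closure hK hn hn.le (κ := 1) one_pos hnn.ge ht.1 ht.2.1 ht.2.2
    rw [normalProfile, ← hndef, ← coe_schwartzGradient,
      regionalFracLaplacian_compl hσ0 hσ1 hm hx w, real_inner_smul_left, inner_sub_left]

end NormalProfile

/-! ### The area formula for graphs -/

section Area
variable {U V : Type*} [NormedAddCommGroup U] [InnerProductSpace ℝ U] [FiniteDimensional ℝ U]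
  [MeasurableSpace U] [BorelSpace U] [NormedAddCommGroup V] [InnerProductSpace ℝ V]
  [MeasurableSpace V] [BorelSpace V]

/-- If `f` contracts distances at least as much as `g`, up to the factor `C`, then its images have
at most `C ^ d` times the `d`-dimensional measure. -/
lemma euclideanHausdorffMeasure_image_le_of_edist_le {X Y Z : Type*} [EMetricSpace Y]
    [MeasurableSpace Y] [BorelSpace Y] [EMetricSpace Z] [MeasurableSpace Z] [BorelSpace Z]
    {f : X → Y} {g : X → Z} {s : Set X} {C : ℝ≥0}
    (h : ∀ a ∈ s, ∀ b ∈ s, edist (f a) (f b) ≤ C * edist (g a) (g b)) (d : ℕ) :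
    μHE[d] (f '' s) ≤ C ^ d * μHE[d] (g '' s) := by
  rcases s.eq_empty_or_nonempty with rfl | ⟨x₀, hx₀⟩
  · simp
  have : Nonempty X := ⟨x₀⟩
  have hmem : ∀ a ∈ s, Function.invFunOn g s (g a) ∈ s := fun a ha =>
    Function.invFunOn_mem ⟨a, ha, rfl⟩
  have heq : ∀ a ∈ s, g (Function.invFunOn g s (g a)) = g a := fun a ha =>
    Function.invFunOn_eq ⟨a, ha, rfl⟩
  have hL : LipschitzOnWith C (f ∘ Function.invFunOn g s) (g '' s) := by
    rintro _ ⟨a, ha, rfl⟩ _ ⟨b, hb, rfl⟩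
    have := h _ (hmem a ha) _ (hmem b hb)
    rwa [heq a ha, heq b hb] at this
  have him : (f ∘ Function.invFunOn g s) '' (g '' s) = f '' s := by
    rw [image_image]
    refine image_congr fun a ha => ?_
    have := h _ (hmem a ha) _ ha
    rw [heq a ha, edist_self, mul_zero, nonpos_iff_eq_zero, edist_eq_zero] at this
    exact this
  have := hL.hausdorffMeasure_image_le (d := d) (by positivity)
  rw [him, ENNReal.rpow_natCast] at this
  simp only [Measure.euclideanHausdorffMeasure_def, Measure.smul_apply, ENNReal.smul_def,
    smul_eq_mul]
  rw [mul_left_comm]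
  gcongr

/-- An inequality between measures, with a fixed factor, is a local property. -/
lemma Measure.le_smul_of_locally {X : Type*} [TopologicalSpace X] [SecondCountableTopology X]
    [MeasurableSpace X] [OpensMeasurableSpace X] {μ ν : Measure X} {θ : ENNReal}
    (h : ∀ x, ∃ O ∈ 𝓝 x, ∀ A ⊆ O, MeasurableSet A → μ A ≤ θ * ν A) {A : Set X}
    (hA : MeasurableSet A) : μ A ≤ θ * ν A := by
  choose O hO hle using h
  have hO' : ∀ x, interior (O x) ∈ 𝓝 x := fun x => interior_mem_nhds.2 (hO x)
  obtain ⟨s, hs, hcov⟩ := TopologicalSpace.countable_cover_nhds hO'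
  rcases s.eq_empty_or_nonempty with rfl | hne
  · simp only [mem_empty_iff_false, iUnion_false, iUnion_empty] at hcov
    have : A = ∅ := by rw [← subset_empty_iff, hcov]; exact subset_univ A
    simp [this]
  obtain ⟨a, rfl⟩ := hs.exists_eq_range hne
  set B : ℕ → Set X := disjointed fun k => interior (O (a k))
  have hBm : ∀ k, MeasurableSet (B k) := fun k =>
    MeasurableSet.disjointed (fun k => isOpen_interior.measurableSet) k
  have hB : ⋃ k, A ∩ B k = A := by
    rw [← inter_iUnion, iUnion_disjointed]
    rw [biUnion_range] at hcov
    rw [hcov, inter_univ]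
  have hd : Pairwise (Function.onFun Disjoint fun k => A ∩ B k) := fun i j hij =>
    (disjoint_disjointed _ hij).mono inter_subset_right inter_subset_right
  rw [← hB, measure_iUnion hd (fun k => hA.inter (hBm k)),
    measure_iUnion hd (fun k => hA.inter (hBm k)), ← ENNReal.tsum_mul_left]
  exact ENNReal.tsum_le_tsum fun k => hle (a k) _
    (inter_subset_right.trans ((disjointed_subset _ k).trans interior_subset)) (hA.inter (hBm k))

/-- The area formula for a `C¹` embedding that does not decrease distances: by strict
differentiability it is locally almost an isometric perturbation of its linearization, for which the
measure of images is given by `LinearMap.normDet`. -/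
theorem comap_euclideanHausdorffMeasure_eq_withDensity {G : U → V} (hG : ContDiff ℝ 1 G)
    (hexp : ∀ a b, ‖a - b‖ ≤ ‖G a - G b‖) (hemb : MeasurableEmbedding G) {J : U → ℝ}
    (hJ : Continuous J) (hJ0 : ∀ x, 0 < J x)
    (hdet : ∀ x, (fderiv ℝ G x : U →ₗ[ℝ] V).normDet = J x) :
    (μHE[Module.finrank ℝ U] : Measure V).comap G =
      volume.withDensity fun x => ENNReal.ofReal (J x) := by
  set d := Module.finrank ℝ U
  set μ₁ := (μHE[d] : Measure V).comap G
  set μ₂ := (volume : Measure U).withDensity fun x => ENNReal.ofReal (J x)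
  have hloc : ∀ c : ℝ≥0, 1 < c → ∀ x, ∃ O ∈ 𝓝 x, ∀ A ⊆ O, MeasurableSet A →
      μ₁ A ≤ (c : ENNReal) ^ (d + 1) * μ₂ A ∧ μ₂ A ≤ (c : ENNReal) ^ (d + 1) * μ₁ A := by
    intro c hc x
    have hc' : (1 : ℝ) < c := hc
    set D := fderiv ℝ G x
    have hst : HasStrictFDerivAt G D x := hG.contDiffAt.hasStrictFDerivAt one_ne_zero
    have hDexp : ∀ z, ‖z‖ ≤ ‖D z‖ := by
      intro z
      have h1 : Tendsto (fun t : ℝ => ‖t⁻¹ • (G (x + t • z) - G x)‖) (𝓝[≠] 0) (𝓝 ‖D z‖) :=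
        ((hst.hasFDerivAt.hasLineDerivAt z).tendsto_slope_zero).norm
      refine ge_of_tendsto h1 ?_
      filter_upwards [self_mem_nhdsWithin] with t ht
      have := hexp (x + t • z) x
      rw [add_sub_cancel_left, norm_smul] at this
      rw [norm_smul, norm_inv, inv_mul_eq_div, le_div_iff₀ (norm_pos_iff.2 ht)]
      linarith
    set η : ℝ := 1 - (c : ℝ)⁻¹
    have hη : 0 < η := sub_pos.2 (inv_lt_one_of_one_lt₀ hc')
    have hη1 : 1 + η ≤ c := by
      have : (c : ℝ) * (c : ℝ)⁻¹ = 1 := mul_inv_cancel₀ (by linarith)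
      have h0 : (0 : ℝ) < (c : ℝ)⁻¹ := by positivity
      simp only [η]; nlinarith
    have hη2 : c * (1 - η) = 1 := by simp only [η, sub_sub_cancel]; exact mul_inv_cancel₀ (by linarith)
    have e1 : ∀ᶠ q : U × U in 𝓝 (x, x), ‖G q.1 - G q.2 - D (q.1 - q.2)‖ ≤ η * ‖q.1 - q.2‖ :=
      hst.isLittleO.def hη
    obtain ⟨O₁, hO₁, h₁⟩ :
        ∃ O ∈ 𝓝 x, ∀ a ∈ O, ∀ b ∈ O, ‖G a - G b - D (a - b)‖ ≤ η * ‖a - b‖ := by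
      rw [nhds_prod_eq] at e1
      obtain ⟨O, hO, h⟩ := mem_prod_same_iff.1 e1
      exact ⟨O, hO, fun a ha b hb => h (mk_mem_prod ha hb)⟩
    have e2 : ∀ᶠ y in 𝓝 x, J y < c * J x :=
      hJ.continuousAt.eventually_lt_const (by nlinarith [hJ0 x])
    have e3 : ∀ᶠ y in 𝓝 x, J x < c * J y :=
      (show Continuous fun y => c * J y from continuous_const.mul hJ).continuousAt
        |>.eventually_const_lt (by nlinarith [hJ0 x])
    refine ⟨O₁ ∩ ({y | J y < c * J x} ∩ {y | J x < c * J y}),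
      inter_mem hO₁ (inter_mem e2 e3), fun A hAO hA => ?_⟩
    -- On `A` the map `G` and its linearization `D` distort distances by at most `c` relative to
    -- each other.
    have hup : ∀ a ∈ A, ∀ b ∈ A, edist (G a) (G b) ≤ c * edist (D a) (D b) := by
      intro a ha b hb
      rw [edist_nndist, edist_nndist, ← ENNReal.coe_mul, ENNReal.coe_le_coe, ← NNReal.coe_le_coe,
        NNReal.coe_mul, coe_nndist, coe_nndist, dist_eq_norm, dist_eq_norm, ← map_sub]
      have h := h₁ a (hAO ha).1 b (hAO hb).1
      have h2 := norm_sub_norm_le (G a - G b) (D (a - b))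
      have h3 := hDexp (a - b)
      nlinarith [norm_nonneg (D (a - b))]
    have hlow : ∀ a ∈ A, ∀ b ∈ A, edist (D a) (D b) ≤ c * edist (G a) (G b) := by
      intro a ha b hb
      rw [edist_nndist, edist_nndist, ← ENNReal.coe_mul, ENNReal.coe_le_coe, ← NNReal.coe_le_coe,
        NNReal.coe_mul, coe_nndist, coe_nndist, dist_eq_norm, dist_eq_norm, ← map_sub]
      have h := h₁ a (hAO ha).1 b (hAO hb).1
      have h2 := norm_sub_norm_le (D (a - b)) (G a - G b)
      rw [norm_sub_rev (D (a - b))] at h2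
      have h3 := hDexp (a - b)
      have h4 : (1 - η) * ‖D (a - b)‖ ≤ ‖G a - G b‖ := by nlinarith
      calc ‖D (a - b)‖ = c * ((1 - η) * ‖D (a - b)‖) := by rw [← mul_assoc, hη2, one_mul]
        _ ≤ _ := by gcongr
    have hD : μHE[d] (D '' A) = ENNReal.ofReal (J x) * volume A := by
      rw [← hdet x]
      exact (D : U →ₗ[ℝ] V).euclideanHausdorffMeasure_image_eq_normDet_mul_volume A
    have hμ₁ : μ₁ A = μHE[d] (G '' A) := hemb.comap_apply _ _
    have hofc : ENNReal.ofReal (c : ℝ) = c := ENNReal.ofReal_coe_nnreal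
    have hμ₂ : μ₂ A ≤ c * (ENNReal.ofReal (J x) * volume A) := by
      rw [withDensity_apply _ hA, ← mul_assoc, ← hofc, ← ENNReal.ofReal_mul (by positivity),
        ← setLIntegral_const]
      exact setLIntegral_mono' hA fun y hy => ENNReal.ofReal_le_ofReal (hAO hy).2.1.le
    have hμ₂' : ENNReal.ofReal (J x) * volume A ≤ c * μ₂ A := by
      rw [withDensity_apply _ hA, ← lintegral_const_mul _ (by fun_prop), ← setLIntegral_const]
      refine setLIntegral_mono' hA fun y hy => ?_
      rw [← hofc, ← ENNReal.ofReal_mul (by positivity)]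
      exact ENNReal.ofReal_le_ofReal (hAO hy).2.2.le
    constructor
    · rw [hμ₁]
      refine (euclideanHausdorffMeasure_image_le_of_edist_le hup d).trans ?_
      rw [hD, pow_succ, mul_assoc]
      gcongr
    · refine hμ₂.trans ?_
      rw [← hD, hμ₁, pow_succ, mul_comm ((c : ENNReal) ^ d), mul_assoc]
      gcongr
      exact euclideanHausdorffMeasure_image_le_of_edist_le hlow d
  -- The local comparison holds for every `c > 1`, and `c → 1`.
  have hle : ∀ (a b : ENNReal), (∀ c : ℝ≥0, 1 < c → a ≤ (c : ENNReal) ^ (d + 1) * b) → a ≤ b := by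
    intro a b h
    have hcont : Continuous fun c : ℝ≥0 => (c : ENNReal) ^ (d + 1) := by fun_prop
    have h1 : Tendsto (fun c : ℝ≥0 => (c : ENNReal) ^ (d + 1) * b) (𝓝[>] 1) (𝓝 b) := by
      have := (ENNReal.Tendsto.mul_const (b := b) (hcont.tendsto 1) (by simp)).mono_left
        (nhdsWithin_le_nhds (s := Ioi 1))
      simpa using this
    exact ge_of_tendsto h1 (by filter_upwards [self_mem_nhdsWithin] with c hc using h c hc)
  ext A hA
  refine le_antisymm (hle _ _ fun c hc => Measure.le_smul_of_locally (fun x => ?_) hA)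
    (hle _ _ fun c hc => Measure.le_smul_of_locally (fun x => ?_) hA)
  · obtain ⟨O, hO, h⟩ := hloc c hc x
    exact ⟨O, hO, fun B hB hBm => (h B hB hBm).1⟩
  · obtain ⟨O, hO, h⟩ := hloc c hc x
    exact ⟨O, hO, fun B hB hBm => (h B hB hBm).2⟩

end Area

section GraphArea
variable {N : ℕ} {e : RN N} {φ : (ℝ ∙ e)ᗮ → ℝ}

/-- The parametrization of the graph of `φ` over the hyperplane orthogonal to `e`. -/
def graphMap (e : RN N) (φ : (ℝ ∙ e)ᗮ → ℝ) (x' : (ℝ ∙ e)ᗮ) : RN N := (x' : RN N) + φ x' • e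

lemma hasFDerivAt_graphMap (hφ : ContDiff ℝ 1 φ) (x' : (ℝ ∙ e)ᗮ) :
    HasFDerivAt (graphMap e φ) ((ℝ ∙ e)ᗮ.subtypeL + (fderiv ℝ φ x').smulRight e) x' :=
  ((ℝ ∙ e)ᗮ.subtypeL.hasFDerivAt).add
    ((hφ.differentiable one_ne_zero x').hasFDerivAt.smul_const e)

lemma contDiff_graphMap (hφ : ContDiff ℝ 1 φ) : ContDiff ℝ 1 (graphMap e φ) :=
  ((ℝ ∙ e)ᗮ.subtypeL.contDiff).add (hφ.smul contDiff_const)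

lemma norm_sub_le_norm_graphMap_sub (a b : (ℝ ∙ e)ᗮ) :
    ‖a - b‖ ≤ ‖graphMap e φ a - graphMap e φ b‖ := by
  have := norm_proj_le (e := e) (graphMap e φ a - graphMap e φ b)
  rwa [map_sub, graphMap, graphMap, proj_add_smul, proj_add_smul] at this

lemma isClosedEmbedding_graphMap (hφ : Continuous φ) : IsClosedEmbedding (graphMap e φ) := by
  have hc : Continuous (graphMap e φ) := by unfold graphMap; fun_prop
  exact Function.LeftInverse.isClosedEmbedding (f := (ℝ ∙ e)ᗮ.orthogonalProjectionOnto)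
    (fun x' => proj_add_smul x' _) (by fun_prop) hc

lemma normSq_graphNormal (he : ‖e‖ = 1) (x' : (ℝ ∙ e)ᗮ) :
    ‖graphNormal e φ x'‖ ^ 2 = 1 + ‖gradient φ x'‖ ^ 2 := by
  rw [graphNormal, ← real_inner_self_eq_norm_sq, inner_sub_left, inner_sub_right, inner_sub_right,
    real_inner_comm, inner_hyperplane, real_inner_self_eq_norm_sq, real_inner_self_eq_norm_sq, he,
    real_inner_comm, inner_hyperplane, Submodule.coe_norm]
  ring

/-- By the matrix determinant lemma, the Jacobian of a graph is `√(1 + |∇φ|²)`, the norm of the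
non-normalized normal. -/
lemma normDet_fderiv_graphMap (he : ‖e‖ = 1) (hφ : ContDiff ℝ 1 φ) (x' : (ℝ ∙ e)ᗮ) :
    (fderiv ℝ (graphMap e φ) x' : (ℝ ∙ e)ᗮ →ₗ[ℝ] RN N).normDet = ‖graphNormal e φ x'‖ := by
  rw [← sq_eq_sq₀ (LinearMap.normDet_nonneg _) (norm_nonneg _), normSq_graphNormal he]
  set b := stdOrthonormalBasis ℝ (ℝ ∙ e)ᗮ
  set g := gradient φ x'
  have h := LinearMap.normDet_sq_eq_det_gram (fderiv ℝ (graphMap e φ) x' : (ℝ ∙ e)ᗮ →ₗ[ℝ] RN N) b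
  have hval : ∀ z : (ℝ ∙ e)ᗮ, fderiv ℝ (graphMap e φ) x' z = (z : RN N) + (inner ℝ g z : ℝ) • e := by
    intro z
    rw [(hasFDerivAt_graphMap hφ x').fderiv]
    simp [g, gradient, InnerProductSpace.toDual_symm_apply]
  have hgram : Matrix.gram ℝ (fun i => (fderiv ℝ (graphMap e φ) x' : (ℝ ∙ e)ᗮ →ₗ[ℝ] RN N) (b i)) =
      1 + Matrix.replicateCol Unit (fun i => inner ℝ g (b i)) *
        Matrix.replicateRow Unit (fun i => inner ℝ g (b i)) := by
    ext i j
    rw [Matrix.gram_apply, ContinuousLinearMap.coe_coe, hval, hval, Matrix.add_apply,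
      Matrix.mul_apply]
    simp only [inner_add_left, inner_add_right, real_inner_smul_left, real_inner_smul_right,
      inner_hyperplane, real_inner_self_eq_norm_sq, he]
    have h1 := orthonormal_iff_ite.1 b.orthonormal i j
    rw [Submodule.coe_inner] at h1
    have h2 : inner ℝ ((b i : (ℝ ∙ e)ᗮ) : RN N) e = 0 := by rw [real_inner_comm, inner_hyperplane]
    rw [h1, h2, Matrix.one_apply]
    rw [Finset.univ_unique, Finset.sum_singleton, Matrix.replicateCol_apply,
      Matrix.replicateRow_apply]
    ring
  simp only [RCLike.ofReal_real_eq_id, id_eq] at h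
  rw [h, hgram, Matrix.det_one_add_replicateCol_mul_replicateRow]
  congr 1
  rw [← b.sum_sq_norm_inner_left g]
  simp [dotProduct, sq]

lemma finrank_hyperplane (he : ‖e‖ = 1) : Module.finrank ℝ (ℝ ∙ e)ᗮ = N - 1 := by
  have h1 := (ℝ ∙ e).finrank_add_finrank_orthogonal
  rw [finrank_span_singleton (by rintro rfl; simp at he), finrank_euclideanSpace,
    Fintype.card_fin] at h1
  omega

/-- The surface measure of a graph, in the coordinates of the hyperplane. -/
lemma map_withDensity_graphMap (he : ‖e‖ = 1) (hφ : ContDiff ℝ 1 φ) :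
    (volume.withDensity fun x' => ENNReal.ofReal ‖graphNormal e φ x'‖).map (graphMap e φ) =
      (μHE[N - 1] : Measure (RN N)).restrict (range (graphMap e φ)) := by
  have hemb := (isClosedEmbedding_graphMap hφ.continuous).measurableEmbedding
  rw [← comap_euclideanHausdorffMeasure_eq_withDensity (contDiff_graphMap hφ)
    norm_sub_le_norm_graphMap_sub hemb (continuous_graphNormal hφ).norm
    (fun x => by linarith [one_le_norm_graphNormal he φ x]) (normDet_fderiv_graphMap he hφ),
    hemb.map_comap, finrank_hyperplane he]

end GraphArea

section FrontierMeasure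
variable {N : ℕ} {x₀ e : RN N} {r : ℝ} {φ : (ℝ ∙ e)ᗮ → ℝ} {K : ℝ≥0} {Ω : Set (RN N)}

lemma GraphChart.frontier_inter_ball_eq (h : GraphChart Ω x₀ r e φ K) (hΩ : IsOpen Ω) :
    frontier Ω ∩ Metric.ball x₀ r = range (graphMap e φ) ∩ Metric.ball x₀ r := by
  rw [h.frontier_inter_ball hΩ, image_univ]
  rfl

/-- Surface integrals in a chart, for integrands that vanish outside its ball. -/
lemma GraphChart.setIntegral_frontier (h : GraphChart Ω x₀ r e φ K) (hΩ : IsOpen Ω)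
    {f : RN N → ℝ} (hf : ∀ x ∉ Metric.ball x₀ r, f x = 0) :
    ∫ x in frontier Ω, f x ∂μHE[N - 1] =
      ∫ x', ‖graphNormal e φ x'‖ * f (graphMap e φ x') := by
  have hemb := (isClosedEmbedding_graphMap (e := e) h.contDiff.continuous).measurableEmbedding
  have hm := (continuous_graphNormal h.contDiff).norm.measurable
  have e1 : ∀ (M : Measure (RN N)) (s : Set (RN N)), MeasurableSet s →
      ∫ x in s, f x ∂M = ∫ x in s ∩ Metric.ball x₀ r, f x ∂M := fun M s hs =>
    setIntegral_eq_of_subset_of_forall_sdiff_eq_zero hs inter_subset_left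
      fun x hx => hf x fun hb => hx.2 ⟨hx.1, hb⟩
  rw [e1 _ _ isClosed_frontier.measurableSet, h.frontier_inter_ball_eq hΩ,
    ← e1 _ _ hemb.measurableSet_range,
    ← map_withDensity_graphMap h.norm_e h.contDiff, hemb.integral_map,
    integral_withDensity_eq_integral_toReal_smul (by fun_prop) (by simp)]
  simp

lemma IsBoundedC11Domain.euclideanHausdorffMeasure_frontier_lt_top (hΩ : IsBoundedC11Domain Ω) :
    (μHE[N - 1] : Measure (RN N)) (frontier Ω) < ⊤ := by
  refine hΩ.isCompact_frontier.measure_lt_top_of_nhdsWithin fun x hx => ?_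
  obtain ⟨r, e, φ, K, h⟩ := hΩ.exists_chart hx
  have hemb := isClosedEmbedding_graphMap (e := e) h.contDiff.continuous
  refine ⟨frontier Ω ∩ Metric.closedBall x (r / 2),
    inter_mem self_mem_nhdsWithin (mem_nhdsWithin_of_mem_nhds
      (Metric.closedBall_mem_nhds x (by linarith [h.pos]))), ?_⟩
  have hsub : frontier Ω ∩ Metric.closedBall x (r / 2) ⊆
      Metric.closedBall x (r / 2) ∩ range (graphMap e φ) := by
    rintro y ⟨hy1, hy2⟩
    have : y ∈ frontier Ω ∩ Metric.ball x r :=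
      ⟨hy1, Metric.closedBall_subset_ball (by linarith [h.pos]) hy2⟩
    rw [h.frontier_inter_ball_eq hΩ.isOpen] at this
    exact ⟨hy2, this.1⟩
  refine (measure_mono hsub).trans_lt ?_
  rw [← Measure.restrict_apply Metric.isClosed_closedBall.measurableSet,
    ← map_withDensity_graphMap h.norm_e h.contDiff, hemb.measurableEmbedding.map_apply]
  have hc : IsCompact (graphMap e φ ⁻¹' Metric.closedBall x (r / 2)) :=
    hemb.isCompact_preimage (isCompact_closedBall x _)
  rw [withDensity_apply _ hc.measurableSet]
  have hcn := (continuous_graphNormal h.contDiff).norm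
  exact (hcn.continuousOn.integrableOn_compact hc).lintegral_lt_top

end FrontierMeasure

/-! ### Integration by parts with a cut-off at the boundary -/

section CompactSupport
variable {N : ℕ}

/-- A function that vanishes off a compact set, and is continuous at its points as a function on the
whole space, is continuous with compact support. -/
lemma continuous_and_hasCompactSupport {E F : Type*} [TopologicalSpace E] [T2Space E]
    [TopologicalSpace F] [Zero F] {S : Set E} {f : E → F} (hS : IsCompact S)
    (h0 : ∀ x ∉ S, f x = 0) (hf : ∀ x ∈ S, ContinuousAt f x) :
    Continuous f ∧ HasCompactSupport f := by
  refine ⟨continuous_iff_continuousAt.2 fun x => ?_, HasCompactSupport.intro hS fun {x} hx => h0 x hx⟩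
  by_cases hx : x ∈ S
  · exact hf x hx
  · have : f =ᶠ[𝓝 x] fun _ => 0 := by
      filter_upwards [hS.isClosed.isOpen_compl.mem_nhds hx] with y hy using h0 y hy
    exact continuousAt_const.congr this.symm

lemma continuousAt_fderiv_of_contDiffAt {W : RN N → RN N} {x : RN N} (h : ContDiffAt ℝ 1 W x) :
    ContinuousAt (fderiv ℝ W) x :=
  (h.fderiv_right (m := 0) (by norm_num)).continuousAt

lemma continuousAt_divergence {W : RN N → RN N} {x : RN N} (h : ContDiffAt ℝ 1 W x) :
    ContinuousAt (divergence W) x := by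
  have h1 := continuousAt_fderiv_of_contDiffAt h
  unfold divergence
  refine tendsto_finsetSum _ fun i _ => ?_
  have : ContinuousAt (fun y => fderiv ℝ W y (EuclideanSpace.single i 1)) x :=
    h1.clm_apply continuousAt_const
  exact (EuclideanSpace.proj (𝕜 := ℝ) i).continuous.continuousAt.comp this

lemma inner_gradient {f : RN N → ℝ} (x z : RN N) : inner ℝ z (gradient f x) = fderiv ℝ f x z := by
  rw [gradient, real_inner_comm, InnerProductSpace.toDual_symm_apply]

/-- Integration by parts against a compactly supported function, for a vector field that is only
differentiable on its support. -/
lemma integral_fderiv_apply_eq_neg {ψ : RN N → ℝ} (hψ : ContDiff ℝ 1 ψ) (hc : HasCompactSupport ψ)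
    {W : RN N → RN N} (hW : ∀ x ∈ tsupport ψ, ContDiffAt ℝ 1 W x) :
    ∫ x, fderiv ℝ ψ x (W x) = -∫ x, ψ x * divergence W x := by
  have h0 : ∀ x ∉ tsupport ψ, ψ x = 0 := fun x hx => image_eq_zero_of_notMem_tsupport hx
  have h0' : ∀ x ∉ tsupport ψ, fderiv ℝ ψ x = 0 := fun x hx =>
    image_eq_zero_of_notMem_tsupport fun h => hx (tsupport_fderiv_subset ℝ h)
  have hψ' : Continuous (fderiv ℝ ψ) := hψ.continuous_fderiv one_ne_zero
  set b : Fin N → RN N := fun i => EuclideanSpace.single i 1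
  have hWi : ∀ i, ∀ x ∈ tsupport ψ, ContDiffAt ℝ 1 (fun y => W y i) x := fun i x hx =>
    (EuclideanSpace.proj (𝕜 := ℝ) i).contDiff.contDiffAt.comp x (hW x hx)
  have i1 : ∀ i, Integrable fun x => W x i * fderiv ℝ ψ x (b i) := fun i => by
    have := continuous_and_hasCompactSupport (f := fun x => W x i * fderiv ℝ ψ x (b i)) hc
      (fun x hx => by rw [h0' x hx]; simp) (fun x hx => (hWi i x hx).continuousAt.mul
        (hψ'.clm_apply continuous_const).continuousAt)
    exact this.1.integrable_of_hasCompactSupport this.2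
  have i2 : ∀ i, Integrable fun x => fderiv ℝ (fun y => W y i) x (b i) * ψ x := fun i => by
    have := continuous_and_hasCompactSupport
      (f := fun x => fderiv ℝ (fun y => W y i) x (b i) * ψ x) hc
      (fun x hx => by rw [h0 x hx, mul_zero]) (fun x hx =>
        (((hWi i x hx).fderiv_right (m := 0) (by norm_num)).continuousAt.clm_apply
          continuousAt_const).mul hψ.continuous.continuousAt)
    exact this.1.integrable_of_hasCompactSupport this.2
  have i3 : ∀ i, Integrable fun x => W x i * ψ x := fun i => by
    have := continuous_and_hasCompactSupport (f := fun x => W x i * ψ x) hc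
      (fun x hx => by rw [h0 x hx, mul_zero]) (fun x hx =>
        (hWi i x hx).continuousAt.mul hψ.continuous.continuousAt)
    exact this.1.integrable_of_hasCompactSupport this.2
  have key : ∀ i, ∫ x, W x i * fderiv ℝ ψ x (b i) =
      -∫ x, fderiv ℝ (fun y => W y i) x (b i) * ψ x := fun i =>
    integral_mul_fderiv_eq_neg_fderiv_mul_of_integrable (i2 i) (i1 i) (i3 i)
      (fun x hx => (hWi i x hx).differentiableAt one_ne_zero)
      (fun x _ => hψ.differentiable one_ne_zero x)
  have e1 : ∀ x, fderiv ℝ ψ x (W x) = ∑ i, W x i * fderiv ℝ ψ x (b i) := by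
    intro x
    have : W x = ∑ i, W x i • b i := by
      ext j; simp [b, Finset.sum_apply, Pi.single_apply]
    conv_lhs => rw [this]
    simp [map_sum]
  have e2 : ∀ x, ψ x * divergence W x = ∑ i, fderiv ℝ (fun y => W y i) x (b i) * ψ x := by
    intro x
    by_cases hx : x ∈ tsupport ψ
    · rw [divergence, Finset.mul_sum]
      refine Finset.sum_congr rfl fun i _ => ?_
      have : HasFDerivAt (fun y => W y i) ((EuclideanSpace.proj (𝕜 := ℝ) i).comp (fderiv ℝ W x)) x :=
        (EuclideanSpace.proj (𝕜 := ℝ) i).hasFDerivAt.comp x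
          ((hW x hx).differentiableAt one_ne_zero).hasFDerivAt
      rw [this.fderiv, mul_comm]
      rfl
    · simp [h0 x hx]
  simp_rw [e1, e2]
  rw [integral_finsetSum _ fun i _ => i1 i, integral_finsetSum _ fun i _ => i2 i,
    ← Finset.sum_neg_distrib]
  exact Finset.sum_congr rfl fun i _ => key i

end CompactSupport

/-- A smooth transition from `0` on `(-∞, 1/2]` to `1` on `[1, ∞)`. -/
def boundaryCutoff (s : ℝ) : ℝ := Real.smoothTransition (2 * s - 1)

section Cutoff

lemma contDiff_boundaryCutoff : ContDiff ℝ 1 boundaryCutoff :=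
  Real.smoothTransition.contDiff.comp (by fun_prop)

lemma boundaryCutoff_eq_zero {s : ℝ} (hs : s ≤ 1 / 2) : boundaryCutoff s = 0 :=
  Real.smoothTransition.zero_of_nonpos (by linarith)

lemma boundaryCutoff_eq_one {s : ℝ} (hs : 1 ≤ s) : boundaryCutoff s = 1 :=
  Real.smoothTransition.one_of_one_le (by linarith)

lemma boundaryCutoff_nonneg (s : ℝ) : 0 ≤ boundaryCutoff s := Real.smoothTransition.nonneg _

lemma boundaryCutoff_le_one (s : ℝ) : boundaryCutoff s ≤ 1 := Real.smoothTransition.le_one _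

lemma continuous_deriv_boundaryCutoff : Continuous (deriv boundaryCutoff) :=
  contDiff_boundaryCutoff.continuous_deriv le_rfl

lemma deriv_boundaryCutoff_nonneg (s : ℝ) : 0 ≤ deriv boundaryCutoff s :=
  Monotone.deriv_nonneg (Real.smoothTransition.monotone.comp fun a b h => by linarith)

lemma deriv_boundaryCutoff_eq_zero {s : ℝ} (hs : s ∉ Icc (1 / 2) 1) : deriv boundaryCutoff s = 0 := by
  rw [mem_Icc, not_and_or, not_le, not_le] at hs
  rcases hs with hs | hs
  · have : boundaryCutoff =ᶠ[𝓝 s] fun _ => 0 := by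
      filter_upwards [Iio_mem_nhds hs] with t ht using boundaryCutoff_eq_zero (le_of_lt ht)
    rw [this.deriv_eq, deriv_const]
  · have : boundaryCutoff =ᶠ[𝓝 s] fun _ => 1 := by
      filter_upwards [Ioi_mem_nhds hs] with t ht using boundaryCutoff_eq_one (le_of_lt ht)
    rw [this.deriv_eq, deriv_const]

lemma integral_deriv_boundaryCutoff : ∫ s, deriv boundaryCutoff s = 1 := by
  have h1 : ∫ s in (0 : ℝ)..1, deriv boundaryCutoff s = 1 := by
    rw [intervalIntegral.integral_deriv_eq_sub
      (fun s _ => contDiff_boundaryCutoff.differentiable one_ne_zero s)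
      (continuous_deriv_boundaryCutoff.intervalIntegrable _ _), boundaryCutoff_eq_one le_rfl,
      boundaryCutoff_eq_zero (by norm_num), sub_zero]
  rw [← h1, intervalIntegral.integral_of_le zero_le_one]
  refine (setIntegral_eq_integral_of_forall_compl_eq_zero fun s hs => ?_).symm
  refine deriv_boundaryCutoff_eq_zero fun h => hs ⟨by linarith [h.1], h.2⟩

lemma hasCompactSupport_deriv_boundaryCutoff : HasCompactSupport (deriv boundaryCutoff) :=
  HasCompactSupport.intro isCompact_Icc fun {_} hs => deriv_boundaryCutoff_eq_zero hs

end Cutoff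

section Chart
variable {N : ℕ} {x₀ e : RN N} {r : ℝ} {φ : (ℝ ∙ e)ᗮ → ℝ} {K : ℝ≥0} {Ω : Set (RN N)}

/-- The vertical height over the graph of `φ`. -/
def graphHeight (e : RN N) (φ : (ℝ ∙ e)ᗮ → ℝ) (x : RN N) : ℝ :=
  inner ℝ e x - φ ((ℝ ∙ e)ᗮ.orthogonalProjectionOnto x)

lemma contDiff_graphHeight (hφ : ContDiff ℝ 1 φ) : ContDiff ℝ 1 (graphHeight e φ) :=
  ((innerSL ℝ e).contDiff).sub (hφ.comp (ContinuousLinearMap.contDiff _))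

lemma fderiv_graphHeight (hφ : ContDiff ℝ 1 φ) (x z : RN N) :
    fderiv ℝ (graphHeight e φ) x z =
      inner ℝ z (graphNormal e φ ((ℝ ∙ e)ᗮ.orthogonalProjectionOnto x)) := by
  have h1 : HasFDerivAt (fun y : RN N => (inner ℝ e y : ℝ)) (innerSL ℝ e) x :=
    (innerSL ℝ e).hasFDerivAt
  have h2 := (hφ.differentiable one_ne_zero ((ℝ ∙ e)ᗮ.orthogonalProjectionOnto x)).hasFDerivAt.comp x
    ((ℝ ∙ e)ᗮ.orthogonalProjectionOnto.hasFDerivAt)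
  have h3 : HasFDerivAt (graphHeight e φ) _ x := h1.sub h2
  rw [h3.fderiv, inner_graphNormal]
  simp

lemma graphHeight_graphMap_add (he : ‖e‖ = 1) (x' : (ℝ ∙ e)ᗮ) (t : ℝ) :
    graphHeight e φ (graphMap e φ x' + t • e) = t := by
  rw [graphHeight, graphMap, add_assoc, ← add_smul, inner_add_smul he, proj_add_smul]
  ring

lemma proj_graphMap_add (x' : (ℝ ∙ e)ᗮ) (t : ℝ) :
    (ℝ ∙ e)ᗮ.orthogonalProjectionOnto (graphMap e φ x' + t • e) = x' := by
  rw [graphMap, add_assoc, ← add_smul, proj_add_smul]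

lemma GraphChart.notMem_closure (h : GraphChart Ω x₀ r e φ K) (hΩ : IsOpen Ω) {x : RN N}
    (hx : x ∈ Metric.ball x₀ r) (hpos : 0 < graphHeight e φ x) : x ∉ closure Ω := by
  rw [closure_eq_self_union_frontier, mem_union, not_or]
  refine ⟨fun hm => ?_, fun hm => ?_⟩
  · have := (h.mem_iff x hx).1 hm
    unfold graphHeight at hpos; linarith
  · have := h.inner_eq_of_mem_frontier hΩ hm hx
    unfold graphHeight at hpos; linarith

lemma GraphChart.graphMap_mem_frontier (h : GraphChart Ω x₀ r e φ K) (hΩ : IsOpen Ω) {x' : (ℝ ∙ e)ᗮ}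
    (hx : graphMap e φ x' ∈ Metric.ball x₀ r) : graphMap e φ x' ∈ frontier Ω :=
  h.mem_frontier_of_inner_eq hΩ hx (by rw [graphMap, inner_add_smul h.norm_e, proj_add_smul])

lemma integrable_comp_graph (he : ‖e‖ = 1) (hφ : Continuous φ) {f : RN N → ℝ}
    (hf : Continuous f) (hc : HasCompactSupport f) {ε : ℝ} (hε : 0 < ε) :
    Integrable fun q : (ℝ ∙ e)ᗮ × ℝ => f (graphMap e φ q.1 + (ε * q.2) • e) := by
  set Φ := graphHomeomorph he φ hφ
  have hΦ : ∀ q, Φ q = graphMap e φ q.1 + q.2 • e := fun q => by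
    change (q.1 : RN N) + (φ q.1 + q.2) • e = _
    rw [graphMap, add_smul, add_assoc]
  have := (hf.comp (Φ.continuous.comp (show Continuous fun q : (ℝ ∙ e)ᗮ × ℝ => (q.1, ε * q.2) by
    fun_prop))).integrable_of_hasCompactSupport (μ := volume)
      ((hc.comp_homeomorph Φ).comp_homeomorph
        ((Homeomorph.refl _).prodCongr (Homeomorph.mulLeft₀ ε hε.ne')))
  refine this.congr (Eventually.of_forall fun q => ?_)
  simp only [Function.comp_apply, hΦ]

/-- Integration in the coordinates of a graph, rescaled by `ε` in the vertical direction. -/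
lemma integral_eq_smul_integral_graph (he : ‖e‖ = 1) (hφ : Continuous φ) {f : RN N → ℝ}
    (hf : Continuous f) (hc : HasCompactSupport f) {ε : ℝ} (hε : 0 < ε) :
    ∫ x, f x = ε * ∫ q : (ℝ ∙ e)ᗮ × ℝ, f (graphMap e φ q.1 + (ε * q.2) • e) := by
  set Φ := graphHomeomorph he φ hφ
  have hΦ : ∀ q, Φ q = graphMap e φ q.1 + q.2 • e := fun q => by
    change (q.1 : RN N) + (φ q.1 + q.2) • e = _
    rw [graphMap, add_smul, add_assoc]
  have i1 : Integrable fun q => f (Φ q) :=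
    (hf.comp Φ.continuous).integrable_of_hasCompactSupport (hc.comp_homeomorph Φ)
  have e0 : (fun q : (ℝ ∙ e)ᗮ × ℝ => f (graphMap e φ q.1 + (ε * q.2) • e)) =
      fun q => f (Φ (q.1, ε * q.2)) := by ext q; rw [hΦ]
  have i2 := integrable_comp_graph he hφ hf hc hε
  rw [e0] at i2
  rw [e0, ← (measurePreserving_graphHomeomorph he φ hφ).integral_comp Φ.measurableEmbedding f]
  rw [Measure.volume_eq_prod] at i1 i2 ⊢
  rw [integral_prod _ i1, integral_prod _ i2, ← integral_const_mul]
  congr with x'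
  have := Measure.integral_comp_mul_left (fun t => f (Φ (x', t))) ε
  rw [this, abs_of_pos (inv_pos.2 hε), smul_eq_mul, ← mul_assoc, mul_inv_cancel₀ hε.ne', one_mul]

/-- The flux density of `W` through the level sets of the cut-off height is continuous: the cut-off
keeps away from the boundary. -/
lemma GraphChart.continuous_cutoffFlux (h : GraphChart Ω x₀ r e φ K) (hΩ : IsOpen Ω)
    {ψ : RN N → ℝ} (hψ : Continuous ψ) (hc : HasCompactSupport ψ)
    (hs : tsupport ψ ⊆ Metric.ball x₀ r) {W : RN N → RN N}
    (hW : ∀ x ∉ closure Ω, ContinuousAt W x) {ε : ℝ} (hε : 0 < ε) :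
    Continuous (fun x => ψ x * (deriv boundaryCutoff (graphHeight e φ x / ε) *
      inner ℝ (W x) (graphNormal e φ ((ℝ ∙ e)ᗮ.orthogonalProjectionOnto x)))) ∧
    HasCompactSupport (fun x => ψ x * (deriv boundaryCutoff (graphHeight e φ x / ε) *
      inner ℝ (W x) (graphNormal e φ ((ℝ ∙ e)ᗮ.orthogonalProjectionOnto x)))) := by
  have hφ := h.contDiff
  have hhC := contDiff_graphHeight (e := e) hφ
  have hScl : IsClosed {x | ε / 2 ≤ graphHeight e φ x} :=
    isClosed_le continuous_const hhC.continuous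
  refine continuous_and_hasCompactSupport (hc.isCompact.inter_right hScl) (fun x hx => ?_)
    fun x hx => ?_
  · rw [mem_inter_iff, not_and_or] at hx
    rcases hx with hx | hx
    · rw [image_eq_zero_of_notMem_tsupport hx, zero_mul]
    · rw [deriv_boundaryCutoff_eq_zero fun hm => hx ?_, zero_mul, mul_zero]
      have := hm.1
      rw [le_div_iff₀ hε] at this
      change ε / 2 ≤ _
      linarith
  · have c1 := continuous_deriv_boundaryCutoff.comp (hhC.continuous.div_const ε)
    have c2 : Continuous fun x : RN N => graphNormal e φ ((ℝ ∙ e)ᗮ.orthogonalProjectionOnto x) :=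
      (continuous_graphNormal hφ).comp (by fun_prop)
    have c3 := hW x (h.notMem_closure hΩ (hs hx.1) (by have : ε / 2 ≤ _ := hx.2; linarith))
    exact hψ.continuousAt.mul (c1.continuousAt.mul (c3.inner c2.continuousAt))

/-- The divergence theorem for a vector field over the exterior of `Ω`, cut off near the graph at
the scale `ε`. The derivative of the cut-off has size `1/ε` on a layer of width `ε`; in graph
coordinates stretched by `1/ε` it becomes an average of the flux through the parallel surfaces at
heights `ε s`, `1/2 ≤ s ≤ 1`. -/
lemma GraphChart.integral_cutoff (h : GraphChart Ω x₀ r e φ K) (hΩ : IsOpen Ω) {ψ : RN N → ℝ}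
    (hψ : ContDiff ℝ 1 ψ) (hc : HasCompactSupport ψ) (hs : tsupport ψ ⊆ Metric.ball x₀ r)
    {W : RN N → RN N} (hW : ∀ x ∉ closure Ω, ContDiffAt ℝ 1 W x) {ε : ℝ} (hε : 0 < ε) :
    (∫ x, boundaryCutoff (graphHeight e φ x / ε) * fderiv ℝ ψ x (W x)) +
      (∫ q : (ℝ ∙ e)ᗮ × ℝ, ψ (graphMap e φ q.1 + (ε * q.2) • e) * (deriv boundaryCutoff q.2 *
        inner ℝ (W (graphMap e φ q.1 + (ε * q.2) • e)) (graphNormal e φ q.1))) =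
      -∫ x, boundaryCutoff (graphHeight e φ x / ε) * (ψ x * divergence W x) := by
  have he := h.norm_e
  have hφ := h.contDiff
  set χ : RN N → ℝ := fun x => boundaryCutoff (graphHeight e φ x / ε) with hχdef
  have hhC := contDiff_graphHeight (e := e) hφ
  have hχ : ContDiff ℝ 1 χ := contDiff_boundaryCutoff.comp (hhC.div_const ε)
  set S := tsupport ψ ∩ {x | ε / 2 ≤ graphHeight e φ x} with hSdef
  have hScl : IsClosed {x | ε / 2 ≤ graphHeight e φ x} :=
    isClosed_le continuous_const hhC.continuous
  have hS : IsCompact S := hc.isCompact.inter_right hScl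
  have hSW : ∀ x ∈ S, ContDiffAt ℝ 1 W x := fun x hx =>
    hW x (h.notMem_closure hΩ (hs hx.1) (by have : ε / 2 ≤ _ := hx.2; linarith))
  have hψ0 : ∀ x ∉ tsupport ψ, ψ x = 0 := fun x hx => image_eq_zero_of_notMem_tsupport hx
  have hψ0' : ∀ x ∉ tsupport ψ, fderiv ℝ ψ x = 0 := fun x hx =>
    image_eq_zero_of_notMem_tsupport fun h => hx (tsupport_fderiv_subset ℝ h)
  have hχ0 : ∀ x, ¬ ε / 2 ≤ graphHeight e φ x → χ x = 0 := fun x hx =>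
    boundaryCutoff_eq_zero (by rw [div_le_iff₀ hε]; linarith)
  have hψ' : Continuous (fderiv ℝ ψ) := hψ.continuous_fderiv one_ne_zero
  have hsupp : tsupport (fun x => χ x * ψ x) ⊆ S := by
    refine closure_minimal (fun x hx => ?_) hS.isClosed
    have hx' : χ x * ψ x ≠ 0 := hx
    exact ⟨subset_closure (right_ne_zero_of_mul hx'), not_not.1 fun hn =>
      left_ne_zero_of_mul hx' (hχ0 x hn)⟩
  have hcs : HasCompactSupport fun x => χ x * ψ x :=
    hS.of_isClosed_subset (isClosed_tsupport _) hsupp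
  have hibp := integral_fderiv_apply_eq_neg (hχ.mul hψ) hcs (W := W)
    (fun x hx => hSW x (hsupp hx))
  set F : RN N → ℝ := fun x => ψ x * (deriv boundaryCutoff (graphHeight e φ x / ε) *
    inner ℝ (W x) (graphNormal e φ ((ℝ ∙ e)ᗮ.orthogonalProjectionOnto x))) with hFdef
  have hFc := h.continuous_cutoffFlux hΩ hψ.continuous hc hs (fun x hx => (hW x hx).continuousAt) hε
  have hAc := continuous_and_hasCompactSupport (f := fun x => χ x * fderiv ℝ ψ x (W x)) hS
    (fun x hx => by
      rw [hSdef, mem_inter_iff, not_and_or] at hx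
      rcases hx with hx | hx
      · simp [hψ0' x hx]
      · simp only [hχ0 x hx, zero_mul]) (fun x hx =>
      hχ.continuous.continuousAt.mul (hψ'.continuousAt.clm_apply (hSW x hx).continuousAt))
  have hder : ∀ x, fderiv ℝ (fun x => χ x * ψ x) x (W x) =
      χ x * fderiv ℝ ψ x (W x) + ε⁻¹ * F x := by
    intro x
    have d1 : HasFDerivAt χ (deriv boundaryCutoff (graphHeight e φ x / ε) •
        (ε⁻¹ • fderiv ℝ (graphHeight e φ) x)) x := by
      have := (hhC.differentiable one_ne_zero x).hasFDerivAt.mul_const ε⁻¹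
      simp only [← div_eq_mul_inv] at this
      exact (contDiff_boundaryCutoff.differentiable one_ne_zero _).hasDerivAt.comp_hasFDerivAt x this
    have d2 : HasFDerivAt (fun x => χ x * ψ x) _ x :=
      d1.mul (hψ.differentiable one_ne_zero x).hasFDerivAt
    rw [d2.fderiv]
    simp only [add_apply, smul_apply, smul_eq_mul,
      fderiv_graphHeight hφ, hFdef]
    ring
  simp only [hder] at hibp
  rw [integral_add (hAc.1.integrable_of_hasCompactSupport hAc.2)
    ((hFc.1.integrable_of_hasCompactSupport hFc.2).const_mul _), integral_const_mul,
    integral_eq_smul_integral_graph he hφ.continuous hFc.1 hFc.2 hε, ← mul_assoc,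
    inv_mul_cancel₀ hε.ne', one_mul] at hibp
  have hq : (fun q : (ℝ ∙ e)ᗮ × ℝ => F (graphMap e φ q.1 + (ε * q.2) • e)) = fun q =>
      ψ (graphMap e φ q.1 + (ε * q.2) • e) * (deriv boundaryCutoff q.2 *
        inner ℝ (W (graphMap e φ q.1 + (ε * q.2) • e)) (graphNormal e φ q.1)) := by
    ext q
    simp only [hFdef, graphHeight_graphMap_add he, proj_graphMap_add, mul_div_cancel_left₀ _ hε.ne']
  rw [hq] at hibp
  rw [hibp]
  congr 1
  refine integral_congr_ae (Eventually.of_forall fun x => ?_)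
  simp only [hχdef, mul_assoc]

end Chart

/-! ### Removing the cut-off -/

section CutoffLimit
variable {N : ℕ} {x₀ e : RN N} {r : ℝ} {φ : (ℝ ∙ e)ᗮ → ℝ} {K : ℝ≥0} {Ω : Set (RN N)}

/-- The cut-off vanishes on `Ω`, within the ball of the chart. -/
lemma GraphChart.cutoff_mul_eq (h : GraphChart Ω x₀ r e φ K) {f : RN N → ℝ}
    (hf : ∀ x ∉ Metric.ball x₀ r, f x = 0) {ε : ℝ} (hε : 0 < ε) (x : RN N) :
    boundaryCutoff (graphHeight e φ x / ε) * f x =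
      boundaryCutoff (graphHeight e φ x / ε) * Ωᶜ.indicator f x := by
  by_cases hx : x ∈ Ω
  · by_cases hb : x ∈ Metric.ball x₀ r
    · have h1 := (h.mem_iff x hb).1 hx
      rw [boundaryCutoff_eq_zero, zero_mul, zero_mul]
      have : graphHeight e φ x / ε ≤ 0 :=
        div_nonpos_of_nonpos_of_nonneg (by unfold graphHeight; linarith) hε.le
      linarith
    · rw [hf x hb, indicator_of_notMem (by simpa using hx)]
  · rw [indicator_of_mem (show x ∈ Ωᶜ from hx)]

lemma GraphChart.norm_integral_cutoff_le (h : GraphChart Ω x₀ r e φ K) (hΩ : IsOpen Ω)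
    {f : RN N → ℝ} (hf : ∀ x ∉ Metric.ball x₀ r, f x = 0) (hi : IntegrableOn f Ωᶜ) {ε : ℝ}
    (hε : 0 < ε) : |∫ x, boundaryCutoff (graphHeight e φ x / ε) * f x| ≤ ∫ x in Ωᶜ, |f x| := by
  have hm := hΩ.measurableSet.compl
  rw [← integral_indicator hm]
  simp_rw [h.cutoff_mul_eq hf hε]
  refine norm_integral_le_of_norm_le (f := fun x => boundaryCutoff (graphHeight e φ x / ε) *
    Ωᶜ.indicator f x) ((integrable_indicator_iff hm).2 hi.norm) (Eventually.of_forall fun x => ?_)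
  rw [norm_mul, Real.norm_of_nonneg (boundaryCutoff_nonneg _), norm_indicator_eq_indicator_norm]
  exact mul_le_of_le_one_left (indicator_nonneg (fun _ _ => norm_nonneg _) _)
    (boundaryCutoff_le_one _)

lemma GraphChart.tendsto_integral_cutoff (h : GraphChart Ω x₀ r e φ K) (hΩ : IsOpen Ω)
    (hnull : volume (frontier Ω) = 0) {f : RN N → ℝ} (hf : ∀ x ∉ Metric.ball x₀ r, f x = 0)
    (hi : IntegrableOn f Ωᶜ) :
    Tendsto (fun ε => ∫ x, boundaryCutoff (graphHeight e φ x / ε) * f x) (𝓝[>] 0)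
      (𝓝 (∫ x in Ωᶜ, f x)) := by
  have hm := hΩ.measurableSet.compl
  have hi' : Integrable (Ωᶜ.indicator f) := (integrable_indicator_iff hm).2 hi
  rw [← integral_indicator hm]
  have hcg : Continuous (graphHeight e φ) := (contDiff_graphHeight h.contDiff).continuous
  refine Tendsto.congr' (f₁ := fun ε =>
    ∫ x, boundaryCutoff (graphHeight e φ x / ε) * Ωᶜ.indicator f x) ?_ ?_
  · filter_upwards [self_mem_nhdsWithin] with ε hε
    simp_rw [h.cutoff_mul_eq hf hε]
  · refine tendsto_integral_filter_of_dominated_convergence (fun x => ‖Ωᶜ.indicator f x‖)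
      (Eventually.of_forall fun ε =>
        ((contDiff_boundaryCutoff.continuous.comp (hcg.div_const ε)).aestronglyMeasurable.mul
          hi'.aestronglyMeasurable))
      (Eventually.of_forall fun ε => Eventually.of_forall fun x => ?_) hi'.norm ?_
    · rw [norm_mul, Real.norm_of_nonneg (boundaryCutoff_nonneg _)]
      exact mul_le_of_le_one_left (norm_nonneg _) (boundaryCutoff_le_one _)
    · filter_upwards [measure_eq_zero_iff_ae_notMem.1 hnull] with x hx
      by_cases hb : x ∈ Ωᶜ ∩ Metric.ball x₀ r
      · have hpos : 0 < graphHeight e φ x := by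
          have h1 := mt (h.mem_iff x hb.2).2 hb.1
          refine lt_of_le_of_ne (by unfold graphHeight; linarith) fun h0 => hx ?_
          exact h.mem_frontier_of_inner_eq hΩ hb.2 (by unfold graphHeight at h0; linarith)
        refine tendsto_const_nhds.congr' ?_
        filter_upwards [Ioo_mem_nhdsGT hpos] with ε hε
        rw [boundaryCutoff_eq_one (by rw [one_le_div hε.1]; exact hε.2.le), one_mul]
      · have h0 : Ωᶜ.indicator f x = 0 := by
          by_cases hc : x ∈ Ωᶜ
          · rw [indicator_of_mem hc, hf x fun hb' => hb ⟨hc, hb'⟩]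
          · exact indicator_of_notMem hc f
        simp [h0]

/-- The averages of the flux over parallel surfaces converge to the flux through the graph, by
dominated convergence: the weight `deriv boundaryCutoff` has integral one. -/
lemma tendsto_integral_flux (he : ‖e‖ = 1) (hr : 0 < r) {ψ : RN N → ℝ}
    (hψ : Continuous ψ) (hc : HasCompactSupport ψ)
    (hs : tsupport ψ ⊆ Metric.ball x₀ (r / 4)) {g : (ℝ ∙ e)ᗮ → ℝ → ℝ} {z : (ℝ ∙ e)ᗮ → ℝ} {C t₀ : ℝ}
    (ht₀ : 0 < t₀)
    (hgm : ∀ᶠ ε in 𝓝[>] (0 : ℝ), AEStronglyMeasurable (fun q : (ℝ ∙ e)ᗮ × ℝ =>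
      ψ (graphMap e φ q.1 + (ε * q.2) • e) * (deriv boundaryCutoff q.2 * g q.1 (ε * q.2))))
    (hb : ∀ x', graphMap e φ x' ∈ Metric.ball x₀ (r / 2) → ∀ t : ℝ, 0 < t → t ≤ t₀ → |g x' t| ≤ C)
    (hz : ∀ x', graphMap e φ x' ∈ Metric.ball x₀ (r / 2) →
      Tendsto (g x') (𝓝[>] 0) (𝓝 (z x'))) :
    Tendsto (fun ε => ∫ q : (ℝ ∙ e)ᗮ × ℝ, ψ (graphMap e φ q.1 + (ε * q.2) • e) *
      (deriv boundaryCutoff q.2 * g q.1 (ε * q.2))) (𝓝[>] 0)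
      (𝓝 (∫ x', ψ (graphMap e φ x') * z x')) := by
  obtain ⟨Cψ, hCψ⟩ := hc.exists_bound_of_continuous hψ
  obtain ⟨Cχ, hCχ⟩ := hasCompactSupport_deriv_boundaryCutoff.exists_bound_of_continuous
    continuous_deriv_boundaryCutoff
  have hlim : ∫ x', ψ (graphMap e φ x') * z x' =
      ∫ q : (ℝ ∙ e)ᗮ × ℝ, (ψ (graphMap e φ q.1) * z q.1) * deriv boundaryCutoff q.2 := by
    rw [Measure.volume_eq_prod, integral_prod_mul (fun x' => ψ (graphMap e φ x') * z x'),
      integral_deriv_boundaryCutoff, mul_one]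
  rw [hlim]
  set B : Set ((ℝ ∙ e)ᗮ × ℝ) :=
    Metric.ball ((ℝ ∙ e)ᗮ.orthogonalProjectionOnto x₀) r ×ˢ Icc (1 / 2) 1 with hB
  have hBm : MeasurableSet B := measurableSet_ball.prod measurableSet_Icc
  have hBfin : volume B ≠ ⊤ := by
    rw [hB, Measure.volume_eq_prod, Measure.prod_prod]
    exact ENNReal.mul_ne_top measure_ball_lt_top.ne measure_Icc_lt_top.ne
  refine tendsto_integral_filter_of_dominated_convergence (B.indicator fun _ => Cψ * (Cχ * |C|)) hgm ?_
    ((integrable_indicator_iff hBm).2 (integrableOn_const hBfin)) ?_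
  · filter_upwards [Ioo_mem_nhdsGT ht₀, Ioo_mem_nhdsGT (show 0 < r / 4 by positivity)] with ε h1 h2
    refine Eventually.of_forall fun q => ?_
    by_cases hq : q.2 ∈ Icc (1 / 2 : ℝ) 1
    · set x := graphMap e φ q.1 + (ε * q.2) • e with hx
      have hε2 : 0 < ε * q.2 := mul_pos h1.1 (by linarith [hq.1])
      have hε3 : ε * q.2 ≤ ε := by nlinarith [hq.2, h1.1]
      by_cases hxs : x ∈ tsupport ψ
      · have hxb := hs hxs
        rw [Metric.mem_ball, dist_eq_norm] at hxb
        have hG : graphMap e φ q.1 ∈ Metric.ball x₀ (r / 2) := by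
          rw [Metric.mem_ball, dist_eq_norm]
          have : graphMap e φ q.1 - x₀ = (x - x₀) - (ε * q.2) • e := by rw [hx]; abel
          rw [this]
          have h3 := norm_sub_le (x - x₀) ((ε * q.2) • e)
          rw [norm_smul, he, mul_one, Real.norm_of_nonneg hε2.le] at h3
          linarith [h2.2]
        have hqB : q ∈ B := by
          refine ⟨?_, hq⟩
          have h3 := norm_proj_le (e := e) (x - x₀)
          rw [map_sub, hx, proj_graphMap_add] at h3
          rw [Metric.mem_ball, dist_eq_norm]
          linarith
        rw [indicator_of_mem hqB, norm_mul, norm_mul]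
        have h4 : ‖g q.1 (ε * q.2)‖ ≤ |C| :=
          (hb _ hG _ hε2 (by linarith [h1.2])).trans (le_abs_self C)
        have hCψ0 : 0 ≤ Cψ := (norm_nonneg _).trans (hCψ x)
        have hCχ0 : 0 ≤ Cχ := (norm_nonneg _).trans (hCχ q.2)
        gcongr
        · exact hCψ x
        · exact hCχ _
      · rw [image_eq_zero_of_notMem_tsupport hxs, zero_mul, norm_zero]
        have hCψ0 : 0 ≤ Cψ := (norm_nonneg _).trans (hCψ x)
        have hCχ0 : 0 ≤ Cχ := (norm_nonneg _).trans (hCχ q.2)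
        exact indicator_nonneg (fun _ _ => by positivity) _
    · rw [deriv_boundaryCutoff_eq_zero hq, zero_mul, mul_zero, norm_zero,
        indicator_of_notMem fun h => hq h.2]
  · refine Eventually.of_forall fun q => ?_
    by_cases hq : q.2 ∈ Icc (1 / 2 : ℝ) 1
    · have hq0 : 0 < q.2 := by linarith [hq.1]
      have ht : Tendsto (fun ε : ℝ => ε * q.2) (𝓝[>] 0) (𝓝[>] 0) := by
        refine tendsto_nhdsWithin_iff.2 ⟨?_, ?_⟩
        · have : Continuous fun ε : ℝ => ε * q.2 := by fun_prop
          simpa using (this.tendsto 0).mono_left nhdsWithin_le_nhds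
        · filter_upwards [self_mem_nhdsWithin] with ε hε using mul_pos hε hq0
      have hx : Tendsto (fun ε : ℝ => graphMap e φ q.1 + (ε * q.2) • e) (𝓝[>] 0)
          (𝓝 (graphMap e φ q.1)) := by
        have : Continuous fun ε : ℝ => graphMap e φ q.1 + (ε * q.2) • e := by fun_prop
        simpa using (this.tendsto 0).mono_left nhdsWithin_le_nhds
      by_cases hG : graphMap e φ q.1 ∈ Metric.ball x₀ (r / 2)
      · have h1 := ((hψ.tendsto _).comp hx).mul (((hz _ hG).comp ht).const_mul
          (deriv boundaryCutoff q.2))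
        rw [show ψ (graphMap e φ q.1) * z q.1 * deriv boundaryCutoff q.2 =
          ψ (graphMap e φ q.1) * (deriv boundaryCutoff q.2 * z q.1) by ring]
        exact h1
      · have hns : graphMap e φ q.1 ∉ tsupport ψ := fun h =>
          hG (Metric.ball_subset_ball (by linarith) (hs h))
        rw [image_eq_zero_of_notMem_tsupport hns, zero_mul, zero_mul]
        refine tendsto_const_nhds.congr' ?_
        filter_upwards [hx.eventually ((isClosed_tsupport ψ).isOpen_compl.mem_nhds hns)] with ε hε
        rw [image_eq_zero_of_notMem_tsupport hε, zero_mul]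
    · simp only [deriv_boundaryCutoff_eq_zero hq, zero_mul, mul_zero]
      exact tendsto_const_nhds

lemma GraphChart.integrable_flux (h : GraphChart Ω x₀ r e φ K) (hΩ : IsOpen Ω)
    {ψ : RN N → ℝ} (hψ : Continuous ψ) (hc : HasCompactSupport ψ)
    (hs : tsupport ψ ⊆ Metric.ball x₀ r) {W : RN N → RN N}
    (hW : ∀ x ∉ closure Ω, ContinuousAt W x) {ε : ℝ} (hε : 0 < ε) :
    Integrable (fun q : (ℝ ∙ e)ᗮ × ℝ =>
      ψ (graphMap e φ q.1 + (ε * q.2) • e) * (deriv boundaryCutoff q.2 *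
        inner ℝ (W (graphMap e φ q.1 + (ε * q.2) • e)) (graphNormal e φ q.1))) := by
  have h1 := h.continuous_cutoffFlux hΩ hψ hc hs hW hε
  refine (integrable_comp_graph h.norm_e h.contDiff.continuous h1.1 h1.2 hε).congr
    (Eventually.of_forall fun q => ?_)
  simp only [graphHeight_graphMap_add h.norm_e, proj_graphMap_add, mul_div_cancel_left₀ _ hε.ne']

/-- The divergence theorem over the exterior of `Ω`, localized in a chart, for a vector field with
bounded normal components that converge along the vertical lines of the chart. -/
lemma GraphChart.integral_exterior (h : GraphChart Ω x₀ r e φ K) (hΩ : IsOpen Ω)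
    (hnull : volume (frontier Ω) = 0) {ψ : RN N → ℝ}
    (hψ : ContDiff ℝ 1 ψ) (hc : HasCompactSupport ψ) (hs : tsupport ψ ⊆ Metric.ball x₀ (r / 4))
    {W : RN N → RN N} (hW : ∀ x ∉ closure Ω, ContDiffAt ℝ 1 W x)
    (hi₁ : IntegrableOn (fun x => fderiv ℝ ψ x (W x)) Ωᶜ)
    (hi₂ : IntegrableOn (fun x => ψ x * divergence W x) Ωᶜ) {z : (ℝ ∙ e)ᗮ → ℝ} {C t₀ : ℝ}
    (ht₀ : 0 < t₀)
    (hb : ∀ x', graphMap e φ x' ∈ Metric.ball x₀ (r / 2) → ∀ t : ℝ, 0 < t → t ≤ t₀ →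
      |inner ℝ (W (graphMap e φ x' + t • e)) (graphNormal e φ x')| ≤ C)
    (hz : ∀ x', graphMap e φ x' ∈ Metric.ball x₀ (r / 2) →
      Tendsto (fun t : ℝ => inner ℝ (W (graphMap e φ x' + t • e)) (graphNormal e φ x'))
        (𝓝[>] 0) (𝓝 (z x'))) :
    (∫ x in Ωᶜ, fderiv ℝ ψ x (W x)) + ∫ x', ψ (graphMap e φ x') * z x' =
      -∫ x in Ωᶜ, ψ x * divergence W x := by
  have hs' : tsupport ψ ⊆ Metric.ball x₀ r :=
    hs.trans (Metric.ball_subset_ball (by linarith [h.pos]))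
  have h0 : ∀ x ∉ Metric.ball x₀ r, fderiv ℝ ψ x (W x) = 0 := fun x hx => by
    rw [image_eq_zero_of_notMem_tsupport fun h => hx (hs' (tsupport_fderiv_subset ℝ h))]; simp
  have h0' : ∀ x ∉ Metric.ball x₀ r, ψ x * divergence W x = 0 := fun x hx => by
    rw [image_eq_zero_of_notMem_tsupport fun h => hx (hs' h), zero_mul]
  have l1 := h.tendsto_integral_cutoff hΩ hnull h0 hi₁
  have l2 := tendsto_integral_flux h.norm_e h.pos hψ.continuous hc hs ht₀
    (by filter_upwards [self_mem_nhdsWithin] with ε hε using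
      (h.integrable_flux hΩ hψ.continuous hc hs'
        (fun x hx => (hW x hx).continuousAt) hε).aestronglyMeasurable) hb hz
  have l3 := (h.tendsto_integral_cutoff hΩ hnull h0' hi₂).neg
  refine tendsto_nhds_unique ((l1.add l2).congr' ?_) l3
  filter_upwards [self_mem_nhdsWithin] with ε hε
  exact h.integral_cutoff hΩ hψ hc hs' hW hε

/-- A vector field whose divergence is integrable over the exterior of `Ω` cannot have a normal
component that blows up, with a fixed sign, all over a piece of the boundary: the other two terms of
the divergence theorem with cut-off stay bounded, so the flux term does. -/
lemma GraphChart.not_blowup (h : GraphChart Ω x₀ r e φ K) (hΩ : IsOpen Ω) (hx₀ : x₀ ∈ frontier Ω)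
    {W : RN N → RN N} (hW : ∀ x ∉ closure Ω, ContDiffAt ℝ 1 W x) (hi₁ : IntegrableOn W Ωᶜ)
    (hi₂ : IntegrableOn (divergence W) Ωᶜ)
    (hb : ∀ B : ℝ, ∃ t₁ > 0, ∀ x', graphMap e φ x' ∈ Metric.ball x₀ (r / 2) →
      ∀ t : ℝ, 0 < t → t ≤ t₁ → B ≤ inner ℝ (W (graphMap e φ x' + t • e)) (graphNormal e φ x')) :
    False := by
  have hr := h.pos
  let ψ : ContDiffBump x₀ := ⟨r / 16, r / 8, by positivity, by linarith⟩
  have hψ : ContDiff ℝ 1 ψ := ψ.contDiff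
  have hψ0 : ∀ x, 0 ≤ ψ x := fun x => ψ.nonneg
  have hc : HasCompactSupport ψ := ψ.hasCompactSupport
  have hs : tsupport ψ ⊆ Metric.ball x₀ (r / 4) := by
    rw [ψ.tsupport_eq]; exact Metric.closedBall_subset_ball (show r / 8 < r / 4 by linarith)
  have hs' : tsupport ψ ⊆ Metric.ball x₀ r :=
    hs.trans (Metric.ball_subset_ball (by linarith [h.pos]))
  have h0 : ∀ x ∉ Metric.ball x₀ r, fderiv ℝ ψ x (W x) = 0 := fun x hx => by
    rw [image_eq_zero_of_notMem_tsupport fun h => hx (hs' (tsupport_fderiv_subset ℝ h))]; simp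
  have h0' : ∀ x ∉ Metric.ball x₀ r, ψ x * divergence W x = 0 := fun x hx => by
    rw [image_eq_zero_of_notMem_tsupport fun h => hx (hs' h), zero_mul]
  have hj₁ : IntegrableOn (fun x => fderiv ℝ ψ x (W x)) Ωᶜ := by
    obtain ⟨C, hC⟩ := (hc.fderiv ℝ).exists_bound_of_continuous (hψ.continuous_fderiv one_ne_zero)
    refine (hi₁.norm.const_mul C).mono' ?_ (Eventually.of_forall fun x =>
      (ContinuousLinearMap.le_opNorm _ _).trans (by gcongr; exact hC x))
    exact (ContinuousLinearMap.apply ℝ ℝ : RN N →L[ℝ] _).flip.aestronglyMeasurable_comp₂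
      (hψ.continuous_fderiv one_ne_zero).aestronglyMeasurable hi₁.aestronglyMeasurable
  have hj₂ : IntegrableOn (fun x => ψ x * divergence W x) Ωᶜ :=
    hi₂.bdd_mul (c := 1) hψ.continuous.aestronglyMeasurable (Eventually.of_forall fun x => by
      rw [Real.norm_of_nonneg (hψ0 x)]; exact ψ.le_one)
  -- `A` bounds the other two terms of the divergence theorem at every scale of the cut-off.
  set A := (∫ x in Ωᶜ, |fderiv ℝ ψ x (W x)|) + ∫ x in Ωᶜ, |ψ x * divergence W x|
  set I := ∫ x', ψ (graphMap e φ x')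
  have hgc : Continuous (graphMap e φ) := (contDiff_graphMap h.contDiff).continuous
  have hI : 0 < I := by
    have hcomp : HasCompactSupport fun x' => ψ (graphMap e φ x') :=
      hc.comp_isClosedEmbedding (isClosedEmbedding_graphMap h.contDiff.continuous)
    refine (hψ.continuous.comp hgc).integral_pos_of_hasCompactSupport_nonneg_nonzero hcomp
      (fun x' => hψ0 _) (x := (ℝ ∙ e)ᗮ.orthogonalProjectionOnto x₀) ?_
    have hx : graphMap e φ ((ℝ ∙ e)ᗮ.orthogonalProjectionOnto x₀) = x₀ := by
      rw [graphMap, ← h.inner_eq_of_mem_frontier hΩ hx₀ (Metric.mem_ball_self hr),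
        proj_add_inner_smul h.norm_e]
    rw [hx]
    exact (ψ.pos_of_mem_ball (Metric.mem_ball_self (show 0 < r / 8 by positivity))).ne'
  have lim := tendsto_integral_flux (z := fun _ => 1) (g := fun _ _ => 1) (C := 1) (t₀ := 1) h.norm_e
    hr hψ.continuous hc hs one_pos (Eventually.of_forall fun ε => by
      have := continuous_deriv_boundaryCutoff
      have := hψ.continuous
      exact Continuous.aestronglyMeasurable (by fun_prop)) (fun _ _ _ _ _ => by simp)
    (fun _ _ => tendsto_const_nhds)
  simp only [mul_one] at lim
  -- The averages of `ψ` exceed `I / 2`, so normal components of this size have flux at least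
  -- `A + 1`.
  obtain ⟨t₁, ht₁, hB⟩ := hb ((A + 1) * 2 / I)
  have hev := lim.eventually_const_lt (show I / 2 < I by linarith)
  have hpos : ∀ᶠ ε in 𝓝[>] (0 : ℝ), 0 < ε := self_mem_nhdsWithin
  have hsm₁ : ∀ᶠ ε in 𝓝[>] (0 : ℝ), ε ∈ Ioo 0 t₁ := Ioo_mem_nhdsGT ht₁
  have hsm₂ : ∀ᶠ ε in 𝓝[>] (0 : ℝ), ε ∈ Ioo 0 (r / 4) := Ioo_mem_nhdsGT (by positivity)
  obtain ⟨ε, hεI, hε, hε1, hε2⟩ := (hev.and (hpos.and (hsm₁.and hsm₂))).exists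
  have hid := h.integral_cutoff hΩ hψ hc hs' hW hε
  have b1 := abs_le.1 (h.norm_integral_cutoff_le hΩ h0 hj₁ hε)
  have b2 := abs_le.1 (h.norm_integral_cutoff_le hΩ h0' hj₂ hε)
  have hA0 : 0 ≤ A := add_nonneg (integral_nonneg fun _ => abs_nonneg _)
    (integral_nonneg fun _ => abs_nonneg _)
  have hint := h.integrable_flux hΩ hψ.continuous hc hs'
    (fun x hx => (hW x hx).continuousAt) hε
  have hnn : 0 ≤ fun q : (ℝ ∙ e)ᗮ × ℝ =>
      ψ (graphMap e φ q.1 + (ε * q.2) • e) * deriv boundaryCutoff q.2 := fun q =>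
    mul_nonneg (hψ0 _) (deriv_boundaryCutoff_nonneg _)
  have hge : (A + 1) * 2 / I * ∫ q : (ℝ ∙ e)ᗮ × ℝ,
      ψ (graphMap e φ q.1 + (ε * q.2) • e) * deriv boundaryCutoff q.2 ≤
      ∫ q : (ℝ ∙ e)ᗮ × ℝ, ψ (graphMap e φ q.1 + (ε * q.2) • e) * (deriv boundaryCutoff q.2 *
        inner ℝ (W (graphMap e φ q.1 + (ε * q.2) • e)) (graphNormal e φ q.1)) := by
    rw [← integral_const_mul]
    refine integral_mono_of_nonneg (Eventually.of_forall fun q =>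
      mul_nonneg (by positivity) (hnn q)) hint (Eventually.of_forall fun q => ?_)
    change (A + 1) * 2 / I * (_ * _) ≤ _ * (_ * _)
    by_cases hq : q.2 ∈ Icc (1 / 2 : ℝ) 1
    · set x := graphMap e φ q.1 + (ε * q.2) • e with hx
      have hε3 : 0 < ε * q.2 := mul_pos hε1.1 (by linarith [hq.1])
      have hε4 : ε * q.2 ≤ ε := by nlinarith [hq.2, hε1.1]
      by_cases hxs : x ∈ tsupport ψ
      · have hxb := hs hxs
        rw [Metric.mem_ball, dist_eq_norm] at hxb
        have hG : graphMap e φ q.1 ∈ Metric.ball x₀ (r / 2) := by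
          rw [Metric.mem_ball, dist_eq_norm]
          have : graphMap e φ q.1 - x₀ = (x - x₀) - (ε * q.2) • e := by rw [hx]; abel
          rw [this]
          have h3 := norm_sub_le (x - x₀) ((ε * q.2) • e)
          rw [norm_smul, h.norm_e, mul_one, Real.norm_of_nonneg hε3.le] at h3
          linarith [hε2.2]
        have h4 := hB _ hG _ hε3 (by linarith [hε1.2])
        have h5 := hnn q
        calc _ = ψ x * deriv boundaryCutoff q.2 * ((A + 1) * 2 / I) := by ring
          _ ≤ ψ x * deriv boundaryCutoff q.2 * inner ℝ (W x) (graphNormal e φ q.1) :=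
            mul_le_mul_of_nonneg_left h4 h5
          _ = _ := by ring
      · rw [image_eq_zero_of_notMem_tsupport hxs, zero_mul, zero_mul, mul_zero]
    · rw [deriv_boundaryCutoff_eq_zero hq]; simp
  have hge2 : A + 1 ≤ (A + 1) * 2 / I * ∫ q : (ℝ ∙ e)ᗮ × ℝ,
      ψ (graphMap e φ q.1 + (ε * q.2) • e) * deriv boundaryCutoff q.2 := by
    calc A + 1 = (A + 1) * 2 / I * (I / 2) := by field_simp
      _ ≤ _ := by gcongr
  have : A = (∫ x in Ωᶜ, |fderiv ℝ ψ x (W x)|) + ∫ x in Ωᶜ, |ψ x * divergence W x| := rfl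
  linarith [b1.1, b1.2, b2.1, b2.2]

end CutoffLimit

/-! ### The divergence theorem outside the domain -/

/-- `W` is a `C¹` vector field on the exterior of `Ω`, locally integrable up to the boundary
together with its divergence, whose normal component attains the boundary values `T` along all
directions that are transversal to the boundary, boundedly as long as the angle is. -/
structure HasNormalTrace {N : ℕ} (Ω : Set (RN N)) (W : RN N → RN N) (T : RN N → ℝ) : Prop where
  contDiffAt : ∀ x ∉ closure Ω, ContDiffAt ℝ 1 W x
  integrableOn : ∀ S, IsCompact S → IntegrableOn W (S ∩ Ωᶜ)
  integrableOn_divergence : ∀ S, IsCompact S → IntegrableOn (divergence W) (S ∩ Ωᶜ)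
  bound : ∀ κ > 0, ∃ C t₀ : ℝ, 0 < t₀ ∧ ∀ p ∈ frontier Ω, ∀ q : RN N, ‖q‖ ≤ 1 →
    κ ≤ inner ℝ q (outerNormal Ω p) → ∀ t : ℝ, 0 < t → t ≤ t₀ →
    |inner ℝ (W (p + t • q)) (outerNormal Ω p)| ≤ C
  tendsto : ∀ p ∈ frontier Ω, ∀ q : RN N, ‖q‖ ≤ 1 → 0 < inner ℝ q (outerNormal Ω p) →
    Tendsto (fun t : ℝ => inner ℝ (W (p + t • q)) (outerNormal Ω p)) (𝓝[>] 0) (𝓝 (T p))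

section NormalTrace
variable {N : ℕ} {Ω : Set (RN N)} {W : RN N → RN N} {T ψ : RN N → ℝ}

lemma GraphChart.mono {x₀ e : RN N} {r r' : ℝ} {φ : (ℝ ∙ e)ᗮ → ℝ} {K : ℝ≥0}
    (h : GraphChart Ω x₀ r e φ K) (hr : 0 < r') (hle : r' ≤ r) : GraphChart Ω x₀ r' e φ K :=
  ⟨hr, h.norm_e, h.contDiff, h.lipschitz, fun y hy => h.mem_iff y (Metric.ball_subset_ball hle hy)⟩

/-- In a chart, the vertical direction is uniformly transversal to the boundary. -/
lemma GraphChart.exists_norm_graphNormal_le {x₀ e : RN N} {r : ℝ} {φ : (ℝ ∙ e)ᗮ → ℝ} {K : ℝ≥0}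
    (h : GraphChart Ω x₀ r e φ K) :
    ∃ M : ℝ, 1 ≤ M ∧ ∀ x', graphMap e φ x' ∈ Metric.ball x₀ r → ‖graphNormal e φ x'‖ ≤ M := by
  obtain ⟨M, hM⟩ := (isCompact_closedBall ((ℝ ∙ e)ᗮ.orthogonalProjectionOnto x₀)
    r).exists_bound_of_continuousOn (continuous_graphNormal h.contDiff).continuousOn
  refine ⟨max 1 M, le_max_left _ _, fun x' hx' => (hM x' ?_).trans (le_max_right _ _)⟩
  have h3 := norm_proj_le (e := e) (graphMap e φ x' - x₀)
  rw [map_sub, graphMap, proj_add_smul] at h3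
  rw [Metric.mem_ball, dist_eq_norm] at hx'
  rw [Metric.mem_closedBall, dist_eq_norm]
  exact h3.trans hx'.le

/-- On a graph the outer normal is the normalized `graphNormal`, and its angle to the vertical
direction is given by the Jacobian. -/
lemma GraphChart.outerNormal_graphMap {x₀ e : RN N} {r : ℝ} {φ : (ℝ ∙ e)ᗮ → ℝ} {K : ℝ≥0}
    (h : GraphChart Ω x₀ r e φ K) (hΩ : IsOpen Ω) {x' : (ℝ ∙ e)ᗮ}
    (hx : graphMap e φ x' ∈ Metric.ball x₀ (r / 2)) :
    graphNormal e φ x' = ‖graphNormal e φ x'‖ • outerNormal Ω (graphMap e φ x') ∧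
      inner ℝ e (outerNormal Ω (graphMap e φ x')) = ‖graphNormal e φ x'‖⁻¹ := by
  have h1 := one_le_norm_graphNormal h.norm_e φ x'
  have h2 := h.outerNormal_eq hΩ (h.graphMap_mem_frontier hΩ
    (Metric.ball_subset_ball (by linarith [h.pos]) hx)) hx
  have h3 : (ℝ ∙ e)ᗮ.orthogonalProjectionOnto (graphMap e φ x') = x' := proj_add_smul x' _
  rw [h3] at h2
  rw [h2, smul_smul, mul_inv_cancel₀ (by positivity), one_smul, inner_smul_right,
    inner_e_graphNormal h.norm_e, mul_one]
  exact ⟨rfl, rfl⟩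

lemma HasNormalTrace.integrableOn_fderiv_apply (hW : HasNormalTrace Ω W T) (hΩ : IsOpen Ω)
    (hψ : ContDiff ℝ 1 ψ) (hc : HasCompactSupport ψ) : IntegrableOn (fun x => fderiv ℝ ψ x (W x)) Ωᶜ := by
  obtain ⟨C, hC⟩ := (hc.fderiv ℝ).exists_bound_of_continuous (hψ.continuous_fderiv one_ne_zero)
  have h1 : IntegrableOn (fun x => fderiv ℝ ψ x (W x)) (tsupport ψ ∩ Ωᶜ) := by
    refine ((hW.integrableOn _ hc).norm.const_mul C).mono' ?_ (Eventually.of_forall fun x =>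
      (ContinuousLinearMap.le_opNorm _ _).trans (by gcongr; exact hC x))
    exact (ContinuousLinearMap.apply ℝ ℝ : RN N →L[ℝ] _).flip.aestronglyMeasurable_comp₂
      (hψ.continuous_fderiv one_ne_zero).aestronglyMeasurable
      (hW.integrableOn _ hc).aestronglyMeasurable
  refine h1.of_forall_sdiff_eq_zero ?_ fun x hx => ?_
  · exact hΩ.measurableSet.compl
  · rw [image_eq_zero_of_notMem_tsupport fun h => hx.2 ⟨tsupport_fderiv_subset ℝ h, hx.1⟩]; simp

lemma HasNormalTrace.integrableOn_mul_divergence (hW : HasNormalTrace Ω W T) (hΩ : IsOpen Ω)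
    (hψ : Continuous ψ) (hc : HasCompactSupport ψ) : IntegrableOn (fun x => ψ x * divergence W x) Ωᶜ := by
  obtain ⟨C, hC⟩ := hc.exists_bound_of_continuous hψ
  have h1 : IntegrableOn (fun x => ψ x * divergence W x) (tsupport ψ ∩ Ωᶜ) :=
    (hW.integrableOn_divergence _ hc).bdd_mul (c := C) hψ.aestronglyMeasurable
      (Eventually.of_forall hC)
  refine h1.of_forall_sdiff_eq_zero ?_ fun x hx => ?_
  · exact hΩ.measurableSet.compl
  · rw [image_eq_zero_of_notMem_tsupport fun h => hx.2 ⟨h, hx.1⟩, zero_mul]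

/-- The trace is a bounded limit of functions that are continuous on the boundary, and the boundary
has finite surface measure. -/
lemma HasNormalTrace.integrableOn_frontier (hW : HasNormalTrace Ω W T)
    (hΩ : IsBoundedC11Domain Ω) : IntegrableOn T (frontier Ω) μHE[N - 1] := by
  obtain ⟨K, r, hK, hr, hT⟩ := hΩ.exists_tangentAt
  obtain ⟨C, t₀, ht₀, hC⟩ := hW.bound 1 one_pos
  have hm : MeasurableSet (frontier Ω) := isClosed_frontier.measurableSet
  have hnn : ∀ p ∈ frontier Ω, inner ℝ (outerNormal Ω p) (outerNormal Ω p) = (1 : ℝ) := fun p hp => by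
    rw [real_inner_self_eq_norm_sq, (hT p hp).1]; norm_num
  have hfin : IsFiniteMeasure ((μHE[N - 1] : Measure (RN N)).restrict (frontier Ω)) :=
    ⟨by rw [Measure.restrict_apply_univ]; exact hΩ.euclideanHausdorffMeasure_frontier_lt_top⟩
  set t₁ := min (r / 2) (1 / (8 * K))
  have ht₁ : 0 < t₁ := by positivity
  have hseq : Tendsto (fun k : ℕ => t₁ * (1 / ((k : ℝ) + 1))) atTop (𝓝[>] 0) := by
    refine tendsto_nhdsWithin_iff.2 ⟨?_, Eventually.of_forall fun k => ?_⟩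
    · simpa using tendsto_one_div_add_atTop_nhds_zero_nat.const_mul t₁
    · exact mul_pos ht₁ (by positivity)
  have hmeas : AEStronglyMeasurable T ((μHE[N - 1] : Measure (RN N)).restrict (frontier Ω)) := by
    refine aestronglyMeasurable_of_tendsto_ae atTop (f := fun (k : ℕ) p =>
      inner ℝ (W (p + (t₁ * (1 / ((k : ℝ) + 1))) • outerNormal Ω p)) (outerNormal Ω p))
      (fun k => ?_) ?_
    · refine ContinuousOn.aestronglyMeasurable (fun p hp => ?_) hm
      have hνc := hΩ.continuousOn_outerNormal p hp
      set t := t₁ * (1 / ((k : ℝ) + 1)) with ht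
      have htpos : 0 < t := mul_pos ht₁ (by positivity)
      have htle : t ≤ t₁ := by
        have : 1 / ((k : ℝ) + 1) ≤ 1 := by
          rw [div_le_one (by positivity)]; linarith [(Nat.cast_nonneg k : (0 : ℝ) ≤ k)]
        nlinarith
      have hx := (hT p hp).2.notMem_closure hK (hT p hp).1 (hT p hp).1.le one_pos (hnn p hp).ge
        htpos (by linarith [min_le_left (r / 2) (1 / (8 * K))]) (by
          have := htle.trans (min_le_right (r / 2) (1 / (8 * K)))
          rw [le_div_iff₀ (by positivity)] at this; linarith)
      have h1 : ContinuousWithinAt (fun p => p + t • outerNormal Ω p) (frontier Ω) p :=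
        continuousWithinAt_id.add (hνc.const_smul t)
      exact ((hW.contDiffAt _ hx).continuousAt.comp_continuousWithinAt
        (f := fun p => p + t • outerNormal Ω p) h1).inner hνc
    · filter_upwards [ae_restrict_mem hm] with p hp
      exact (hW.tendsto p hp _ (hT p hp).1.le (by rw [hnn p hp]; norm_num)).comp hseq
  refine Integrable.of_bound hmeas C ?_
  filter_upwards [ae_restrict_mem hm] with p hp
  refine le_of_tendsto (hW.tendsto p hp _ (hT p hp).1.le (by rw [hnn p hp]; norm_num)).norm ?_
  filter_upwards [Ioo_mem_nhdsGT ht₀] with t ht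
  exact hC p hp _ (hT p hp).1.le (hnn p hp).ge t ht.1 ht.2.le

/-- The divergence theorem for test functions supported in a chart. The Jacobian in the surface
integral turns the unit normal into `graphNormal`. -/
lemma HasNormalTrace.integral_of_subset_chart (hW : HasNormalTrace Ω W T)
    (hΩ : IsBoundedC11Domain Ω) {x₀ e : RN N} {r : ℝ} {φ : (ℝ ∙ e)ᗮ → ℝ} {K : ℝ≥0}
    (h : GraphChart Ω x₀ r e φ K) (hψ : ContDiff ℝ 1 ψ) (hc : HasCompactSupport ψ)
    (hs : tsupport ψ ⊆ Metric.ball x₀ (r / 4)) :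
    (∫ x in Ωᶜ, fderiv ℝ ψ x (W x)) + ∫ p in frontier Ω, ψ p * T p ∂μHE[N - 1] =
      -∫ x in Ωᶜ, ψ x * divergence W x := by
  obtain ⟨M, hM1, hM⟩ := h.exists_norm_graphNormal_le
  obtain ⟨C, t₀, ht₀, hC⟩ := hW.bound M⁻¹ (by positivity)
  have hsub : ∀ {y}, y ∈ Metric.ball x₀ (r / 2) → y ∈ Metric.ball x₀ r := fun hy =>
    Metric.ball_subset_ball (by linarith [h.pos]) hy
  have key := h.integral_exterior hΩ.isOpen hΩ.volume_frontier hψ hc hs hW.contDiffAt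
    (hW.integrableOn_fderiv_apply hΩ.isOpen hψ hc) (hW.integrableOn_mul_divergence hΩ.isOpen hψ.continuous hc)
    (z := fun x' => ‖graphNormal e φ x'‖ * T (graphMap e φ x')) (C := M * |C|) ht₀
    (fun x' hx' t ht htt => ?_) (fun x' hx' => ?_)
  · rw [← key, h.setIntegral_frontier hΩ.isOpen]
    · congr 2
      ext x'; ring
    · intro x hx
      rw [image_eq_zero_of_notMem_tsupport fun h' => hx (Metric.ball_subset_ball
        (by linarith [h.pos]) (hs h')), zero_mul]
  · obtain ⟨h1, h2⟩ := h.outerNormal_graphMap hΩ.isOpen hx'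
    have h3 := hM x' (hsub hx')
    have h4 := one_le_norm_graphNormal h.norm_e φ x'
    have h5 := hC _ (h.graphMap_mem_frontier hΩ.isOpen (hsub hx')) e h.norm_e.le
      (by rw [h2]; exact inv_anti₀ (by positivity) h3) t ht htt
    rw [h1, inner_smul_right, abs_mul, abs_norm]
    exact mul_le_mul h3 (h5.trans (le_abs_self C)) (abs_nonneg _) (by positivity)
  · obtain ⟨h1, h2⟩ := h.outerNormal_graphMap hΩ.isOpen hx'
    have h4 := one_le_norm_graphNormal h.norm_e φ x'
    have h5 := (hW.tendsto _ (h.graphMap_mem_frontier hΩ.isOpen (hsub hx')) e h.norm_e.le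
      (by rw [h2]; positivity)).const_mul ‖graphNormal e φ x'‖
    refine h5.congr fun t => ?_
    conv_rhs => rw [h1, inner_smul_right]

/-- The divergence theorem for test functions supported off the boundary, where the field extended
by zero is `C¹`. -/
lemma HasNormalTrace.integral_of_disjoint_frontier (hW : HasNormalTrace Ω W T)
    (hΩ : IsBoundedC11Domain Ω) (hψ : ContDiff ℝ 1 ψ) (hc : HasCompactSupport ψ)
    (hs : tsupport ψ ⊆ (frontier Ω)ᶜ) :
    (∫ x in Ωᶜ, fderiv ℝ ψ x (W x)) + ∫ p in frontier Ω, ψ p * T p ∂μHE[N - 1] =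
      -∫ x in Ωᶜ, ψ x * divergence W x := by
  have hm := hΩ.isOpen.measurableSet.compl
  have h0 : ∫ p in frontier Ω, ψ p * T p ∂μHE[N - 1] = 0 :=
    setIntegral_eq_zero_of_forall_eq_zero fun p hp => by
      rw [image_eq_zero_of_notMem_tsupport fun h => hs h hp, zero_mul]
  have hnm : ∀ {x}, x ∈ Ω → x ∉ Ωᶜ := fun hx h => h hx
  have hin : ∀ x ∈ Ω, Ωᶜ.indicator W =ᶠ[𝓝 x] fun _ => 0 := fun x hx => by
    filter_upwards [hΩ.isOpen.mem_nhds hx] with y hy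
    exact indicator_of_notMem (hnm hy) _
  have hout : ∀ x ∉ closure Ω, Ωᶜ.indicator W =ᶠ[𝓝 x] W := fun x hx => by
    filter_upwards [isClosed_closure.isOpen_compl.mem_nhds hx] with y hy
    exact indicator_of_mem (show y ∈ Ωᶜ from fun h => hy (subset_closure h)) _
  have hcases : ∀ x ∉ frontier Ω, x ∈ Ω ∨ x ∉ closure Ω := fun x hx => by
    by_contra! h
    exact hx (by rw [hΩ.isOpen.frontier_eq]; exact ⟨h.2, h.1⟩)
  have key := integral_fderiv_apply_eq_neg hψ hc (W := Ωᶜ.indicator W) fun x hx => by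
    rcases hcases x (hs hx) with h | h
    · exact contDiffAt_const.congr_of_eventuallyEq (hin x h)
    · exact (hW.contDiffAt x h).congr_of_eventuallyEq (hout x h)
  have e1 : ∀ x, Ωᶜ.indicator (fun x => fderiv ℝ ψ x (W x)) x =
      fderiv ℝ ψ x (Ωᶜ.indicator W x) := fun x => by
    by_cases hx : x ∈ Ω
    · rw [indicator_of_notMem (hnm hx), indicator_of_notMem (hnm hx), map_zero]
    · rw [indicator_of_mem (show x ∈ Ωᶜ from hx), indicator_of_mem (show x ∈ Ωᶜ from hx)]
  have e2 : ∀ x, Ωᶜ.indicator (fun x => ψ x * divergence W x) x =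
      ψ x * divergence (Ωᶜ.indicator W) x := fun x => by
    by_cases hxs : x ∈ tsupport ψ
    · rcases hcases x (hs hxs) with h | h
      · rw [indicator_of_notMem (hnm h)]
        simp [divergence, (hin x h).fderiv_eq]
      · rw [indicator_of_mem (show x ∈ Ωᶜ from fun h' => h (subset_closure h'))]
        simp only [divergence, (hout x h).fderiv_eq]
    · rw [image_eq_zero_of_notMem_tsupport hxs, zero_mul]
      by_cases hx : x ∈ Ω
      · exact indicator_of_notMem (hnm hx) _
      · rw [indicator_of_mem (show x ∈ Ωᶜ from hx), image_eq_zero_of_notMem_tsupport hxs, zero_mul]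
  rw [h0, add_zero, ← integral_indicator hm, ← integral_indicator hm]
  simp_rw [e1, e2]
  exact key

/-- The divergence theorem on the exterior of a `C^{1,1}` domain, for vector fields with a normal
trace. A partition of unity reduces it to test functions supported in a chart or off the boundary.
-/
theorem HasNormalTrace.integral_exterior (hW : HasNormalTrace Ω W T) (hΩ : IsBoundedC11Domain Ω)
    (hψ : ContDiff ℝ 1 ψ) (hc : HasCompactSupport ψ) :
    (∫ x in Ωᶜ, fderiv ℝ ψ x (W x)) + ∫ p in frontier Ω, ψ p * T p ∂μHE[N - 1] =
      -∫ x in Ωᶜ, ψ x * divergence W x := by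
  choose! r e φ K hchart using fun x (hx : x ∈ frontier Ω) => hΩ.exists_chart hx
  obtain ⟨t, ht, hcov⟩ := hΩ.isCompact_frontier.elim_nhds_subcover
    (fun x => Metric.ball x (r x / 4)) (fun x hx => Metric.ball_mem_nhds x
      (by linarith [(hchart x hx).pos]))
  let U : Option t → Set (RN N) := fun i =>
    i.elim (frontier Ω)ᶜ (fun x => Metric.ball (x : RN N) (r x / 4))
  obtain ⟨ρ, hρ⟩ := SmoothPartitionOfUnity.exists_isSubordinate (modelWithCornersSelf ℝ (RN N))
    isClosed_univ U (fun i => by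
      rcases i with _ | i
      · exact isClosed_frontier.isOpen_compl
      · exact Metric.isOpen_ball) (fun x _ => by
      rw [mem_iUnion]
      by_cases hx : x ∈ frontier Ω
      · obtain ⟨y, hy, hxy⟩ := mem_iUnion₂.1 (hcov hx)
        exact ⟨some ⟨y, hy⟩, hxy⟩
      · exact ⟨none, hx⟩)
  have hρc : ∀ i, ContDiff ℝ 1 (ρ i) := fun i =>
    ((ρ i).contMDiff.contDiff).of_le (by exact_mod_cast le_top)
  have hρψ : ∀ i, ContDiff ℝ 1 fun x => ρ i x * ψ x := fun i => (hρc i).mul hψ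
  have hρcs : ∀ i, HasCompactSupport fun x => ρ i x * ψ x := fun i => hc.mul_left
  have hρs : ∀ i, tsupport (fun x => ρ i x * ψ x) ⊆ U i := fun i =>
    (tsupport_mul_subset_left).trans (hρ i)
  have hsum : ∀ x, ∑ i, ρ i x = 1 := fun x => by
    rw [← finsum_eq_sum_of_fintype]; exact ρ.sum_eq_one (mem_univ x)
  have hpiece : ∀ i, (∫ x in Ωᶜ, fderiv ℝ (fun x => ρ i x * ψ x) x (W x)) +
      ∫ p in frontier Ω, (ρ i p * ψ p) * T p ∂μHE[N - 1] =
      -∫ x in Ωᶜ, (ρ i x * ψ x) * divergence W x := by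
    intro i
    rcases i with _ | i
    · exact hW.integral_of_disjoint_frontier hΩ (hρψ none) (hρcs none) (hρs none)
    · exact hW.integral_of_subset_chart hΩ (hchart i (ht i i.2)) (hρψ _) (hρcs _) (hρs (some i))
  have hψsum : ψ = fun x => ∑ i, ρ i x * ψ x := by
    ext x; rw [← Finset.sum_mul, hsum, one_mul]
  have e1 : ∀ x, fderiv ℝ ψ x (W x) = ∑ i, fderiv ℝ (fun x => ρ i x * ψ x) x (W x) := by
    intro x
    conv_lhs => rw [hψsum]
    rw [fderiv_fun_sum fun i _ => (hρψ i).differentiable one_ne_zero x, sum_apply]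
  have e2 : ∀ p, ψ p * T p = ∑ i, (ρ i p * ψ p) * T p := fun p => by
    rw [← Finset.sum_mul, ← Finset.sum_mul, hsum, one_mul]
  have e3 : ∀ x, ψ x * divergence W x = ∑ i, (ρ i x * ψ x) * divergence W x := fun x => by
    rw [← Finset.sum_mul, ← Finset.sum_mul, hsum, one_mul]
  simp_rw [e1, e2, e3]
  rw [integral_finsetSum _ fun i _ => hW.integrableOn_fderiv_apply hΩ.isOpen (hρψ i) (hρcs i),
    integral_finsetSum _ fun i _ => hW.integrableOn_mul_divergence hΩ.isOpen (hρψ i).continuous (hρcs i),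
    integral_finsetSum, ← Finset.sum_add_distrib, ← Finset.sum_neg_distrib]
  · exact Finset.sum_congr rfl fun i _ => hpiece i
  · intro i _
    obtain ⟨C, hC⟩ := (hρcs i).exists_bound_of_continuous (hρψ i).continuous
    exact (hW.integrableOn_frontier hΩ).bdd_mul (c := C) (hρψ i).continuous.aestronglyMeasurable
      (Eventually.of_forall hC)

end NormalTrace

/-! ### Normal traces of the two fractional fields -/

section Fields
variable {N : ℕ} {σ μ : ℝ} {Ω : Set (RN N)}

lemma contDiff_fracLap {F : Type*} [NormedAddCommGroup F] [NormedSpace ℝ F] [CompleteSpace F]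
    [NeZero N] (hσ0 : 0 < σ) (hσ1 : σ < 1) (f : 𝓢(RN N, F)) :
    ContDiff ℝ 1 (fracLap σ f) := by
  rw [contDiff_one_iff_fderiv]
  refine ⟨fun x => (hasFDerivAt_fracLap hσ0 hσ1 f x).differentiableAt, ?_⟩
  have : fderiv ℝ (fracLap σ f) = fracLap σ (SchwartzMap.fderivCLM ℝ (RN N) F f) := by
    ext1 x
    exact (hasFDerivAt_fracLap hσ0 hσ1 f x).fderiv
  rw [this]
  exact continuous_fracLap hσ0 hσ1 _

lemma divergence_const_smul (c : ℝ) (W : RN N → RN N) (x : RN N) :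
    divergence (fun z => c • W z) x = c * divergence W x := by
  rw [divergence, show (fun z => c • W z) = c • W from rfl, fderiv_const_smul_field, divergence,
    Finset.mul_sum]
  rfl

lemma continuous_divergence_of_contDiff {W : RN N → RN N} (hW : ContDiff ℝ 1 W) :
    Continuous (divergence W) :=
  continuous_iff_continuousAt.2 fun _ => continuousAt_divergence hW.contDiffAt

lemma tendsto_add_smul_nhds (p q : RN N) : Tendsto (fun t : ℝ => p + t • q) (𝓝[>] 0) (𝓝 p) := by
  have : Continuous fun t : ℝ => p + t • q := by fun_prop
  simpa using (this.tendsto 0).mono_left nhdsWithin_le_nhds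

lemma hasNormalTrace_fracLap [NeZero N] (hΩ : IsBoundedC11Domain Ω) (hσ0 : 0 < σ) (hσ1 : σ < 1)
    (w : 𝓢(RN N, RN N)) :
    HasNormalTrace Ω (fracLap σ w) fun p => inner ℝ (fracLap σ w p) (outerNormal Ω p) := by
  have hC1 := contDiff_fracLap hσ0 hσ1 w
  obtain ⟨K, r, hK, hr, hT⟩ := hΩ.exists_tangentAt
  obtain ⟨C, hC, hCb⟩ := exists_fracLap_bound hσ0 hσ1 w
  refine ⟨fun x _ => hC1.contDiffAt, fun S hS =>
    (hC1.continuous.continuousOn.integrableOn_compact hS).mono_set inter_subset_left, fun S hS =>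
    ((continuous_divergence_of_contDiff hC1).continuousOn.integrableOn_compact hS).mono_set
      inter_subset_left, fun κ _ => ⟨C, 1, one_pos, fun p hp q _ _ t _ _ => ?_⟩,
    fun p _ q _ _ => ?_⟩
  · have := abs_real_inner_le_norm (fracLap σ w (p + t • q)) (outerNormal Ω p)
    rw [(hT p hp).1, mul_one] at this
    exact this.trans (hCb _)
  · exact ((hC1.continuous.tendsto p).comp (tendsto_add_smul_nhds p q)).inner tendsto_const_nhds

/-- For `σ ≥ 1/2` integrability of the divergence forces the normal-normal derivative of `w` to
vanish on the boundary, as otherwise the normal component of the regional integral would blow up. -/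
lemma inner_fderiv_outerNormal_eq_zero [NeZero N] (hΩ : IsBoundedC11Domain Ω) (hσ : 1 / 2 ≤ σ)
    (hσ1 : σ < 1) (w : 𝓢(RN N, RN N))
    (hdiv : IntegrableOn (divergence (regionalIntegral σ Ω w)) Ωᶜ) {p : RN N}
    (hp : p ∈ frontier Ω) :
    inner ℝ (fderiv ℝ w p (outerNormal Ω p)) (outerNormal Ω p) = 0 := by
  have hσ0 : 0 < σ := by linarith
  have hm := hΩ.isOpen.measurableSet
  set lam : RN N → ℝ := fun x => inner ℝ (fderiv ℝ w x (outerNormal Ω x)) (outerNormal Ω x)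
    with hlam
  by_contra hne
  change lam p ≠ 0 at hne
  obtain ⟨τ, hτ, hτp⟩ : ∃ τ : ℝ, |τ| = 1 ∧ τ * lam p = |lam p| := by
    rcases lt_or_gt_of_ne hne with h | h
    · exact ⟨-1, by simp, by rw [abs_of_neg h]; ring⟩
    · exact ⟨1, by simp, by rw [abs_of_pos h]; ring⟩
  set δ := |lam p| / 2
  have hδ : 0 < δ := by positivity
  have hlamc : ContinuousWithinAt lam (frontier Ω) p := by
    have h1 : Continuous (fderiv ℝ w) := (w.smooth 1).continuous_fderiv one_ne_zero
    have h2 := hΩ.continuousOn_outerNormal p hp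
    exact (h1.continuousAt.continuousWithinAt.clm_apply h2).inner h2
  have hev : ∀ᶠ x in 𝓝[frontier Ω] p, δ < τ * lam x := by
    have : δ < τ * lam p := by
      rw [hτp]; exact half_lt_self (abs_pos.2 hne)
    exact (hlamc.const_mul τ).eventually_const_lt this
  obtain ⟨ρ, hρ, hρsub⟩ := Metric.mem_nhdsWithin_iff.1 hev
  obtain ⟨r₀, e, φ, L, hchart₀⟩ := hΩ.exists_chart hp
  have hchart := hchart₀.mono (r' := min r₀ ρ) (lt_min hchart₀.pos hρ) (min_le_left _ _)
  set r := min r₀ ρ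
  obtain ⟨M, hM1, hM⟩ := hchart.exists_norm_graphNormal_le
  obtain ⟨K, r₁, hK, hr₁, hT⟩ := hΩ.exists_tangentAt
  have hMi : 0 < M⁻¹ := by positivity
  obtain ⟨C, hC, hCb⟩ := exists_abs_inner_regionalIntegral_sub_le hσ0 hσ1
    (Or.inl rfl : ModelWeight σ 1) hK hMi hr₁ w
  -- The sign `τ` makes the coefficient of the model positive near `p`.
  refine hchart.not_blowup hΩ.isOpen hp (W := fun x => τ • regionalIntegral σ Ω w x)
    (fun x hx => (contDiffAt_regionalIntegral hm hΩ.isBounded hx w).const_smul τ)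
    ((integrableOn_regionalIntegral w (hΩ.integrableOn_kernelMajorant hσ0 hσ1)).smul τ) ?_ ?_
  · refine (hdiv.const_mul τ).congr (Eventually.of_forall fun x => ?_)
    exact (divergence_const_smul τ _ x).symm
  · intro B
    obtain ⟨d₀, hd₀, hI⟩ := exists_halfSpaceIntegral_ge (N := N) hσ ((|B| + C) / δ)
    refine ⟨min (d₀ / 2) (min (r₁ / 2) (M⁻¹ / (8 * K))), by positivity, fun x' hx' t ht htt => ?_⟩
    have ht1 : t ≤ d₀ / 2 := htt.trans (min_le_left _ _)
    have ht2 : t ≤ r₁ / 2 := htt.trans ((min_le_right _ _).trans (min_le_left _ _))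
    have ht3 : t ≤ M⁻¹ / (8 * K) := htt.trans ((min_le_right _ _).trans (min_le_right _ _))
    rw [le_div_iff₀ (by positivity)] at ht3
    have hxr : graphMap e φ x' ∈ Metric.ball p r :=
      Metric.ball_subset_ball (by linarith [hchart.pos]) hx'
    obtain ⟨h1, h2⟩ := hchart.outerNormal_graphMap hΩ.isOpen hx'
    have h3 := hM x' hxr
    have h4 := one_le_norm_graphNormal hchart.norm_e φ x'
    have hfr := hchart.graphMap_mem_frontier hΩ.isOpen hxr
    set x := graphMap e φ x'
    set n := outerNormal Ω x
    obtain ⟨hn, hTx⟩ := hT x hfr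
    have hb := hCb Ω x n n e t hm hTx hn hn.le hchart.norm_e.le
      (by rw [h2]; exact inv_anti₀ (by positivity) h3) ht (by linarith) (by linarith)
    have hle : inner ℝ e n ≤ (1 : ℝ) := by rw [h2]; exact inv_le_one_of_one_le₀ h4
    have hpos : (0 : ℝ) < inner ℝ e n := by rw [h2]; positivity
    have hI' := hI n hn (t * inner ℝ e n) (mul_pos ht hpos) (by nlinarith)
    have hlx : δ < τ * lam x := hρsub ⟨Metric.ball_subset_ball (min_le_right _ _) hxr, hfr⟩
    rw [div_le_iff₀ hδ] at hI'
    set I := halfSpaceIntegral σ n (t * inner ℝ e n)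
    set R := inner ℝ (regionalIntegral σ Ω w (x + t • e)) n
    have hlxe : inner ℝ (fderiv ℝ w x n) n = lam x := rfl
    rw [hlxe, one_mul] at hb
    have hI0 : 0 ≤ I := by
      have : 0 ≤ |B| + C := by positivity
      by_contra! hneg
      nlinarith
    have hτb : |τ * R - τ * (lam x * I)| ≤ C := by
      rw [← mul_sub, abs_mul, hτ, one_mul]; exact hb
    have h5 : |B| ≤ τ * R := by
      have := (abs_le.1 hτb).1
      have h6 : I * δ ≤ τ * (lam x * I) := by nlinarith
      linarith
    rw [h1, inner_smul_right, real_inner_smul_left]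
    calc B ≤ 1 * |B| := by rw [one_mul]; exact le_abs_self B
      _ ≤ ‖graphNormal e φ x'‖ * (τ * R) := by gcongr

/-- Once the coefficient of the singular model vanishes on the boundary, the regional integral has a
normal trace. -/
lemma hasNormalTrace_regionalIntegral [NeZero N] (hΩ : IsBoundedC11Domain Ω) (hσ0 : 0 < σ)
    (hσ1 : σ < 1) (hμ : ModelWeight σ μ) (w : 𝓢(RN N, RN N))
    (hdiv : IntegrableOn (divergence (regionalIntegral σ Ω w)) Ωᶜ)
    (h0 : ∀ p ∈ frontier Ω,
      μ * inner ℝ (fderiv ℝ w p (outerNormal Ω p)) (outerNormal Ω p) = 0) :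
    HasNormalTrace Ω (regionalIntegral σ Ω w) fun p =>
      regionalTrace σ μ Ω w p (outerNormal Ω p) (outerNormal Ω p) := by
  have hm := hΩ.isOpen.measurableSet
  obtain ⟨K, r, hK, hr, hT⟩ := hΩ.exists_tangentAt
  refine ⟨fun x hx => contDiffAt_regionalIntegral hm hΩ.isBounded hx w, fun S _ =>
    (integrableOn_regionalIntegral w (hΩ.integrableOn_kernelMajorant hσ0 hσ1)).mono_set
      inter_subset_right, fun S _ => hdiv.mono_set inter_subset_right, fun κ hκ => ?_,
    fun p hp q hq hqn => ?_⟩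
  · obtain ⟨C, hC, hCb⟩ := exists_abs_inner_regionalIntegral_sub_le hσ0 hσ1 hμ hK hκ hr w
    refine ⟨C, min (r / 2) (κ / (8 * K)), by positivity, fun p hp q hq hqn t ht htt => ?_⟩
    have ht2 : t ≤ r / 2 := htt.trans (min_le_left _ _)
    have ht3 : t ≤ κ / (8 * K) := htt.trans (min_le_right _ _)
    rw [le_div_iff₀ (by positivity)] at ht3
    have := hCb Ω p _ _ q t hm (hT p hp).2 (hT p hp).1 (hT p hp).1.le hq hqn ht (by linarith)
      (by linarith)
    rwa [← mul_assoc, h0 p hp, zero_mul, sub_zero] at this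
  · exact tendsto_inner_regionalIntegral hσ0 hσ1 hμ hK hr w hm (hT p hp).2 (hT p hp).1
      (hT p hp).1.le hq hqn (h0 p hp)

/-- The model may be dropped when it is integrable, and its coefficient vanishes otherwise. -/
lemma exists_modelWeight [NeZero N] (hΩ : IsBoundedC11Domain Ω) (hσ1 : σ < 1)
    (w : 𝓢(RN N, RN N)) (hdiv : IntegrableOn (divergence (regionalIntegral σ Ω w)) Ωᶜ) :
    ∃ μ, ModelWeight σ μ ∧ ∀ p ∈ frontier Ω,
      μ * inner ℝ (fderiv ℝ w p (outerNormal Ω p)) (outerNormal Ω p) = 0 := by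
  rcases lt_or_ge σ (1 / 2) with h | h
  · exact ⟨0, Or.inr ⟨rfl, h⟩, fun p _ => zero_mul _⟩
  · exact ⟨1, Or.inl rfl, fun p hp => by
      rw [inner_fderiv_outerNormal_eq_zero hΩ h hσ1 w hdiv hp, mul_zero]⟩

end Fields

/-! ### The normalization constant, approximation, and the identity -/

section FracConst
variable {N : ℕ}

/-- The integral that defines the normalization constant converges and is positive. -/
lemma fracConst_ne_zero [NeZero N] {σ : ℝ} (hσ0 : 0 < σ) (hσ1 : σ < 1) : fracConst N σ ≠ 0 := by
  set f : RN N → ℝ := fun ξ => (1 - Real.cos (ξ 0)) / ‖ξ‖ ^ ((N : ℝ) + 2 * σ)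
  have hnn : 0 ≤ f := fun ξ =>
    div_nonneg (by linarith [Real.cos_le_one (ξ 0)]) (by positivity)
  have hint : Integrable f := by
    refine ((integrable_kernelMajorant (N := N) (β := 2) hσ0 (by linarith)).const_mul 2).mono'
      (Measurable.aestronglyMeasurable (by fun_prop)) ?_
    filter_upwards [Measure.ae_ne volume (0 : RN N)] with ξ hξ
    rw [Real.norm_of_nonneg (hnn ξ)]
    have h1 : |ξ 0| ≤ ‖ξ‖ := PiLp.norm_apply_le ξ 0
    have h2 : (ξ 0) ^ 2 ≤ ‖ξ‖ ^ 2 := by rw [← sq_abs]; gcongr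
    have := mul_fracKernel_le_kernelMajorant (σ := σ) (β := 2) hξ (a := (1 - Real.cos (ξ 0)) / 2)
      (by linarith [Real.neg_one_le_cos (ξ 0)]) (by
        rw [Real.rpow_two]
        nlinarith [Real.one_sub_sq_div_two_le_cos (x := ξ 0), sq_nonneg ‖ξ‖])
    calc f ξ = 2 * ((1 - Real.cos (ξ 0)) / 2 * fracKernel σ ξ) := by
          simp only [f, fracKernel]; ring
      _ ≤ _ := by gcongr
  have hpos : 0 < ∫ ξ, f ξ := by
    rw [integral_pos_iff_support_of_nonneg hnn hint]
    have ho : IsOpen ({ξ : RN N | 0 < ξ 0} ∩ {ξ | ξ 0 < Real.pi}) :=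
      (isOpen_lt (by fun_prop) (by fun_prop)).inter (isOpen_lt (by fun_prop) (by fun_prop))
    refine lt_of_lt_of_le (ho.measure_pos volume ⟨EuclideanSpace.single 0 1, ?_, ?_⟩)
      (measure_mono ?_)
    · simp
    · simpa using (by linarith [Real.pi_gt_three] : 1 < Real.pi)
    · rintro ξ ⟨h1, h2⟩
      have h3 := Real.cos_lt_cos_of_nonneg_of_le_pi le_rfl h2.le h1
      rw [Real.cos_zero] at h3
      have h4 : ξ ≠ 0 := by rintro rfl; simp at h1
      have h5 : 0 < ‖ξ‖ := norm_pos_iff.2 h4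
      exact (div_pos (by linarith) (by positivity)).ne'
  exact inv_ne_zero hpos.ne'

end FracConst

section Approximation
variable {N : ℕ}

/-- A Schwartz function is the limit of compactly supported functions that are bounded together with
their differentials and locally eventually agree with it. -/
lemma exists_compactSupport_approx (v : 𝓢(RN N, ℝ)) : ∃ (ψ : ℕ → RN N → ℝ) (C : ℝ),
    (∀ k, ContDiff ℝ 1 (ψ k)) ∧ (∀ k, HasCompactSupport (ψ k)) ∧ (∀ k x, ‖ψ k x‖ ≤ C) ∧
    (∀ k x, ‖fderiv ℝ (ψ k) x‖ ≤ C) ∧ ∀ x, ∀ᶠ k in atTop, ψ k =ᶠ[𝓝 x] v := by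
  let b : ContDiffBump (0 : RN N) := ⟨1, 2, one_pos, one_lt_two⟩
  have hb : ContDiff ℝ 1 b := b.contDiff
  obtain ⟨B, hB⟩ := (b.hasCompactSupport.fderiv ℝ).exists_bound_of_continuous
    (hb.continuous_fderiv one_ne_zero)
  obtain ⟨C, hC, h0, h1, -⟩ := v.exists_taylor_bounds
  have hv : ContDiff ℝ 1 v := v.smooth 1
  have hB0 : 0 ≤ B := (norm_nonneg _).trans (hB 0)
  set a : ℕ → ℝ := fun k => ((k : ℝ) + 1)⁻¹
  have ha : ∀ k, 0 < a k := fun k => by positivity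
  have ha1 : ∀ k, a k ≤ 1 := fun k =>
    inv_le_one_of_one_le₀ (by linarith [(Nat.cast_nonneg k : (0 : ℝ) ≤ k)])
  have hθ : ∀ k, ContDiff ℝ 1 fun x : RN N => b (a k • x) := fun k => hb.comp (contDiff_const_smul _)
  refine ⟨fun k x => b (a k • x) * v x, C + C * B, fun k => (hθ k).mul hv, fun k =>
    HasCompactSupport.mul_right (b.hasCompactSupport.comp_smul (ha k).ne'), fun k x => ?_,
    fun k x => ?_, fun x => ?_⟩
  · rw [norm_mul, Real.norm_of_nonneg b.nonneg]
    have := mul_le_mul b.le_one (h0 x) (norm_nonneg _) zero_le_one (a := b (a k • x))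
    nlinarith [mul_nonneg hC.le hB0]
  · have d1 : HasFDerivAt (fun x : RN N => b (a k • x))
        ((fderiv ℝ b (a k • x)).comp (a k • ContinuousLinearMap.id ℝ (RN N))) x :=
      (hb.differentiable one_ne_zero _).hasFDerivAt.comp x ((hasFDerivAt_id x).const_smul (a k))
    have d2 : HasFDerivAt (fun x : RN N => b (a k • x) * v x) _ x :=
      d1.mul (hv.differentiable one_ne_zero x).hasFDerivAt
    rw [d2.fderiv]
    refine (norm_add_le _ _).trans (add_le_add ?_ ?_)
    · rw [norm_smul, Real.norm_of_nonneg b.nonneg]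
      exact (mul_le_mul b.le_one (h1 x) (norm_nonneg _) zero_le_one).trans (one_mul C).le
    · rw [norm_smul]
      refine mul_le_mul (h0 x) ?_ (norm_nonneg _) hC.le
      rw [ContinuousLinearMap.comp_smul, ContinuousLinearMap.comp_id, norm_smul,
        Real.norm_of_nonneg (ha k).le]
      exact (mul_le_mul (ha1 k) (hB _) (norm_nonneg _) zero_le_one).trans (one_mul B).le
  · obtain ⟨n, hn⟩ := exists_nat_gt (‖x‖ + 1)
    filter_upwards [eventually_ge_atTop n] with k hk
    filter_upwards [Metric.ball_mem_nhds x one_pos] with y hy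
    rw [b.one_of_mem_closedBall, one_mul]
    have h2 : ‖y‖ ≤ k := by
      rw [Metric.mem_ball, dist_eq_norm] at hy
      have := norm_sub_norm_le y x
      have : (n : ℝ) ≤ k := by exact_mod_cast hk
      linarith
    rw [mem_closedBall_zero_iff, norm_smul, Real.norm_of_nonneg (ha k).le]
    change ((k : ℝ) + 1)⁻¹ * ‖y‖ ≤ 1
    rw [inv_mul_le_iff₀ (by positivity)]
    linarith

lemma aestronglyMeasurable_fderiv_apply {ψ : RN N → ℝ} (hψ : ContDiff ℝ 1 ψ) {W : RN N → RN N}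
    {ν : Measure (RN N)} (hW : AEStronglyMeasurable W ν) :
    AEStronglyMeasurable (fun x => fderiv ℝ ψ x (W x)) ν :=
  (ContinuousLinearMap.apply ℝ ℝ : RN N →L[ℝ] _).flip.aestronglyMeasurable_comp₂
    (hψ.continuous_fderiv one_ne_zero).aestronglyMeasurable hW

variable {ψ : ℕ → RN N → ℝ} {v : RN N → ℝ} {C : ℝ} {ν : Measure (RN N)}

lemma tendsto_integral_mul_approx (hψ : ∀ k, ContDiff ℝ 1 (ψ k)) (hb : ∀ k x, ‖ψ k x‖ ≤ C)
    (hv : ∀ x, ∀ᶠ k in atTop, ψ k =ᶠ[𝓝 x] v) {f : RN N → ℝ} (hf : Integrable f ν) :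
    Tendsto (fun k => ∫ x, ψ k x * f x ∂ν) atTop (𝓝 (∫ x, v x * f x ∂ν)) := by
  refine tendsto_integral_of_dominated_convergence (fun x => C * ‖f x‖) (fun k =>
    (hψ k).continuous.aestronglyMeasurable.mul hf.aestronglyMeasurable) (hf.norm.const_mul C)
    (fun k => Eventually.of_forall fun x => ?_) (Eventually.of_forall fun x => ?_)
  · rw [norm_mul]; gcongr; exact hb k x
  · refine tendsto_const_nhds.congr' ?_
    filter_upwards [hv x] with k hk
    rw [hk.eq_of_nhds]

lemma tendsto_integral_fderiv_approx (hψ : ∀ k, ContDiff ℝ 1 (ψ k))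
    (hb : ∀ k x, ‖fderiv ℝ (ψ k) x‖ ≤ C) (hv : ∀ x, ∀ᶠ k in atTop, ψ k =ᶠ[𝓝 x] v)
    {W : RN N → RN N} (hW : Integrable W ν) :
    Tendsto (fun k => ∫ x, fderiv ℝ (ψ k) x (W x) ∂ν) atTop (𝓝 (∫ x, fderiv ℝ v x (W x) ∂ν)) := by
  refine tendsto_integral_of_dominated_convergence (fun x => C * ‖W x‖) (fun k =>
    aestronglyMeasurable_fderiv_apply (hψ k) hW.aestronglyMeasurable) (hW.norm.const_mul C)
    (fun k => Eventually.of_forall fun x => ?_) (Eventually.of_forall fun x => ?_)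
  · exact (ContinuousLinearMap.le_opNorm _ _).trans (by gcongr; exact hb k x)
  · refine tendsto_const_nhds.congr' ?_
    filter_upwards [hv x] with k hk
    rw [hk.fderiv_eq]

end Approximation

section Identity
variable {N : ℕ} {Ω : Set (RN N)}

/-- The divergence theorem for a field that is given by `V` in `Ω` and by `W` outside: the boundary
term is the jump of the normal component. -/
lemma integral_jump_of_hasCompactSupport (hΩ : IsBoundedC11Domain Ω) {V W : RN N → RN N}
    {TV TW : RN N → ℝ} (hV : ContDiff ℝ 1 V) (hVT : HasNormalTrace Ω V TV)
    (hWT : HasNormalTrace Ω W TW) {ψ : RN N → ℝ} (hψ : ContDiff ℝ 1 ψ)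
    (hc : HasCompactSupport ψ) :
    (∫ x in Ω, fderiv ℝ ψ x (V x)) + ∫ x in Ωᶜ, fderiv ℝ ψ x (W x) =
      -(∫ x in Ω, ψ x * divergence V x) - (∫ x in Ωᶜ, ψ x * divergence W x) +
        ∫ p in frontier Ω, ψ p * (TV p - TW p) ∂μHE[N - 1] := by
  have hm := hΩ.isOpen.measurableSet
  have h1 := hVT.integral_exterior hΩ hψ hc
  have h2 := hWT.integral_exterior hΩ hψ hc
  have h3 := integral_fderiv_apply_eq_neg hψ hc fun x _ => hV.contDiffAt (x := x)
  have i1 : Integrable fun x => fderiv ℝ ψ x (V x) :=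
    ((hψ.continuous_fderiv one_ne_zero).clm_apply hV.continuous).integrable_of_hasCompactSupport
      (hc.fderiv ℝ |>.mono fun x hx h => hx (by simp [h]))
  have i2 : Integrable fun x => ψ x * divergence V x :=
    (hψ.continuous.mul (continuous_divergence_of_contDiff hV)).integrable_of_hasCompactSupport
      hc.mul_right
  rw [← integral_add_compl hm i1, ← integral_add_compl hm i2] at h3
  have i3 : ∀ {T : RN N → ℝ}, IntegrableOn T (frontier Ω) μHE[N - 1] →
      IntegrableOn (fun p => ψ p * T p) (frontier Ω) μHE[N - 1] := fun {T} hT => by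
    obtain ⟨C, hC⟩ := hc.exists_bound_of_continuous hψ.continuous
    exact hT.bdd_mul (c := C) hψ.continuous.aestronglyMeasurable (Eventually.of_forall hC)
  have h4 : ∫ p in frontier Ω, ψ p * (TV p - TW p) ∂μHE[N - 1] =
      (∫ p in frontier Ω, ψ p * TV p ∂μHE[N - 1]) - ∫ p in frontier Ω, ψ p * TW p ∂μHE[N - 1] := by
    rw [← integral_sub (i3 (hVT.integrableOn_frontier hΩ)) (i3 (hWT.integrableOn_frontier hΩ))]
    simp_rw [mul_sub]
  rw [h4]
  linarith

/-- The jump formula for Schwartz test functions, which requires integrability of the exterior field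
and of its divergence at infinity. -/
lemma integral_jump (hΩ : IsBoundedC11Domain Ω) {V W : RN N → RN N}
    {TV TW : RN N → ℝ} (hV : ContDiff ℝ 1 V) (hVT : HasNormalTrace Ω V TV)
    (hWT : HasNormalTrace Ω W TW) (hW : IntegrableOn W Ωᶜ) (hdW : IntegrableOn (divergence W) Ωᶜ)
    (v : 𝓢(RN N, ℝ)) :
    (∫ x in Ω, fderiv ℝ v x (V x)) + ∫ x in Ωᶜ, fderiv ℝ v x (W x) =
      -(∫ x in Ω, v x * divergence V x) - (∫ x in Ωᶜ, v x * divergence W x) +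
        ∫ p in frontier Ω, v p * (TV p - TW p) ∂μHE[N - 1] := by
  obtain ⟨ψ, C, hψ, hc, hb, hb', hv⟩ := exists_compactSupport_approx v
  have hcl : IsCompact (closure Ω) := hΩ.isBounded.isCompact_closure
  have i1 : IntegrableOn V Ω :=
    (hV.continuous.continuousOn.integrableOn_compact hcl).mono_set subset_closure
  have i2 : IntegrableOn (divergence V) Ω :=
    ((continuous_divergence_of_contDiff hV).continuousOn.integrableOn_compact hcl).mono_set
      subset_closure
  have i3 : IntegrableOn (fun p => TV p - TW p) (frontier Ω) μHE[N - 1] :=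
    (hVT.integrableOn_frontier hΩ).sub (hWT.integrableOn_frontier hΩ)
  have l1 := (tendsto_integral_fderiv_approx hψ hb' hv i1).add
    (tendsto_integral_fderiv_approx hψ hb' hv hW)
  have l2 := (((tendsto_integral_mul_approx hψ hb hv i2).neg).sub
    (tendsto_integral_mul_approx hψ hb hv hdW)).add (tendsto_integral_mul_approx hψ hb hv i3)
  refine tendsto_nhds_unique l1 (l2.congr fun k => ?_)
  exact (integral_jump_of_hasCompactSupport hΩ hV hVT hWT (hψ k) (hc k)).symm

end Identity

end

theorem proposition2p6 (N : ℕ) [NeZero N] (Ω : Set (RN N)) (hΩ : IsBoundedC11Domain Ω)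
    (σ s : ℝ) (hσ0 : 0 < σ) (hσ1 : σ < 1) (hs : s = 1 + σ) (u v : 𝓢(RN N, ℝ))
    (hu : IntegrableOn (divergence (regionalFracLaplacian σ Ω (gradient u))) Ωᶜ) :
    (∀ x ∈ frontier Ω,
      Tendsto (normalProfile σ Ω u x) (𝓝[≠] (0 : ℝ)) (𝓝 (neumannTwo σ Ω u x))) ∧
    IntegrableOn (energyIntegrand σ u v) (crossSet Ω) ∧
    IntegrableOn (fun x => v x * higherFracLaplacian s u x) Ω ∧
    IntegrableOn (fun x => v x * neumannOne σ Ω u x) Ωᶜ ∧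
    IntegrableOn (fun x => v x * neumannTwo σ Ω u x) (frontier Ω) μHE[N - 1] ∧
    fracConst N σ / 2 * ∫ p in crossSet Ω, energyIntegrand σ u v p =
      (∫ x in Ω, v x * higherFracLaplacian s u x) +
      (∫ x in Ωᶜ, v x * neumannOne σ Ω u x) +
      ∫ x in frontier Ω, v x * neumannTwo σ Ω u x ∂μHE[N - 1] := by
  subst hs
  have hm := hΩ.isOpen.measurableSet
  set c := fracConst N σ with hcdef
  have hc0 : c ≠ 0 := fracConst_ne_zero hσ0 hσ1
  set w := schwartzGradient u
  have hw : ⇑w = gradient u := coe_schwartzGradient u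
  have hvol : volume Ω ≠ ⊤ := hΩ.isBounded.measure_lt_top.ne
  have hper := hΩ.integrableOn_kernelMajorant hσ0 hσ1
  -- Off the closure of `Ω` the regional operator is the absolutely convergent integral.
  have hdivR : ∀ᵐ x ∂volume.restrict Ωᶜ, divergence (regionalFracLaplacian σ Ω (gradient u)) x =
      c * divergence (regionalIntegral σ Ω w) x := by
    rw [ae_restrict_iff' hm.compl]
    filter_upwards [measure_eq_zero_iff_ae_notMem.1 hΩ.volume_frontier] with x hx hxc
    have hx' : x ∉ closure Ω := fun h => hx (by rw [hΩ.isOpen.frontier_eq]; exact ⟨h, hxc⟩)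
    rw [← divergence_const_smul, divergence, divergence, Filter.EventuallyEq.fderiv_eq]
    filter_upwards [isClosed_closure.isOpen_compl.mem_nhds hx'] with y hy
    rw [← hw, regionalFracLaplacian_of_notMem hσ0 hm hy w]
  have hdiv : IntegrableOn (divergence (regionalIntegral σ Ω w)) Ωᶜ := by
    refine (hu.const_mul c⁻¹).congr ?_
    filter_upwards [hdivR] with x hx
    rw [hx, ← mul_assoc, inv_mul_cancel₀ hc0, one_mul]
  obtain ⟨μ, hμ, h0⟩ := exists_modelWeight hΩ hσ1 w hdiv
  have hRT := hasNormalTrace_regionalIntegral hΩ hσ0 hσ1 hμ w hdiv h0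
  have hVT := hasNormalTrace_fracLap hΩ hσ0 hσ1 w
  have hV := contDiff_fracLap hσ0 hσ1 w
  obtain ⟨K, r, hK, hr, hT⟩ := hΩ.exists_tangentAt
  set J : RN N → ℝ := fun p => inner ℝ (fracLap σ w p) (outerNormal Ω p) -
    regionalTrace σ μ Ω w p (outerNormal Ω p) (outerNormal Ω p) with hJ
  have hlim : ∀ p ∈ frontier Ω, Tendsto (normalProfile σ Ω u p) (𝓝[≠] 0) (𝓝 (c * J p)) :=
    fun p hp => by
      have := tendsto_normalProfile hσ0 hσ1 hμ hK hr u hΩ.isOpen (hT p hp).2 (hT p hp).1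
        (by rw [← hw]; exact h0 p hp)
      rwa [← hw] at this
  have hN2 : ∀ p ∈ frontier Ω, neumannTwo σ Ω u p = c * J p := fun p hp => (hlim p hp).limUnder_eq
  have hJi : IntegrableOn J (frontier Ω) μHE[N - 1] :=
    (hVT.integrableOn_frontier hΩ).sub (hRT.integrableOn_frontier hΩ)
  have hhigh : ∀ x, higherFracLaplacian (1 + σ) u x = -(c * divergence (fracLap σ w) x) := fun x => by
    rw [higherFracLaplacian_eq hσ0 hσ1, divergence_const_smul, hw]
  have hN1 : (fun x => v x * neumannOne σ Ω u x) =ᵐ[volume.restrict Ωᶜ]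
      fun x => -c * (v x * divergence (regionalIntegral σ Ω w) x) := by
    filter_upwards [hdivR] with x hx
    rw [neumannOne, hx]; ring
  have hN2' : ∀ p ∈ frontier Ω, v p * neumannTwo σ Ω u p = c * (v p * J p) := fun p hp => by
    rw [hN2 p hp]; ring
  have hh : ∀ x, v x * higherFracLaplacian (1 + σ) u x =
      -c * (v x * divergence (fracLap σ w) x) := fun x => by rw [hhigh]; ring
  obtain ⟨C, hC, hvb, -⟩ := v.exists_taylor_bounds
  have hmul : ∀ {ν : Measure (RN N)} {f : RN N → ℝ}, Integrable f ν →
      Integrable (fun x => v x * f x) ν := fun hf =>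
    hf.bdd_mul (c := C) v.continuous.aestronglyMeasurable (Eventually.of_forall hvb)
  have hfrm : MeasurableSet (frontier Ω) := isClosed_frontier.measurableSet
  have hdV : IntegrableOn (divergence (fracLap σ w)) Ω :=
    ((continuous_divergence_of_contDiff hV).continuousOn.integrableOn_compact
      hΩ.isBounded.isCompact_closure).mono_set subset_closure
  refine ⟨fun p hp => by rw [hN2 p hp]; exact hlim p hp,
    integrableOn_energyIntegrand hσ0 hσ1 u v hm hvol, ?_, ?_, ?_, ?_⟩
  · simp_rw [hh]
    exact (hmul hdV).const_mul _
  · exact ((hmul hdiv).const_mul (-c)).congr hN1.symm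
  · refine ((hmul hJi).const_mul c).congr ?_
    filter_upwards [ae_restrict_mem hfrm] with p hp using (hN2' p hp).symm
  · have hE := setIntegral_energyIntegrand hσ0 hσ1 u v hm hvol hper
    have key := integral_jump hΩ hV hVT hRT (integrableOn_regionalIntegral w hper) hdiv v
    simp_rw [inner_gradient, ← hw] at hE
    simp_rw [hh]
    rw [integral_congr_ae hN1, setIntegral_congr_fun hfrm hN2', integral_const_mul,
      integral_const_mul, integral_const_mul]
    linear_combination c * hE + c * key
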